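/- Let $R$ be a commutative Noetherian ring. All modules are finitely generated, and all subcategories of the category $\mathrm{mod}(R)$ of finitely generated $R$-modules are full and closed under isomorphism. A subcategory $\mathcal M$ is \emph{resolving} if $R\in\mathcal M$; $X\oplus Y\in\mathcal M$ if and only if $X,Y\in\mathcal M$; and for every exact sequence $0\to X\to Y\to Z\to 0$ with $Z\in\mathcal M$ one has $Y\in\mathcal M$ if and only if $X\in\mathcal M$. Let $\operatorname{res}(\mathcal P)$ be the smallest resolving subcategory containing $\mathcal P$. A resolving subcategory $\mathcal M\subseteq\mathcal N$ is \emph{thick in} $\mathcal N$ if for every exact sequence $0\to X\to Y\to Z\to 0$ with $X,Y\in\mathcal M$ and $Z\in\mathcal N$ one has $Z\in\mathcal M$. For $\mathcal A\subseteq\mathcal M$, $\mathcal A$ \emph{cogenerates} $\mathcal M$ if every $X\in\mathcal M$ fits into an exact sequence $0\to X\to A\to X'\to0$ with $A\in\mathcal A$ and $X'\in\mathcal M$. Let $\operatorname{add}\mathcal M$ be the smallest subcategory containing $\mathcal M$ that is closed under finite direct sums and direct summands, and let $\mathcal M_p=\{X_p\mid X\in\mathcal M\}$ for $p\in\operatorname{Spec}R$.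 The dimension $\mathcal M\text{-}\dim X\in\mathbb N\cup\{\infty\}$ is the least $n$ such that there is an exact sequence $0\to M_n\to\cdots\to M_0\to X\to0$ with all $M_i\in\mathcal M$ ($\infty$ if there is none). Put $\Delta(\mathcal M)=\{X\mid\mathcal M\text{-}\dim X<\infty\}$, and let $\mathfrak R(\mathcal M)$ be the collection of resolving subcategories $\mathcal X$ with $\mathcal M\subseteq\mathcal X\subseteq\Delta(\mathcal M)$. Let $\Gamma$ be the set of \emph{grade consistent} functions, i.e. the functions $f:\operatorname{Spec}R\to\mathbb N$ with $f(p)\le f(q)$ whenever $p\subseteq q$ and with $f(p)\le\operatorname{grade}(p)$ for all $p$, where $\operatorname{grade}(p)$ is the supremum of the lengths of the $R$-regular sequences in $p$. For $f\in\Gamma$ and subcategories $\mathcal M,\mathcal X$ put \[\Lambda_{\mathcal M}(f)=\{X\in\mathrm{mod}(R)\mid \operatorname{add}\mathcal M_p\text{-}\dim X_p\le f(p)\ \text{for all } p\in\operatorname{Spec}R\},\qquad \Phi_{\mathcal M}(\mathcal X)(p)=\sup\{\operatorname{add}\mathcal M_p\text{-}\dim X_p\mid X\in\mathcal X\}.\]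 Let $C$ be a semidualizing $R$-module, i.e. a finitely generated module with $\operatorname{Ext}^{i}_R(C,C)=0$ for all $i>0$ for which $R\to\operatorname{Hom}_R(C,C)$, $r\mapsto(c\mapsto rc)$, is an isomorphism. Write $X^\dagger=\operatorname{Hom}_R(X,C)$ and let $\mathcal G_C$ be the category of totally $C$-reflexive modules, i.e. of those $X$ with $\operatorname{Ext}_R^{i}(X,C)=0=\operatorname{Ext}_R^{i}(X^\dagger,C)$ for all $i>0$ for which the evaluation map $X\to X^{\dagger\dagger}$ is an isomorphism. There is a smallest thick subcategory $\mathcal A$ of $\mathcal G_C$ containing $C$. Let $\mathfrak S(C)$ be the collection of resolving subcategories $\mathcal M\supseteq\mathcal A$ such that $\mathcal A$ cogenerates $\mathcal M$ and $\operatorname{add}\mathcal A_p$ is thick in $\operatorname{add}\mathcal M_p$ for all $p\in\operatorname{Spec}R$. Then: (1) Every thick subcategory of $\mathcal G_C$ containing $C$ belongs to $\mathfrak S(C)$. (2) For every $\mathcal M\in\mathfrak S(C)$, $\Lambda_{\mathcal M}:\Gamma\to\mathfrak R(\mathcal M)$ and $\Phi_{\mathcal M}:\mathfrak R(\mathcal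 M)\to\Gamma$ are well-defined and mutually inverse bijections. (3) The map $\Lambda:\mathfrak S(C)\times\Gamma\to\bigcup_{\mathcal M\in\mathfrak S(C)}\mathfrak R(\mathcal M)$, $(\mathcal M,f)\mapsto\Lambda_{\mathcal M}(f)$, is a bijection. (4) For $\mathcal M,\mathcal N\in\mathfrak S(C)$ with $\mathcal M\subseteq\mathcal N$, the maps $\eta_{\mathcal M}^{\mathcal N}:\mathfrak R(\mathcal M)\to\mathfrak R(\mathcal N)$, $\mathcal X\mapsto\operatorname{res}(\mathcal X\cup\mathcal N)$, and $\rho_{\mathcal M}^{\mathcal N}:\mathfrak R(\mathcal N)\to\mathfrak R(\mathcal M)$, $\mathcal X\mapsto\mathcal X\cap\Delta(\mathcal M)$, are well-defined and inverse to each other, and $\Phi_{\mathcal N}\circ\eta_{\mathcal M}^{\mathcal N}=\Phi_{\mathcal M}$ and $\Phi_{\mathcal M}\circ\rho_{\mathcal M}^{\mathcal N}=\Phi_{\mathcal N}$. In particular $\Phi_{\mathcal M}\circ\eta_{\mathcal A}^{\mathcal M}=\Phi_{\mathcal A}$ on $\mathfrak R(\mathcal A)$ for every $\mathcal M\in\mathfrak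 S(C)$. -/

import Mathlib

open CategoryTheory

universe u

namespace ResolvingSubcat

noncomputable section

variable {R : Type u} [CommRing R]

/-! Full subcategories of the category of finitely generated `R`-modules are encoded as predicates
on `ModuleCat R` that imply finite generation and are invariant under isomorphism. -/

/-- Resolving subcategories of the category of finitely generated `R`-modules. -/
structure IsResolving (M : ObjectProperty (ModuleCat.{u} R)) : Prop where
  fg : M ≤ ModuleCat.isFG R
  iso : M.IsClosedUnderIsomorphisms
  self : M (ModuleCat.of R R)
  prod_iff (X Y : ModuleCat.{u} R) : M (ModuleCat.of R (X × Y)) ↔ M X ∧ M Y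
  mid_iff_left (S : ShortComplex (ModuleCat.{u} R)) (hS : S.ShortExact) (h₃ : M S.X₃) :
    M S.X₂ ↔ M S.X₁

/-- `M` is a thick subcategory of `N`. -/
structure IsThickIn (M N : ObjectProperty (ModuleCat.{u} R)) : Prop where
  resolving : IsResolving M
  le : M ≤ N
  right (S : ShortComplex (ModuleCat.{u} R)) (hS : S.ShortExact) (h₁ : M S.X₁) (h₂ : M S.X₂)
    (h₃ : N S.X₃) : M S.X₃

/-- `res P`, the smallest resolving subcategory containing `P`. -/
def res (P : ObjectProperty (ModuleCat.{u} R)) : ObjectProperty (ModuleCat.{u} R) :=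
  sInf {Q | IsResolving Q ∧ P ≤ Q}

/-- `Q` is closed under isomorphisms, (finite) direct sums and direct summands. -/
structure IsAddClosed (Q : ObjectProperty (ModuleCat.{u} R)) : Prop where
  iso : Q.IsClosedUnderIsomorphisms
  prod_iff (X Y : ModuleCat.{u} R) : Q (ModuleCat.of R (X × Y)) ↔ Q X ∧ Q Y

/-- `add P`, the smallest subcategory containing `P` closed under direct sums and summands. -/
def add (P : ObjectProperty (ModuleCat.{u} R)) : ObjectProperty (ModuleCat.{u} R) :=
  sInf {Q | IsAddClosed Q ∧ P ≤ Q}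

/-- There is an exact sequence `0 → Mₙ → ⋯ → M₀ → X → 0` with all `Mᵢ` in `P`. For `n + 1` such a
sequence is spliced from `0 → K → M₀ → X → 0` and a sequence `0 → Mₙ₊₁ → ⋯ → M₁ → K → 0`. -/
def HasResolution (P : ObjectProperty (ModuleCat.{u} R)) : ℕ → ModuleCat.{u} R → Prop
  | 0, X => ∃ M : ModuleCat.{u} R, P M ∧ Nonempty (M ≅ X)
  | n + 1, X => ∃ (K M : ModuleCat.{u} R) (i : K ⟶ M) (π : M ⟶ X) (w : i ≫ π = 0),
      (ShortComplex.mk i π w).ShortExact ∧ P M ∧ HasResolution P n K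

/-- The dimension of `X` with respect to `P`; it is `⊤` if `X` has no finite `P`-resolution. -/
def pdim (P : ObjectProperty (ModuleCat.{u} R)) (X : ModuleCat.{u} R) : ℕ∞ :=
  ⨅ (n : ℕ) (_ : HasResolution P n X), (n : ℕ∞)

/-- The finitely generated modules of finite dimension with respect to `P`. -/
def finDim (P : ObjectProperty (ModuleCat.{u} R)) : ObjectProperty (ModuleCat.{u} R) :=
  fun X => ModuleCat.isFG R X ∧ pdim P X < ⊤

/-- The collection of resolving subcategories `X` with `M ⊆ X ⊆ finDim M`. -/
def resolvingOver (M : ObjectProperty (ModuleCat.{u} R)) :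
    Set (ObjectProperty (ModuleCat.{u} R)) :=
  {X | IsResolving X ∧ M ≤ X ∧ X ≤ finDim M}

/-- The localization `X_p`, a module over `R_p`. -/
def locModule (X : ModuleCat.{u} R) (p : PrimeSpectrum R) :
    ModuleCat.{u} (Localization.AtPrime p.asIdeal) :=
  X.localizedModule p.asIdeal.primeCompl

/-- `add M_p`, where `M_p` consists of the localizations at `p` of the modules in `M`. -/
def addLoc (M : ObjectProperty (ModuleCat.{u} R)) (p : PrimeSpectrum R) :
    ObjectProperty (ModuleCat.{u} (Localization.AtPrime p.asIdeal)) :=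
  add fun Y => ∃ X : ModuleCat.{u} R, M X ∧ Nonempty (locModule X p ≅ Y)

/-- The grade of an ideal: the supremum of the lengths of the `R`-regular sequences in it. -/
def grade (I : Ideal R) : ℕ∞ :=
  ⨆ (rs : List R) (_ : (∀ r ∈ rs, r ∈ I) ∧ RingTheory.Sequence.IsRegular R rs), (rs.length : ℕ∞)

variable (R) in
/-- The grade consistent functions `Spec R → ℕ`, seen as functions to `ℕ∞` with finite values. -/
def gradeConsistent : Set (PrimeSpectrum R → ℕ∞) :=
  {f | (∀ p, f p ≠ ⊤) ∧ Monotone f ∧ ∀ p, f p ≤ grade p.asIdeal}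

/-- `Λ_M(f)`, the finitely generated `X` with `add M_p`-dimension of `X_p` at most `f p`
for all `p`. -/
def Lam (M : ObjectProperty (ModuleCat.{u} R)) (f : PrimeSpectrum R → ℕ∞) :
    ObjectProperty (ModuleCat.{u} R) :=
  fun X => ModuleCat.isFG R X ∧ ∀ p, pdim (addLoc M p) (locModule X p) ≤ f p

/-- `Φ_M(X)`, sending `p` to the supremum of the `add M_p`-dimensions of `Y_p` for `Y` in `X`. -/
def Phi (M X : ObjectProperty (ModuleCat.{u} R)) : PrimeSpectrum R → ℕ∞ :=
  fun p => ⨆ (Y : ModuleCat.{u} R) (_ : X Y), pdim (addLoc M p) (locModule Y p)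

/-- The map `η_M^N`, `X ↦ res (X ∪ N)`, on `resolvingOver M`. -/
def eta (_M N X : ObjectProperty (ModuleCat.{u} R)) : ObjectProperty (ModuleCat.{u} R) :=
  res (X ⊔ N)

/-- The map `ρ_M^N`, `X ↦ X ∩ finDim M`, on `resolvingOver N`. -/
def rho (M _N X : ObjectProperty (ModuleCat.{u} R)) : ObjectProperty (ModuleCat.{u} R) :=
  X ⊓ finDim M

/-- `A` cogenerates `M`. -/
def Cogenerates (A M : ObjectProperty (ModuleCat.{u} R)) : Prop :=
  A ≤ M ∧ ∀ X, M X → ∃ (Y Z : ModuleCat.{u} R) (i : X ⟶ Y) (π : Y ⟶ Z) (w : i ≫ π = 0),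
    (ShortComplex.mk i π w).ShortExact ∧ A Y ∧ M Z

/-- `C` is a semidualizing module. -/
structure IsSemidualizing (C : ModuleCat.{u} R) : Prop where
  fg : Module.Finite R C
  ext (i : ℕ) (hi : 0 < i) : Subsingleton (Abelian.Ext C C i)
  homothety : Function.Bijective (LinearMap.lsmul R C)

/-- The dual `Hom(X, C)`. -/
abbrev dual (C X : ModuleCat.{u} R) : ModuleCat.{u} R :=
  ModuleCat.of R (X →ₗ[R] C)

/-- `X` is totally `C`-reflexive. The last condition is about the evaluation map
`X → Hom(Hom(X, C), C)`. -/
structure IsTotallyReflexive (C X : ModuleCat.{u} R) : Prop where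
  fg : Module.Finite R X
  ext (i : ℕ) (hi : 0 < i) : Subsingleton (Abelian.Ext X C i)
  ext_dual (i : ℕ) (hi : 0 < i) : Subsingleton (Abelian.Ext (dual C X) C i)
  reflexive : Function.Bijective
    (LinearMap.applyₗ : X →ₗ[R] (X →ₗ[R] C) →ₗ[R] C)

/-- The category `G_C` of totally `C`-reflexive modules. -/
def GC (C : ModuleCat.{u} R) : ObjectProperty (ModuleCat.{u} R) := IsTotallyReflexive C

/-- The thick subcategories of `G_C` containing `C`. -/
def thickGC (C : ModuleCat.{u} R) : Set (ObjectProperty (ModuleCat.{u} R)) :=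
  {M | IsThickIn M (GC C) ∧ M C}

/-- The smallest thick subcategory of `G_C` containing `C`. -/
def minThick (C : ModuleCat.{u} R) : ObjectProperty (ModuleCat.{u} R) := sInf (thickGC C)

/-- The collection `S(C)` of resolving subcategories `M` that are cogenerated by
`A = minThick C` and such that `add A_p` is thick in `add M_p` for every prime `p`. -/
def SC (C : ModuleCat.{u} R) : Set (ObjectProperty (ModuleCat.{u} R)) :=
  {M | IsResolving M ∧ Cogenerates (minThick C) M ∧
    ∀ p : PrimeSpectrum R, IsThickIn (addLoc (minThick C) p) (addLoc M p)}

end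

end ResolvingSubcat

open ResolvingSubcat

/-! Cogeneration by `minThick C` and local thickness force the modules of `M ∈ SC C` to be totally
`C`-reflexive and to embed into powers of `C` with cokernel in `M`, so `SC C = thickGC C`. For such
`M` and `X` of finite `M`-dimension, that dimension is the largest `i` with `Ext^i(X, C) ≠ 0`, so it
does not depend on `M`, and `M` is recovered from `Λ_M(f)` as its intersection with `G_C`.

Membership of `X` in a resolving subcategory `P` is measured by the ideal of the scalars `s` for
which multiplication by `s` on `X` factors through an object of `P`: the primes not containing it
are those at which `X` lies locally in `P`. At a minimal prime of this ideal, the question whether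
`X` is in `P` is local and `X` is in `P` on the punctured spectrum.

There, modules `T_n` with multiplication by every element of the maximal ideal factoring through a
power of `C` are built by embedding `C`, then `T_0`, `T_1`, …, into powers of `C` through all maps
to `C`; the depth makes these maps injective. `T_n` carries a universal class in
`Ext^(n+1)(T_n, C)`, through which every class killed by the maximal ideal factors. Such a class on
`V` is killed by passing to the kernel of a map from the sum of `V` and a power of `C` onto `T_n`;
so, by Noetherian induction, every module of dimension at most `n + 1` that lies in `M` on the
punctured spectrum is built from `T_0`, …, `T_n` and modules in `M`. Conversely `T_n` is obtained
from any module `Z` of dimension `n + 1` in `P`, once `Z` is made to lie in `M` on the punctured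
spectrum by pulling back free covers along scalars.

The values `Φ_M(P)(p)` are at most the grade of `p` because a maximal weakly regular sequence in `p`
bounds dimensions at an associated prime of its quotient, and `T_n` built from `p` itself shows that
every grade consistent function occurs. -/

namespace ResolvingSubcat

section ShortExact

variable {R : Type*} [Ring R] {X Y Z N V : Type*}
variable [AddCommGroup X] [Module R X] [AddCommGroup Y] [Module R Y] [AddCommGroup Z] [Module R Z]
variable [AddCommGroup N] [Module R N] [AddCommGroup V] [Module R V]

/-- `0 → X → Y → Z → 0` is a short exact sequence of unbundled modules. -/
structure IsShortExact (f : X →ₗ[R] Y) (g : Y →ₗ[R] Z) : Prop where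
  injective : Function.Injective f
  exact : Function.Exact f g
  surjective : Function.Surjective g

/-- The fiber product of two linear maps with the same codomain. -/
abbrev FiberProduct (g : Y →ₗ[R] Z) (k : N →ₗ[R] Z) : Type _ :=
  LinearMap.eqLocus (g ∘ₗ LinearMap.fst R Y N) (k ∘ₗ LinearMap.snd R Y N)

namespace FiberProduct

variable (g : Y →ₗ[R] Z) (k : N →ₗ[R] Z)

/-- The first projection of a fiber product. -/
def fst : FiberProduct g k →ₗ[R] Y := LinearMap.fst R Y N ∘ₗ Submodule.subtype _

/-- The second projection of a fiber product. -/
def snd : FiberProduct g k →ₗ[R] N := LinearMap.snd R Y N ∘ₗ Submodule.subtype _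

variable {g k}

theorem condition (w : FiberProduct g k) : g (fst g k w) = k (snd g k w) := w.2

theorem exists_of_eq {y : Y} {n : N} (h : g y = k n) :
    ∃ w : FiberProduct g k, fst g k w = y ∧ snd g k w = n :=
  ⟨⟨(y, n), h⟩, rfl, rfl⟩

theorem ext {w w' : FiberProduct g k} (h₁ : fst g k w = fst g k w')
    (h₂ : snd g k w = snd g k w') : w = w' :=
  Subtype.ext (Prod.ext h₁ h₂)

/-- The map into a fiber product given by its universal property. -/
def lift (a : V →ₗ[R] Y) (b : V →ₗ[R] N) (hab : ∀ v, g (a v) = k (b v)) :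
    V →ₗ[R] FiberProduct g k :=
  (a.prod b).codRestrict _ hab

variable {a : V →ₗ[R] Y} {b : V →ₗ[R] N} {hab : ∀ v, g (a v) = k (b v)}

@[simp]
theorem fst_lift (v : V) : fst g k (lift a b hab v) = a v := rfl

end FiberProduct

/-- The pushout of two linear maps with the same domain. -/
abbrev Pushout (k : X →ₗ[R] N) (f : X →ₗ[R] Y) : Type _ :=
  (N × Y) ⧸ LinearMap.range ((-k).prod f)

namespace Pushout

variable (k : X →ₗ[R] N) (f : X →ₗ[R] Y)

/-- The first coprojection of a pushout. -/
def inl : N →ₗ[R] Pushout k f := Submodule.mkQ _ ∘ₗ LinearMap.inl R N Y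

/-- The second coprojection of a pushout. -/
def inr : Y →ₗ[R] Pushout k f := Submodule.mkQ _ ∘ₗ LinearMap.inr R N Y

variable {k f}

theorem inl_add_inr (n : N) (y : Y) :
    inl k f n + inr k f y = (LinearMap.range ((-k).prod f)).mkQ (n, y) := by
  change Submodule.mkQ _ (n, 0) + Submodule.mkQ _ (0, y) = _
  rw [← map_add, Prod.mk_add_mk, add_zero, zero_add]

theorem inl_add_inr_eq_zero_iff {n : N} {y : Y} :
    inl k f n + inr k f y = 0 ↔ ∃ x, -k x = n ∧ f x = y := by
  simp [inl_add_inr]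

theorem condition (x : X) : inr k f (f x) = inl k f (k x) := by
  rw [← sub_eq_zero, sub_eq_neg_add, ← map_neg, inl_add_inr_eq_zero_iff]
  exact ⟨x, rfl, rfl⟩

theorem exists_inl_add_inr (w : Pushout k f) : ∃ n y, inl k f n + inr k f y = w := by
  obtain ⟨⟨n, y⟩, rfl⟩ := Submodule.mkQ_surjective _ w
  exact ⟨n, y, inl_add_inr n y⟩

/-- The map out of a pushout given by its universal property. -/
def desc (a : N →ₗ[R] V) (b : Y →ₗ[R] V) (hab : ∀ x, b (f x) = a (k x)) :
    Pushout k f →ₗ[R] V :=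
  (LinearMap.range ((-k).prod f)).liftQ (a.coprod b) <| by
    rintro _ ⟨x, rfl⟩
    simp [hab]

variable {a : N →ₗ[R] V} {b : Y →ₗ[R] V} {hab : ∀ x, b (f x) = a (k x)}

@[simp]
theorem desc_inl (n : N) : desc a b hab (inl k f n) = a n :=
  (Submodule.liftQ_apply _ _ _).trans (by simp)

@[simp]
theorem desc_inr (y : Y) : desc a b hab (inr k f y) = b y :=
  (Submodule.liftQ_apply _ _ _).trans (by simp)

end Pushout

namespace IsShortExact

theorem of_surjective {g : Y →ₗ[R] Z} (hg : Function.Surjective g) :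
    IsShortExact (LinearMap.ker g).subtype g :=
  ⟨Subtype.val_injective, LinearMap.exact_subtype_ker_map g, hg⟩

theorem of_injective {f : X →ₗ[R] Y} (hf : Function.Injective f) :
    IsShortExact f (LinearMap.range f).mkQ :=
  ⟨hf, LinearMap.exact_map_mkQ_range f, Submodule.mkQ_surjective _⟩

theorem equiv_left {f : X →ₗ[R] Y} {g : Y →ₗ[R] Z} (h : IsShortExact f g) (e : X ≃ₗ[R] V) :
    IsShortExact (f ∘ₗ e.symm.toLinearMap) g :=
  ⟨h.injective.comp e.symm.injective, fun y =>
    (h.exact y).trans (e.symm.surjective.exists (p := fun x => f x = y)), h.surjective⟩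

theorem equiv_mid {f : X →ₗ[R] Y} {g : Y →ₗ[R] Z} (h : IsShortExact f g) (e : Y ≃ₗ[R] V) :
    IsShortExact (e.toLinearMap ∘ₗ f) (g ∘ₗ e.symm.toLinearMap) :=
  ⟨e.injective.comp h.injective, fun v => by
    simpa [LinearEquiv.eq_symm_apply] using h.exact (e.symm v), h.surjective.comp e.symm.surjective⟩

variable (R X Y) in
theorem inl_snd : IsShortExact (LinearMap.inl R X Y) (LinearMap.snd R X Y) :=
  ⟨LinearMap.inl_injective, Function.Exact.inl_snd, LinearMap.snd_surjective⟩

variable {f : X →ₗ[R] Y} {g : Y →ₗ[R] Z} (h : IsShortExact f g)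
include h

theorem comp_apply (x : X) : g (f x) = 0 := h.exact.apply_apply_eq_zero x

theorem exists_preimage {y : Y} (hy : g y = 0) : ∃ x, f x = y := (h.exact y).1 hy

theorem exists_desc (k : Y →ₗ[R] N) (hk : ∀ x, k (f x) = 0) :
    ∃ l : Z →ₗ[R] N, ∀ y, l (g y) = k y := by
  have hle : LinearMap.ker g ≤ LinearMap.ker k := fun y hy => by
    obtain ⟨x, rfl⟩ := h.exists_preimage hy
    exact hk x
  have hsymm (y : Y) : (g.quotKerEquivOfSurjective h.surjective).symm (g y) =
      (LinearMap.ker g).mkQ y := by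
    rw [LinearEquiv.symm_apply_eq]
    rfl
  exact ⟨(LinearMap.ker g).liftQ k hle ∘ₗ (g.quotKerEquivOfSurjective h.surjective).symm,
    fun y => by simp [hsymm]⟩

theorem exists_lift (k : N →ₗ[R] Y) (hk : ∀ n, g (k n) = 0) :
    ∃ l : N →ₗ[R] X, ∀ n, f (l n) = k n := by
  let e := LinearEquiv.ofInjective f h.injective
  let k' := k.codRestrict (LinearMap.range f) fun n => h.exists_preimage (hk n)
  exact ⟨e.symm ∘ₗ k', fun n => congrArg Subtype.val (e.apply_symm_apply (k' n))⟩

theorem prodMap {X' Y' Z' : Type*} [AddCommGroup X'] [Module R X'] [AddCommGroup Y']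
    [Module R Y'] [AddCommGroup Z'] [Module R Z'] {f' : X' →ₗ[R] Y'} {g' : Y' →ₗ[R] Z'}
    (h' : IsShortExact f' g') : IsShortExact (f.prodMap f') (g.prodMap g') where
  injective := h.injective.prodMap h'.injective
  exact w := by simp [Prod.ext_iff, h.exact w.1, h'.exact w.2]
  surjective := h.surjective.prodMap h'.surjective

theorem exists_inclusion_ker (k : N →ₗ[R] Y) (hk : Function.Surjective k) :
    ∃ l : LinearMap.ker (g ∘ₗ k) →ₗ[R] X,
      IsShortExact (Submodule.inclusion (LinearMap.ker_le_ker_comp k g)) l := by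
  obtain ⟨l, hl⟩ := h.exists_lift (k ∘ₗ (LinearMap.ker (g ∘ₗ k)).subtype) fun n => n.2
  replace hl (n : LinearMap.ker (g ∘ₗ k)) : f (l n) = k n := hl n
  refine ⟨l, Submodule.inclusion_injective _, fun n => ⟨fun hn => ?_, ?_⟩, fun x => ?_⟩
  · exact ⟨⟨n, by rw [LinearMap.mem_ker, ← hl, hn, map_zero]⟩, rfl⟩
  · rintro ⟨n, rfl⟩
    exact h.injective ((hl _).trans (n.2.trans (map_zero f).symm))
  · obtain ⟨n, hn⟩ := hk (f x)
    have hgn : g (k n) = 0 := by rw [hn, h.comp_apply]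
    exact ⟨⟨n, hgn⟩, h.injective ((hl _).trans hn)⟩

theorem nonempty_equiv_of_retraction (r : Y →ₗ[R] X) (hr : ∀ x, r (f x) = x) :
    Nonempty (Y ≃ₗ[R] X × Z) :=
  ⟨(h.exact.splitInjectiveEquiv h.surjective ⟨r, LinearMap.ext hr⟩).1⟩

theorem fiberProduct_snd (k : N →ₗ[R] Z) :
    IsShortExact (FiberProduct.lift f 0 (by simp [h.comp_apply])) (FiberProduct.snd g k) where
  injective _ _ hab := h.injective (congrArg (FiberProduct.fst g k) hab)
  exact w := by
    refine ⟨fun hw => ?_, fun ⟨x, hx⟩ => hx ▸ rfl⟩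
    obtain ⟨x, hx⟩ := h.exists_preimage (by rw [w.condition, hw, map_zero])
    exact ⟨x, FiberProduct.ext hx hw.symm⟩
  surjective n := by
    obtain ⟨y, hy⟩ := h.surjective (k n)
    obtain ⟨w, -, hw⟩ := FiberProduct.exists_of_eq hy
    exact ⟨w, hw⟩

theorem fiberProduct_fst (k : N →ₗ[R] Z) :
    IsShortExact (FiberProduct.lift 0 f (by simp [h.comp_apply])) (FiberProduct.fst k g) where
  injective _ _ hab := h.injective (congrArg (FiberProduct.snd k g) hab)
  exact w := by
    refine ⟨fun hw => ?_, fun ⟨x, hx⟩ => hx ▸ rfl⟩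
    obtain ⟨x, hx⟩ := h.exists_preimage (by rw [← w.condition, hw, map_zero])
    exact ⟨x, FiberProduct.ext hw.symm hx⟩
  surjective n := by
    obtain ⟨y, hy⟩ := h.surjective (k n)
    obtain ⟨w, hw, -⟩ := FiberProduct.exists_of_eq hy.symm
    exact ⟨w, hw⟩

theorem pushout_inl (k : X →ₗ[R] N) :
    IsShortExact (Pushout.inl k f) (Pushout.desc 0 g (by simp [h.comp_apply])) where
  injective := (injective_iff_map_eq_zero _).2 fun n hn => by
    obtain ⟨x, rfl, hx⟩ :=
      Pushout.inl_add_inr_eq_zero_iff.1 (by rwa [map_zero (Pushout.inr k f), add_zero])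
    rw [h.injective (hx.trans (map_zero f).symm), map_zero, neg_zero]
  exact w := by
    obtain ⟨n, y, rfl⟩ := w.exists_inl_add_inr
    refine ⟨fun hw => ?_, fun ⟨n', hn'⟩ => by rw [← hn', Pushout.desc_inl, LinearMap.zero_apply]⟩
    obtain ⟨x, rfl⟩ := h.exists_preimage (y := y) (by simpa using hw)
    exact ⟨n + k x, by rw [map_add, Pushout.condition]⟩
  surjective z := by
    obtain ⟨y, rfl⟩ := h.surjective z
    exact ⟨Pushout.inr k f y, Pushout.desc_inr y⟩

theorem pushout_inr (k : X →ₗ[R] N) :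
    IsShortExact (Pushout.inr f k) (Pushout.desc g 0 (by simp [h.comp_apply])) where
  injective := (injective_iff_map_eq_zero _).2 fun n hn => by
    obtain ⟨x, hx, rfl⟩ :=
      Pushout.inl_add_inr_eq_zero_iff.1 (by rwa [map_zero (Pushout.inl f k), zero_add])
    rw [neg_eq_zero] at hx
    rw [h.injective (hx.trans (map_zero f).symm), map_zero]
  exact w := by
    obtain ⟨y, n, rfl⟩ := w.exists_inl_add_inr
    refine ⟨fun hw => ?_, fun ⟨n', hn'⟩ => by rw [← hn', Pushout.desc_inr, LinearMap.zero_apply]⟩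
    obtain ⟨x, rfl⟩ := h.exists_preimage (y := y) (by simpa using hw)
    exact ⟨k x + n, by rw [map_add, Pushout.condition]⟩
  surjective z := by
    obtain ⟨y, rfl⟩ := h.surjective z
    exact ⟨Pushout.inl f k y, Pushout.desc_inl y⟩

end IsShortExact

end ShortExact

namespace IsShortExact

variable {R : Type u} [Ring R] {X Y Z : Type u} [AddCommGroup X] [Module R X] [AddCommGroup Y]
  [Module R Y] [AddCommGroup Z] [Module R Z] {f : X →ₗ[R] Y} {g : Y →ₗ[R] Z}

/-- The short complex in `ModuleCat R` given by a short exact sequence. -/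
abbrev complex (h : IsShortExact f g) : ShortComplex (ModuleCat.{u} R) :=
  ShortComplex.mk (ModuleCat.ofHom f) (ModuleCat.ofHom g) (by ext x; exact h.comp_apply x)

theorem shortExact (h : IsShortExact f g) : h.complex.ShortExact :=
  ModuleCat.shortComplex_shortExact _ h.exact h.injective h.surjective

theorem of_shortExact {S : ShortComplex (ModuleCat.{u} R)} (h : S.ShortExact) :
    IsShortExact S.f.hom S.g.hom :=
  ⟨h.moduleCat_injective_f,
    (ShortComplex.ShortExact.moduleCat_exact_iff_function_exact _).1 h.exact,
    h.moduleCat_surjective_g⟩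

end IsShortExact

section AddClosed

variable {R : Type u} [CommRing R] {X Y Z : Type u} [AddCommGroup X] [Module R X]
  [AddCommGroup Y] [Module R Y] [AddCommGroup Z] [Module R Z] {P : ObjectProperty (ModuleCat.{u} R)}

theorem IsAddClosed.of_equiv (hP : IsAddClosed P) (e : X ≃ₗ[R] Y) (h : P (ModuleCat.of R X)) :
    P (ModuleCat.of R Y) := by
  have := hP.iso
  exact P.prop_of_iso e.toModuleIso h

theorem IsAddClosed.of_retract (hP : IsAddClosed P) (i : X →ₗ[R] Y) (r : Y →ₗ[R] X)
    (hri : ∀ x, r (i x) = x) (hY : P (ModuleCat.of R Y)) : P (ModuleCat.of R X) := by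
  have hi : Function.Injective i := Function.LeftInverse.injective hri
  obtain ⟨e⟩ := (IsShortExact.of_injective hi).nonempty_equiv_of_retraction r hri
  exact ((hP.prod_iff (ModuleCat.of R X) (ModuleCat.of R _)).1 (hP.of_equiv e hY)).1

namespace IsResolving

variable (hP : IsResolving P)
include hP

theorem isAddClosed : IsAddClosed P := ⟨hP.iso, hP.prod_iff⟩

theorem of_equiv (e : X ≃ₗ[R] Y) (h : P (ModuleCat.of R X)) : P (ModuleCat.of R Y) :=
  hP.isAddClosed.of_equiv e h

theorem mid_iff {f : X →ₗ[R] Y} {g : Y →ₗ[R] Z} (h : IsShortExact f g)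
    (hZ : P (ModuleCat.of R Z)) : P (ModuleCat.of R Y) ↔ P (ModuleCat.of R X) :=
  hP.mid_iff_left _ h.shortExact hZ

theorem mid {f : X →ₗ[R] Y} {g : Y →ₗ[R] Z} (h : IsShortExact f g) (hX : P (ModuleCat.of R X))
    (hZ : P (ModuleCat.of R Z)) : P (ModuleCat.of R Y) :=
  (hP.mid_iff h hZ).2 hX

theorem left {f : X →ₗ[R] Y} {g : Y →ₗ[R] Z} (h : IsShortExact f g) (hY : P (ModuleCat.of R Y))
    (hZ : P (ModuleCat.of R Z)) : P (ModuleCat.of R X) :=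
  (hP.mid_iff h hZ).1 hY

theorem finite (X : ModuleCat.{u} R) (h : P X) : Module.Finite R X := hP.fg _ h

theorem prod (hX : P (ModuleCat.of R X)) (hY : P (ModuleCat.of R Y)) :
    P (ModuleCat.of R (X × Y)) :=
  (hP.prod_iff (ModuleCat.of R X) (ModuleCat.of R Y)).2 ⟨hX, hY⟩

theorem of_subsingleton [Subsingleton X] : P (ModuleCat.of R X) := by
  have : Unique X := uniqueOfSubsingleton 0
  have hRX : P (ModuleCat.of R (R × X)) :=
    hP.of_equiv (X := R) (LinearEquiv.prodUnique (R := R) (M := R) (M₂ := X)).symm hP.self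
  exact ((hP.prod_iff (ModuleCat.of R R) (ModuleCat.of R X)).1 hRX).2

theorem pi (n : ℕ) (hX : P (ModuleCat.of R X)) : P (ModuleCat.of R (Fin n → X)) := by
  induction n with
  | zero => exact hP.of_subsingleton
  | succ n ih => exact hP.of_equiv (Fin.consLinearEquiv R (fun _ => X)) (hP.prod hX ih)

theorem free (n : ℕ) : P (ModuleCat.of R (Fin n → R)) := hP.pi n hP.self

end IsResolving

end AddClosed

section Syzygies

variable {R : Type u} [CommRing R] {X Y Z K M : Type u}
variable [AddCommGroup X] [Module R X] [AddCommGroup Y] [Module R Y] [AddCommGroup Z] [Module R Z]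
variable [AddCommGroup M] [Module R M] [AddCommGroup K] [Module R K]

/-- The modules having a first syzygy in `P`. -/
def syzygyIn (P : ObjectProperty (ModuleCat.{u} R)) : ObjectProperty (ModuleCat.{u} R) :=
  fun X => ∃ (n : ℕ) (f : (Fin n → R) →ₗ[R] X),
    Function.Surjective f ∧ P (ModuleCat.of R (LinearMap.ker f))

variable {P Q : ObjectProperty (ModuleCat.{u} R)}

theorem finite_of_syzygyIn {X : ModuleCat.{u} R} (h : syzygyIn P X) : Module.Finite R X := by
  obtain ⟨n, f, hf, -⟩ := h
  exact Module.Finite.of_surjective f hf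

theorem HasResolution.mono (h : P ≤ Q) (n : ℕ) : HasResolution P n ≤ HasResolution Q n := by
  induction n with
  | zero => exact fun X ⟨M, hM, e⟩ => ⟨M, h _ hM, e⟩
  | succ n ih => exact fun X ⟨K, M, i, π, w, hS, hM, hK⟩ => ⟨K, M, i, π, w, hS, h _ hM, ih _ hK⟩

namespace IsResolving

variable (hP : IsResolving P)
include hP

theorem syzygyIn_of_isShortExact {i : K →ₗ[R] M} {π : M →ₗ[R] X} (h : IsShortExact i π)
    (hM : P (ModuleCat.of R M)) (hK : P (ModuleCat.of R K)) : syzygyIn P (ModuleCat.of R X) := by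
  have := hP.finite _ hM
  have : Module.Finite R X := Module.Finite.of_surjective π h.surjective
  obtain ⟨n, f, hf⟩ := Module.Finite.exists_fin' R X
  have hW := hP.mid (h.fiberProduct_snd f) hK (hP.free n)
  exact ⟨n, f, hf, hP.left ((IsShortExact.of_surjective hf).fiberProduct_fst π) hW hM⟩

theorem syzygyIn_iff {i : K →ₗ[R] M} {π : M →ₗ[R] X} (h : IsShortExact i π)
    (hM : P (ModuleCat.of R M)) : syzygyIn P (ModuleCat.of R X) ↔ P (ModuleCat.of R K) := by
  refine ⟨fun ⟨n, f, hf, hK⟩ => ?_, hP.syzygyIn_of_isShortExact h hM⟩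
  have hW := hP.mid ((IsShortExact.of_surjective hf).fiberProduct_fst π) hK hM
  exact hP.left (h.fiberProduct_snd f) hW (hP.free n)

theorem le_syzygyIn : P ≤ syzygyIn P := fun X hX => by
  have := hP.finite _ hX
  obtain ⟨n, f, hf⟩ := Module.Finite.exists_fin' R X
  exact ⟨n, f, hf, hP.left (IsShortExact.of_surjective hf) (hP.free n) hX⟩

theorem syzygyIn_prod_iff [Module.Finite R X] [Module.Finite R Y] :
    syzygyIn P (ModuleCat.of R (X × Y)) ↔
      syzygyIn P (ModuleCat.of R X) ∧ syzygyIn P (ModuleCat.of R Y) := by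
  obtain ⟨n, f, hf⟩ := Module.Finite.exists_fin' R X
  obtain ⟨m, g, hg⟩ := Module.Finite.exists_fin' R Y
  have hsf := IsShortExact.of_surjective hf
  have hsg := IsShortExact.of_surjective hg
  rw [hP.syzygyIn_iff (hsf.prodMap hsg) (hP.prod (hP.free n) (hP.free m)),
    hP.syzygyIn_iff hsf (hP.free n), hP.syzygyIn_iff hsg (hP.free m)]
  exact hP.prod_iff (ModuleCat.of R _) (ModuleCat.of R _)

theorem syzygyIn_mid_iff {f : X →ₗ[R] Y} {g : Y →ₗ[R] Z} (h : IsShortExact f g)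
    [Module.Finite R Y] (hZ : syzygyIn P (ModuleCat.of R Z)) :
    syzygyIn P (ModuleCat.of R Y) ↔ syzygyIn P (ModuleCat.of R X) := by
  obtain ⟨n, k, hk⟩ := Module.Finite.exists_fin' R Y
  obtain ⟨l, hl⟩ := h.exists_inclusion_ker k hk
  have hker : P (ModuleCat.of R (LinearMap.ker (g ∘ₗ k))) :=
    (hP.syzygyIn_iff (IsShortExact.of_surjective (g := g ∘ₗ k) (h.surjective.comp hk))
      (hP.free n)).1 hZ
  rw [hP.syzygyIn_iff hl hker, hP.syzygyIn_iff (IsShortExact.of_surjective hk) (hP.free n)]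

theorem isResolving_syzygyIn : IsResolving (syzygyIn P) where
  fg _ h := finite_of_syzygyIn h
  iso := ⟨fun e ⟨n, f, hf, hK⟩ => ⟨n, e.toLinearEquiv.toLinearMap ∘ₗ f,
    e.toLinearEquiv.surjective.comp hf, by rwa [LinearEquiv.ker_comp]⟩⟩
  self := hP.le_syzygyIn _ hP.self
  prod_iff X Y := by
    refine ⟨fun h => ?_, fun h => ?_⟩
    · have : Module.Finite R (X × Y) := finite_of_syzygyIn h
      have : Module.Finite R X := .of_surjective (LinearMap.fst R X Y) LinearMap.fst_surjective
      have : Module.Finite R Y := .of_surjective (LinearMap.snd R X Y) LinearMap.snd_surjective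
      exact hP.syzygyIn_prod_iff.1 h
    · have := finite_of_syzygyIn h.1
      have := finite_of_syzygyIn h.2
      exact hP.syzygyIn_prod_iff.2 h
  mid_iff_left S hS h₃ := by
    have h := IsShortExact.of_shortExact hS
    refine ⟨fun h₂ => ?_, fun h₁ => ?_⟩
    · have := finite_of_syzygyIn h₂
      exact (hP.syzygyIn_mid_iff h h₃).1 h₂
    · have := finite_of_syzygyIn h₁
      have := finite_of_syzygyIn h₃
      have : Module.Finite R S.X₂ := .of_exact h.exact h.surjective
      exact (hP.syzygyIn_mid_iff h h₃).2 h₁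

theorem hasResolution_zero_iff {X : ModuleCat.{u} R} : HasResolution P 0 X ↔ P X := by
  have := hP.iso
  exact ⟨fun ⟨_, hM, ⟨e⟩⟩ => P.prop_of_iso e hM, fun h => ⟨X, h, ⟨Iso.refl _⟩⟩⟩

theorem isResolving_hasResolution_and_le (n : ℕ) :
    IsResolving (HasResolution P n) ∧ P ≤ HasResolution P n := by
  induction n with
  | zero =>
    rw [show HasResolution P 0 = P from funext fun X => propext hP.hasResolution_zero_iff]
    exact ⟨hP, le_rfl⟩
  | succ n ih =>
    obtain ⟨hres, hle⟩ := ih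
    have hsyz : HasResolution P (n + 1) = syzygyIn (HasResolution P n) := by
      refine le_antisymm ?_ ?_
      · rintro X ⟨K, M, i, π, w, hS, hM, hK⟩
        exact hres.syzygyIn_of_isShortExact (IsShortExact.of_shortExact hS) (hle _ hM) hK
      · rintro X ⟨m, f, hf, hK⟩
        exact ⟨_, _, _, _, _, (IsShortExact.of_surjective hf).shortExact, hP.free m, hK⟩
    rw [hsyz]
    exact ⟨hres.isResolving_syzygyIn, hle.trans hres.le_syzygyIn⟩

theorem isResolving_hasResolution (n : ℕ) : IsResolving (HasResolution P n) :=
  (hP.isResolving_hasResolution_and_le n).1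

theorem le_hasResolution (n : ℕ) : P ≤ HasResolution P n :=
  (hP.isResolving_hasResolution_and_le n).2

theorem hasResolution_succ_iff {i : K →ₗ[R] M} {π : M →ₗ[R] X} (h : IsShortExact i π)
    (hM : P (ModuleCat.of R M)) (n : ℕ) :
    HasResolution P (n + 1) (ModuleCat.of R X) ↔ HasResolution P n (ModuleCat.of R K) := by
  refine ⟨fun ⟨K', M', i', π', w, hS, hM', hK'⟩ => ?_,
    fun hK => ⟨_, _, _, _, _, h.shortExact, hM, hK⟩⟩
  have hres := hP.isResolving_hasResolution n
  have hle := hP.le_hasResolution n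
  exact (hres.syzygyIn_iff h (hle _ hM)).1
    (hres.syzygyIn_of_isShortExact (IsShortExact.of_shortExact hS) (hle _ hM') hK')

theorem hasResolution_mono : Monotone (HasResolution P) := by
  refine monotone_nat_of_le_succ fun n X hX => ?_
  have hres := hP.isResolving_hasResolution n
  obtain ⟨m, f, hf, hK⟩ := hres.le_syzygyIn X hX
  exact (hP.hasResolution_succ_iff (X := X) (IsShortExact.of_surjective hf) (hP.free m) n).2 hK

theorem pdim_le_iff (n : ℕ) (X : ModuleCat.{u} R) : pdim P X ≤ n ↔ HasResolution P n X := by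
  refine ⟨fun h => ?_, fun h => iInf₂_le n h⟩
  have hlt : pdim P X < (n : ℕ∞) + 1 := h.trans_lt (by exact_mod_cast n.lt_succ_self)
  obtain ⟨m, hm, hmn⟩ := by simpa only [pdim, iInf_lt_iff] using hlt
  exact hP.hasResolution_mono (Nat.lt_succ_iff.1 (by exact_mod_cast hmn)) _ hm

theorem pdim_lt_top_iff (X : ModuleCat.{u} R) : pdim P X < ⊤ ↔ ∃ n, HasResolution P n X := by
  simp only [lt_top_iff_ne_top, ENat.ne_top_iff_exists, ← hP.pdim_le_iff]
  exact ⟨fun ⟨n, hn⟩ => ⟨n, hn.ge⟩,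
    fun ⟨n, hn⟩ => (ENat.le_natCast_iff.1 hn).imp fun _ h => h.1.symm⟩

theorem finDim_iff (X : ModuleCat.{u} R) : finDim P X ↔ ∃ n, HasResolution P n X := by
  rw [finDim, hP.pdim_lt_top_iff, and_iff_right_of_imp]
  exact fun ⟨n, hn⟩ => (hP.isResolving_hasResolution n).fg _ hn

end IsResolving

end Syzygies

section LocalMembership

variable {R : Type u} [CommRing R] {X Y Z : Type u}
variable [AddCommGroup X] [Module R X] [AddCommGroup Y] [Module R Y] [AddCommGroup Z] [Module R Z]

/-- Multiplication by `s` on `X` factors through a module in `P`. -/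
def SMulFactors (P : ObjectProperty (ModuleCat.{u} R)) (X : Type u) [AddCommGroup X] [Module R X]
    (s : R) : Prop :=
  ∃ (M : ModuleCat.{u} R) (i : X →ₗ[R] M) (r : M →ₗ[R] X), P M ∧ ∀ x, r (i x) = s • x

variable {P Q : ObjectProperty (ModuleCat.{u} R)}

namespace SMulFactors

theorem mono (h : P ≤ Q) {s : R} (hs : SMulFactors P X s) : SMulFactors Q X s := by
  obtain ⟨M, i, r, hM, hri⟩ := hs
  exact ⟨M, i, r, h _ hM, hri⟩

theorem comp {s t : R} {i : X →ₗ[R] Y} {r : Y →ₗ[R] X} (hri : ∀ x, r (i x) = s • x)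
    (ht : SMulFactors P Y t) : SMulFactors P X (s * t) := by
  obtain ⟨M, i', r', hM, hri'⟩ := ht
  exact ⟨M, i' ∘ₗ i, r ∘ₗ r', hM, fun x => by simp [hri', hri, smul_smul, mul_comm]⟩

theorem of_retract {i : X →ₗ[R] Y} {r : Y →ₗ[R] X} (hri : ∀ x, r (i x) = x) {s : R}
    (hs : SMulFactors P Y s) : SMulFactors P X s := by
  simpa only [one_mul] using hs.comp (s := 1) (by simpa only [one_smul] using hri)

theorem mid (hP : IsResolving P) {f : X →ₗ[R] Y} {g : Y →ₗ[R] Z} (h : IsShortExact f g)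
    {s t : R} (hX : SMulFactors P X s) (hZ : SMulFactors P Z t) : SMulFactors P Y (t * s) := by
  obtain ⟨N, a, b, hN, hab⟩ := hZ
  obtain ⟨M, c, d, hM, hcd⟩ := hX
  -- `t` on `Y` factors through `W = Y ×_Z N`, an extension of `N` by `X`.
  have hW := h.fiberProduct_snd b
  let l : Y →ₗ[R] FiberProduct g b := FiberProduct.lift (t • LinearMap.id) (a ∘ₗ g) (by simp [hab])
  refine comp (i := l) (r := FiberProduct.fst g b) (fun y => by simp [l]) ?_
  -- `s` on `W` factors through the pushout of `W` along `X → M`, an extension of `N` by `M`.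
  exact ⟨ModuleCat.of R (Pushout c _), Pushout.inr c _,
    Pushout.desc (FiberProduct.lift f 0 (by simp [h.comp_apply]) ∘ₗ d) (s • LinearMap.id)
      (by simp [hcd]),
    hP.mid (hW.pushout_inl c) hM hN, fun w => by simp⟩

theorem left_of_mem (hP : IsResolving P) {f : X →ₗ[R] Y} {g : Y →ₗ[R] Z} (h : IsShortExact f g)
    {s : R} (hY : SMulFactors P Y s) (hZ : P (ModuleCat.of R Z)) : SMulFactors P X s := by
  obtain ⟨M, c, d, hM, hcd⟩ := hY
  have := hP.finite _ hZ
  obtain ⟨n, φ, hφ⟩ := Module.Finite.exists_fin' R Z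
  obtain ⟨ψ, hψ⟩ := Module.projective_lifting_property g φ h.surjective
  let e : M × (Fin n → R) →ₗ[R] Y := d.coprod ψ
  have he : Function.Surjective (g ∘ₗ e) := fun z => by
    obtain ⟨y, rfl⟩ := hφ z
    exact ⟨(0, y), by simp [e, ← hψ]⟩
  have hK := hP.left (IsShortExact.of_surjective he) (hP.prod hM (hP.free n)) hZ
  obtain ⟨l, hl⟩ := h.exists_lift (e ∘ₗ (LinearMap.ker (g ∘ₗ e)).subtype) fun x => x.2
  have hcf (x : X) : LinearMap.inl R M (Fin n → R) (c (f x)) ∈ LinearMap.ker (g ∘ₗ e) := by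
    simp [e, hcd, h.comp_apply]
  refine ⟨ModuleCat.of R (LinearMap.ker (g ∘ₗ e)),
    (LinearMap.inl R M (Fin n → R) ∘ₗ c ∘ₗ f).codRestrict _ hcf, l, hK, fun x => h.injective ?_⟩
  rw [hl]
  simp [e, hcd]

theorem ker_of_mem {f : X →ₗ[R] Y} {g : Y →ₗ[R] X} {s : R} (hfg : ∀ x, g (f x) = s • x)
    (hY : P (ModuleCat.of R Y)) : SMulFactors P (LinearMap.ker g) s :=
  ⟨ModuleCat.of R Y, (LinearMap.ker g).subtype,
    (s • LinearMap.id - f ∘ₗ g).codRestrict _ fun y => by simp [hfg], hY,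
    fun y => Subtype.ext (by simp [LinearMap.mem_ker.1 y.2])⟩

theorem left (hP : IsResolving P) {f : X →ₗ[R] Y} {g : Y →ₗ[R] Z} (h : IsShortExact f g)
    [Module.Finite R Z] {s t : R} (hY : SMulFactors P Y s) (hZ : SMulFactors P Z t) :
    SMulFactors P X (s * t) := by
  obtain ⟨N, a, b, hN, hab⟩ := hZ
  obtain ⟨n, φ, hφ⟩ := Module.Finite.exists_fin' R Z
  let b' : N × (Fin n → R) →ₗ[R] Z := b.coprod φ
  have hb' : Function.Surjective b' := fun z => by
    obtain ⟨y, rfl⟩ := hφ z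
    exact ⟨(0, y), by simp [b']⟩
  have hN' := hP.prod hN (hP.free n)
  have hker : SMulFactors P (LinearMap.ker b') t :=
    ker_of_mem (f := LinearMap.inl R N (Fin n → R) ∘ₗ a) (fun z => by simp [b', hab]) hN'
  exact left_of_mem hP (h.fiberProduct_snd b')
    (mid hP ((IsShortExact.of_surjective hb').fiberProduct_fst g) hker hY) hN'

end SMulFactors

/-- The ideal of all scalars whose multiplication on `X` factors through a module in `P`. -/
def smulFactorsIdeal (hP : IsResolving P) (X : Type u) [AddCommGroup X] [Module R X] : Ideal R where
  carrier := {s | SMulFactors P X s}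
  zero_mem' := ⟨ModuleCat.of R PUnit, 0, 0, hP.of_subsingleton, fun x => by simp⟩
  add_mem' := by
    rintro s t ⟨M, i, r, hM, hs⟩ ⟨N, i', r', hN, ht⟩
    exact ⟨ModuleCat.of R (M × N), i.prod i', r.coprod r', hP.prod hM hN,
      fun x => by simp [hs, ht, add_smul]⟩
  smul_mem' := by
    rintro a s ⟨M, i, r, hM, hs⟩
    exact ⟨M, i, a • r, hM, fun x => by simp [hs, smul_smul]⟩

theorem smulFactors_one_iff (hP : IsResolving P) : SMulFactors P X 1 ↔ P (ModuleCat.of R X) := by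
  refine ⟨fun ⟨M, i, r, hM, hs⟩ => hP.isAddClosed.of_retract i r (fun x => by simp [hs]) hM,
    fun h => ⟨ModuleCat.of R X, LinearMap.id, LinearMap.id, h, fun x => by simp⟩⟩

/-- The finitely generated modules that belong to `P` after inverting some element of `S`, up to
direct summands. -/
def locIn (P : ObjectProperty (ModuleCat.{u} R)) (S : Submonoid R) :
    ObjectProperty (ModuleCat.{u} R) :=
  fun X => Module.Finite R X ∧ ∃ s ∈ S, SMulFactors P X s

theorem locIn.mono {S T : Submonoid R} (h : P ≤ Q) (hST : S ≤ T) : locIn P S ≤ locIn Q T :=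
  fun _ ⟨hX, s, hs, hf⟩ => ⟨hX, s, hST hs, hf.mono h⟩

theorem IsResolving.le_locIn (hP : IsResolving P) (S : Submonoid R) : P ≤ locIn P S :=
  fun X hX => ⟨hP.finite X hX, 1, S.one_mem, (smulFactors_one_iff hP).2 hX⟩

theorem IsResolving.isResolving_locIn (hP : IsResolving P) [IsNoetherianRing R]
    (S : Submonoid R) : IsResolving (locIn P S) where
  fg _ h := h.1
  iso := ⟨fun e ⟨_, s, hs, hf⟩ => ⟨.equiv e.toLinearEquiv, s, hs,
    hf.of_retract (i := e.toLinearEquiv.symm) (r := e.toLinearEquiv) (by simp)⟩⟩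
  self := hP.le_locIn S _ hP.self
  prod_iff X Y := by
    refine ⟨fun ⟨hXY, s, hs, hf⟩ => ?_, fun ⟨⟨hX, s, hs, hf⟩, ⟨hY, t, ht, hg⟩⟩ => ?_⟩
    · have : Module.Finite R (X × Y) := hXY
      exact ⟨⟨.of_surjective (LinearMap.fst R X Y) LinearMap.fst_surjective, s, hs,
          hf.of_retract (i := LinearMap.inl R X Y) (r := LinearMap.fst R X Y) (by simp)⟩,
        ⟨.of_surjective (LinearMap.snd R X Y) LinearMap.snd_surjective, s, hs,
          hf.of_retract (i := LinearMap.inr R X Y) (r := LinearMap.snd R X Y) (by simp)⟩⟩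
    · exact ⟨show Module.Finite R (X × Y) from inferInstance, t * s, S.mul_mem ht hs,
        hf.mid hP (IsShortExact.inl_snd R X Y) hg⟩
  mid_iff_left T hT := fun ⟨hZ, t, ht, hg⟩ => by
    have h := IsShortExact.of_shortExact hT
    refine ⟨fun ⟨hY, s, hs, hf⟩ => ?_, fun ⟨hX, s, hs, hf⟩ => ?_⟩
    · exact ⟨.of_injective _ h.injective, s * t, S.mul_mem hs ht, hf.left hP h hg⟩
    · exact ⟨.of_exact h.exact h.surjective, t * s, S.mul_mem ht hs, hf.mid hP h hg⟩

theorem mem_radical_smulFactorsIdeal_iff (hP : IsResolving P) [Module.Finite R X] {s : R} :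
    s ∈ (smulFactorsIdeal hP X).radical ↔ locIn P (Submonoid.powers s) (ModuleCat.of R X) := by
  refine ⟨fun ⟨n, hn⟩ => ⟨‹_›, s ^ n, ⟨n, rfl⟩, hn⟩, ?_⟩
  rintro ⟨-, _, ⟨n, rfl⟩, hn⟩
  exact ⟨n, hn⟩

/-- The modules that belong to `P` locally at `p`, up to direct summands. -/
abbrev locAt (P : ObjectProperty (ModuleCat.{u} R)) (p : PrimeSpectrum R) :
    ObjectProperty (ModuleCat.{u} R) :=
  locIn P p.asIdeal.primeCompl

theorem locAt_iff (hP : IsResolving P) [Module.Finite R X] (p : PrimeSpectrum R) :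
    locAt P p (ModuleCat.of R X) ↔ ¬ smulFactorsIdeal hP X ≤ p.asIdeal := by
  rw [SetLike.not_le_iff_exists]
  exact ⟨fun ⟨_, s, hs, hf⟩ => ⟨s, hf, hs⟩, fun ⟨s, hf, hs⟩ => ⟨‹_›, s, hs, hf⟩⟩

theorem locAt_antitone (P : ObjectProperty (ModuleCat.{u} R)) : Antitone (locAt P) :=
  fun _ _ h => locIn.mono le_rfl fun _ hs hp => hs (h hp)

theorem isOpen_setOf_locAt (hP : IsResolving P) [Module.Finite R X] :
    IsOpen {p | locAt P p (ModuleCat.of R X)} := by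
  have h : {p | locAt P p (ModuleCat.of R X)} =
      (PrimeSpectrum.zeroLocus (smulFactorsIdeal hP X : Set R))ᶜ :=
    Set.ext fun p => locAt_iff hP p
  rw [h]
  exact (PrimeSpectrum.isClosed_zeroLocus _).isOpen_compl

namespace IsResolving

variable (hP : IsResolving P) [Module.Finite R X]
include hP

theorem of_forall_locAt (h : ∀ p, locAt P p (ModuleCat.of R X)) : P (ModuleCat.of R X) := by
  rw [← smulFactors_one_iff hP]
  change 1 ∈ smulFactorsIdeal hP X
  rw [← Ideal.eq_top_iff_one]
  by_contra hne
  obtain ⟨m, hm, hle⟩ := Ideal.exists_le_maximal _ hne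
  exact (locAt_iff hP ⟨m, hm.isPrime⟩).1 (h _) hle

variable [IsNoetherianRing R]

theorem hasResolution_of_forall_locAt (n : ℕ)
    (h : ∀ p, HasResolution (locAt P p) n (ModuleCat.of R X)) :
    HasResolution P n (ModuleCat.of R X) := by
  induction n generalizing X with
  | zero =>
    exact hP.hasResolution_zero_iff.2 <| hP.of_forall_locAt fun p =>
      (hP.isResolving_locIn _).hasResolution_zero_iff.1 (h p)
  | succ n ih =>
    obtain ⟨m, f, hf⟩ := Module.Finite.exists_fin' R X
    have hs := IsShortExact.of_surjective hf
    refine (hP.hasResolution_succ_iff hs (hP.free m) n).2 (ih fun p => ?_)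
    have hp := hP.isResolving_locIn p.asIdeal.primeCompl
    exact (hp.hasResolution_succ_iff hs (hp.free m) n).1 (h p)

variable (X) in
theorem isOpen_setOf_hasResolution_locAt (n : ℕ) :
    IsOpen {p | HasResolution (locAt P p) n (ModuleCat.of R X)} := by
  induction n generalizing X with
  | zero =>
    convert isOpen_setOf_locAt (X := X) hP using 3
    exact (hP.isResolving_locIn _).hasResolution_zero_iff
  | succ n ih =>
    obtain ⟨m, f, hf⟩ := Module.Finite.exists_fin' R X
    convert ih (LinearMap.ker f) using 3 with p
    have hp := hP.isResolving_locIn p.asIdeal.primeCompl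
    exact hp.hasResolution_succ_iff (IsShortExact.of_surjective hf) (hp.free m) n

/-- The loci where the local dimension is at most `n` form an increasing open cover of `Spec R`,
which is quasi-compact. -/
theorem exists_hasResolution_of_forall_locAt
    (h : ∀ p, ∃ n, HasResolution (locAt P p) n (ModuleCat.of R X)) :
    ∃ n, HasResolution P n (ModuleCat.of R X) := by
  let U : ℕ → Set (PrimeSpectrum R) := fun n => {p | HasResolution (locAt P p) n (ModuleCat.of R X)}
  have hmono : Monotone U :=
    fun a b hab p hp => (hP.isResolving_locIn _).hasResolution_mono hab _ hp
  obtain ⟨n, hn⟩ := isCompact_univ.elim_directed_cover U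
    (hP.isOpen_setOf_hasResolution_locAt X) (fun p _ => Set.mem_iUnion.2 (h p)) hmono.directed_le
  exact ⟨n, hP.hasResolution_of_forall_locAt n fun p => hn (Set.mem_univ p)⟩

end IsResolving

end LocalMembership

section Localize

variable {R : Type u} [CommRing R]
variable {X Y Z : Type u} [AddCommGroup X] [Module R X] [AddCommGroup Y] [Module R Y]
  [AddCommGroup Z] [Module R Z]

/-- The local ring at `p`. -/
abbrev LocRing (p : PrimeSpectrum R) : Type u := Localization.AtPrime p.asIdeal

/-- The localization at `p` of an unbundled module. -/
noncomputable abbrev LocMod (p : PrimeSpectrum R) (X : Type u) [AddCommGroup X] [Module R X] :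
    ModuleCat.{u} (LocRing p) := locModule (ModuleCat.of R X) p

noncomputable instance (p : PrimeSpectrum R) (X : ModuleCat.{u} R) : Module R (locModule X p) :=
  inferInstanceAs (Module R (X.localizedModule p.asIdeal.primeCompl))

instance (p : PrimeSpectrum R) (X : ModuleCat.{u} R) :
    IsScalarTower R (LocRing p) (locModule X p) :=
  inferInstanceAs (IsScalarTower R (Localization p.asIdeal.primeCompl)
    (X.localizedModule p.asIdeal.primeCompl))

/-- The canonical map to the localization. -/
noncomputable def locMk (p : PrimeSpectrum R) (X : Type u) [AddCommGroup X] [Module R X] :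
    X →ₗ[R] LocMod p X :=
  (ModuleCat.of R X).localizedModuleMkLinearMap p.asIdeal.primeCompl

instance (p : PrimeSpectrum R) : IsLocalizedModule p.asIdeal.primeCompl (locMk p X) :=
  ModuleCat.localizedModule_isLocalizedModule _ _

/-- The map induced on localizations. -/
noncomputable def locMap (p : PrimeSpectrum R) (f : X →ₗ[R] Y) :
    LocMod p X →ₗ[LocRing p] LocMod p Y :=
  IsLocalizedModule.mapExtendScalars p.asIdeal.primeCompl (locMk p X) (locMk p Y) (LocRing p) f

@[simp]
theorem locMap_mk (p : PrimeSpectrum R) (f : X →ₗ[R] Y) (x : X) :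
    locMap p f (locMk p X x) = locMk p Y (f x) := by
  simp [locMap]

theorem smul_injective_of_notMem {p : PrimeSpectrum R} {V : Type u} [AddCommGroup V]
    [Module (LocRing p) V] [Module R V] [IsScalarTower R (LocRing p) V] {s : R}
    (hs : s ∉ p.asIdeal) : Function.Injective fun v : V => s • v := by
  intro v w h
  have hu : IsUnit (algebraMap R (LocRing p) s) :=
    IsLocalization.map_units (LocRing p) (⟨s, hs⟩ : p.asIdeal.primeCompl)
  exact hu.smul_left_cancel.1 (by simpa only [algebraMap_smul] using h)

theorem locMod_hom_ext {p : PrimeSpectrum R} {V : Type u} [AddCommGroup V]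
    [Module (LocRing p) V] {f g : LocMod p X →ₗ[LocRing p] V}
    (h : ∀ x, f (locMk p X x) = g (locMk p X x)) : f = g := by
  let _ : Module R V := Module.compHom V (algebraMap R (LocRing p))
  have : IsScalarTower R (LocRing p) V := IsScalarTower.of_algebraMap_smul fun _ _ => rfl
  ext y
  obtain ⟨⟨x, s⟩, hx⟩ := IsLocalizedModule.surj p.asIdeal.primeCompl (locMk p X) y
  refine smul_injective_of_notMem s.2 ?_
  have hsmul (k : LocMod p X →ₗ[LocRing p] V) : (s : R) • k y = k (locMk p X x) := by
    rw [← hx, ← algebraMap_smul (LocRing p) (s : R) (k y), ← map_smul, algebraMap_smul]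
    rfl
  simp only [hsmul, h]

theorem IsShortExact.locMap (p : PrimeSpectrum R) {f : X →ₗ[R] Y} {g : Y →ₗ[R] Z}
    (h : IsShortExact f g) : IsShortExact (locMap p f) (locMap p g) where
  injective :=
    IsLocalizedModule.map_injective p.asIdeal.primeCompl (locMk p X) (locMk p Y) f h.injective
  exact := IsLocalizedModule.map_exact p.asIdeal.primeCompl (locMk p X) (locMk p Y) (locMk p Z)
    f g h.exact
  surjective :=
    IsLocalizedModule.map_surjective p.asIdeal.primeCompl (locMk p Y) (locMk p Z) g h.surjective

theorem nonempty_locMod_equiv (p : PrimeSpectrum R) {V : Type u} [AddCommGroup V]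
    [Module (LocRing p) V] [Module R V] [IsScalarTower R (LocRing p) V] (i : X →ₗ[R] V)
    [IsLocalizedModule p.asIdeal.primeCompl i] : Nonempty (LocMod p X ≃ₗ[LocRing p] V) :=
  ⟨(IsLocalizedModule.linearEquiv p.asIdeal.primeCompl (locMk p X) i).extendScalarsOfIsLocalization
    p.asIdeal.primeCompl (LocRing p)⟩

instance (p : PrimeSpectrum R) [Module.Finite R X] : Module.Finite (LocRing p) (LocMod p X) :=
  Module.Finite.of_isLocalizedModule p.asIdeal.primeCompl (locMk p X)

variable (X) in
theorem nonempty_locMod_pi_equiv (p : PrimeSpectrum R) (n : ℕ) :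
    Nonempty (LocMod p (Fin n → X) ≃ₗ[LocRing p] (Fin n → LocMod p X)) := by
  let i : (Fin n → X) →ₗ[R] (Fin n → LocMod p X) := .pi fun i => locMk p X ∘ₗ .proj i
  have : IsLocalizedModule p.asIdeal.primeCompl i := inferInstance
  exact nonempty_locMod_equiv p i

variable (X Y) in
theorem nonempty_locMod_prod_equiv (p : PrimeSpectrum R) :
    Nonempty (LocMod p (X × Y) ≃ₗ[LocRing p] (LocMod p X × LocMod p Y)) := by
  let i : X × Y →ₗ[R] (LocMod p X × LocMod p Y) := (locMk p X).prodMap (locMk p Y)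
  have : IsLocalizedModule p.asIdeal.primeCompl i := inferInstance
  exact nonempty_locMod_equiv p i

theorem nonempty_locMod_self_equiv (p : PrimeSpectrum R) :
    Nonempty (LocMod p R ≃ₗ[LocRing p] LocRing p) :=
  nonempty_locMod_equiv p (Algebra.linearMap R (LocRing p))

theorem exists_locMk_eq_smul [IsNoetherianRing R] [Module.Finite R X] {p : PrimeSpectrum R}
    (φ : LocMod p X →ₗ[LocRing p] LocMod p Y) :
    ∃ (f : X →ₗ[R] Y) (s : R), s ∉ p.asIdeal ∧ ∀ x, locMk p Y (f x) = s • φ (locMk p X x) := by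
  have := Module.finitePresentation_of_finite R X
  obtain ⟨f, s, h⟩ := Module.FinitePresentation.exists_lift_of_isLocalizedModule
    p.asIdeal.primeCompl (locMk p Y) (φ.restrictScalars R ∘ₗ locMk p X)
  exact ⟨f, s, s.2, fun x => LinearMap.congr_fun h x⟩

theorem exists_smul_eq_smul_of_locMk_comp_eq [Module.Finite R X] {p : PrimeSpectrum R}
    {f g : X →ₗ[R] Y} (h : locMk p Y ∘ₗ f = locMk p Y ∘ₗ g) : ∃ s ∉ p.asIdeal, s • f = s • g := by
  obtain ⟨s, hs⟩ := Module.Finite.exists_smul_of_comp_eq_of_isLocalizedModule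
    p.asIdeal.primeCompl (locMk p Y) f g h
  exact ⟨s, s.2, hs⟩

section Add

variable {Q : ObjectProperty (ModuleCat.{u} R)}

theorem sInf_objectProperty_iff {T : Set (ObjectProperty (ModuleCat.{u} R))}
    {X : ModuleCat.{u} R} : sInf T X ↔ ∀ Q ∈ T, Q X := by
  simp [sInf_apply]

theorem add_iff {X : ModuleCat.{u} R} : add Q X ↔ ∀ T, IsAddClosed T → Q ≤ T → T X := by
  rw [add, sInf_objectProperty_iff]
  exact ⟨fun h T h1 h2 => h T ⟨h1, h2⟩, fun h T hT => h T hT.1 hT.2⟩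

variable (Q) in
theorem isAddClosed_add : IsAddClosed (add Q) where
  iso := ⟨fun e h => add_iff.2 fun T hT hle => hT.iso.of_iso e (add_iff.1 h T hT hle)⟩
  prod_iff X Y := by
    simp only [add_iff, ← forall_and]
    exact forall₃_congr fun T hT _ => hT.prod_iff X Y

end Add

variable {P : ObjectProperty (ModuleCat.{u} R)}

theorem addLoc_of_mem (p : PrimeSpectrum R) {X : ModuleCat.{u} R} (h : P X) :
    addLoc P p (locModule X p) :=
  add_iff.2 fun _ _ hle => hle _ ⟨X, h, ⟨Iso.refl _⟩⟩

/-- `V` is a direct summand of the localization at `p` of a module in `P`. -/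
def IsRetractOfLoc (P : ObjectProperty (ModuleCat.{u} R)) (p : PrimeSpectrum R) :
    ObjectProperty (ModuleCat.{u} (LocRing p)) :=
  fun V => ∃ (M : ModuleCat.{u} R) (i : V →ₗ[LocRing p] locModule M p)
    (r : locModule M p →ₗ[LocRing p] V), P M ∧ ∀ v, r (i v) = v

theorem IsResolving.isAddClosed_isRetractOfLoc (hP : IsResolving P) (p : PrimeSpectrum R) :
    IsAddClosed (IsRetractOfLoc P p) where
  iso := by
    refine ⟨?_⟩
    rintro V W e ⟨M, i, r, hM, hri⟩
    exact ⟨M, i ∘ₗ e.toLinearEquiv.symm, e.toLinearEquiv ∘ₗ r, hM, fun v => by simp [hri]⟩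
  prod_iff V W := by
    constructor
    · rintro ⟨M, i, r, hM, hri⟩
      exact ⟨⟨M, i ∘ₗ LinearMap.inl _ V W, LinearMap.fst _ V W ∘ₗ r, hM, fun v => by simp [hri]⟩,
        ⟨M, i ∘ₗ LinearMap.inr _ V W, LinearMap.snd _ V W ∘ₗ r, hM, fun v => by simp [hri]⟩⟩
    · rintro ⟨⟨M, i, r, hM, hri⟩, ⟨M', i', r', hM', hri'⟩⟩
      obtain ⟨e⟩ := nonempty_locMod_prod_equiv M M' p
      exact ⟨ModuleCat.of R (M × M'), e.symm ∘ₗ i.prodMap i', r.prodMap r' ∘ₗ e,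
        hP.prod hM hM', fun v => by simp [hri, hri']⟩

theorem IsResolving.addLoc_eq (hP : IsResolving P) (p : PrimeSpectrum R) :
    addLoc P p = IsRetractOfLoc P p := by
  refine le_antisymm (fun V h => add_iff.1 h _ (hP.isAddClosed_isRetractOfLoc p) ?_) ?_
  · rintro V ⟨M, hM, ⟨e⟩⟩
    exact ⟨M, e.toLinearEquiv.symm, e.toLinearEquiv, hM, fun v => by simp⟩
  · rintro V ⟨M, i, r, hM, hri⟩
    exact (isAddClosed_add _).of_retract i r hri (addLoc_of_mem p hM)

theorem IsRetractOfLoc.of_locAt {p : PrimeSpectrum R} (h : locAt P p (ModuleCat.of R X)) :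
    IsRetractOfLoc P p (LocMod p X) := by
  obtain ⟨-, s, hs, M, i, r, hM, hri⟩ := h
  obtain ⟨u, hu⟩ : IsUnit (algebraMap R (LocRing p) s) :=
    IsLocalization.map_units (LocRing p) (⟨s, hs⟩ : p.asIdeal.primeCompl)
  have hcomp : locMap p r ∘ₗ locMap p i = algebraMap R (LocRing p) s • LinearMap.id :=
    locMod_hom_ext fun x => by simp [hri]
  refine ⟨M, locMap p i, (↑u⁻¹ : LocRing p) • locMap p r, hM, fun v => ?_⟩
  have hv : locMap p r (locMap p i v) = (u : LocRing p) • v := by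
    rw [hu]
    exact LinearMap.congr_fun hcomp v
  rw [LinearMap.smul_apply, hv, smul_smul, Units.inv_mul, one_smul]

theorem IsResolving.locAt_of_isRetractOfLoc [IsNoetherianRing R] (hP : IsResolving P)
    {p : PrimeSpectrum R} [Module.Finite R X] (h : IsRetractOfLoc P p (LocMod p X)) :
    locAt P p (ModuleCat.of R X) := by
  obtain ⟨M, i, r, hM, hri⟩ := h
  have : Module.Finite R M := hP.finite _ hM
  obtain ⟨i', s, hs, hi⟩ := exists_locMk_eq_smul (X := X) (Y := M) i
  obtain ⟨r', t, ht, hr⟩ := exists_locMk_eq_smul (X := M) (Y := X) r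
  have hloc : locMk p X ∘ₗ (r' ∘ₗ i') = locMk p X ∘ₗ ((t * s) • LinearMap.id) := by
    ext x
    have : r (s • i (locMk p X x)) = s • locMk p X x := by
      rw [← algebraMap_smul (LocRing p) s, map_smul, hri, algebraMap_smul]
    simp [hr, hi, this, mul_smul]
  obtain ⟨v, hv, hvri⟩ := exists_smul_eq_smul_of_locMk_comp_eq hloc
  refine ⟨‹_›, v * (t * s), ?_, M, i', v • r', hM, fun x => ?_⟩
  · exact p.asIdeal.primeCompl.mul_mem hv (p.asIdeal.primeCompl.mul_mem ht hs)
  · simpa [mul_smul] using LinearMap.congr_fun hvri x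

theorem IsResolving.addLoc_locMod_iff [IsNoetherianRing R] (hP : IsResolving P)
    (p : PrimeSpectrum R) [Module.Finite R X] :
    addLoc P p (LocMod p X) ↔ locAt P p (ModuleCat.of R X) := by
  rw [hP.addLoc_eq]
  exact ⟨hP.locAt_of_isRetractOfLoc, .of_locAt⟩

theorem isLocalizedModule_subtype (p : PrimeSpectrum R) {V : Type u} [AddCommGroup V]
    [Module (LocRing p) V] [Module R V] [IsScalarTower R (LocRing p) V] (U : Submodule R V)
    (hU : ∀ v, ∃ s ∉ p.asIdeal, s • v ∈ U) :
    IsLocalizedModule p.asIdeal.primeCompl U.subtype where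
  map_units s := by
    have hu := (IsLocalization.map_units (LocRing p) s).map
      (algebraMap (LocRing p) (Module.End (LocRing p) V))
    rw [Module.End.isUnit_iff] at hu ⊢
    convert hu using 1
    ext v
    simp
  surj v := by
    obtain ⟨s, hs, h⟩ := hU v
    exact ⟨(⟨s • v, h⟩, ⟨s, hs⟩), rfl⟩
  exists_of_eq {x y} h := ⟨1, by rw [Subtype.ext h]⟩

theorem IsShortExact.restrict {f : X →ₗ[R] Y} {g : Y →ₗ[R] Z} (h : IsShortExact f g)
    (U : Submodule R Y) :
    IsShortExact (f.restrict (p := U.comap f) (q := U) fun _ hx => hx)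
      (g.restrict (p := U) (q := U.map g) fun x hx => ⟨x, hx, rfl⟩) where
  injective _ _ hab := Subtype.ext (h.injective (congrArg Subtype.val hab))
  exact y := by
    refine ⟨fun hy => ?_, ?_⟩
    · obtain ⟨x, hx⟩ := h.exists_preimage (y := y.1) (congrArg Subtype.val hy)
      exact ⟨⟨x, show f x ∈ U from hx ▸ y.2⟩, Subtype.ext hx⟩
    · rintro ⟨x, rfl⟩
      exact Subtype.ext (h.comp_apply x.1)
  surjective := by
    rintro ⟨_, y, hy, rfl⟩
    exact ⟨⟨y, hy⟩, rfl⟩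

theorem IsShortExact.exists_locMod_equiv {p : PrimeSpectrum R} {A B D : Type u} [AddCommGroup A]
    [Module (LocRing p) A] [AddCommGroup B] [Module (LocRing p) B] [AddCommGroup D]
    [Module (LocRing p) D] [Module.Finite (LocRing p) B] {f : A →ₗ[LocRing p] B}
    {g : B →ₗ[LocRing p] D} (h : IsShortExact f g) :
    ∃ (X Y Z : ModuleCat.{u} R) (f' : X →ₗ[R] Y) (g' : Y →ₗ[R] Z), IsShortExact f' g' ∧
      Module.Finite R Y ∧ Nonempty (locModule X p ≃ₗ[LocRing p] A) ∧
      Nonempty (locModule Y p ≃ₗ[LocRing p] B) ∧ Nonempty (locModule Z p ≃ₗ[LocRing p] D) := by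
  let _ : Module R A := Module.compHom A (algebraMap R (LocRing p))
  have : IsScalarTower R (LocRing p) A := IsScalarTower.of_algebraMap_smul fun _ _ => rfl
  let _ : Module R B := Module.compHom B (algebraMap R (LocRing p))
  have : IsScalarTower R (LocRing p) B := IsScalarTower.of_algebraMap_smul fun _ _ => rfl
  let _ : Module R D := Module.compHom D (algebraMap R (LocRing p))
  have : IsScalarTower R (LocRing p) D := IsScalarTower.of_algebraMap_smul fun _ _ => rfl
  have hR : IsShortExact (f.restrictScalars R) (g.restrictScalars R) :=
    ⟨h.injective, h.exact, h.surjective⟩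
  obtain ⟨T, hT⟩ := Module.Finite.fg_top (R := LocRing p) (M := B)
  let U : Submodule R B := Submodule.span R T
  have hU (v : B) : ∃ s ∉ p.asIdeal, s • v ∈ U := by
    obtain ⟨s, hs⟩ := multiple_mem_span_of_mem_localization_span p.asIdeal.primeCompl (LocRing p)
      (T : Set B) v (hT ▸ Submodule.mem_top)
    exact ⟨s, s.2, hs⟩
  have := isLocalizedModule_subtype p (U.comap (f.restrictScalars R)) fun v => by
    obtain ⟨s, hs, hv⟩ := hU (f v)
    exact ⟨s, hs, by simpa using hv⟩
  have := isLocalizedModule_subtype p U hU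
  have := isLocalizedModule_subtype p (U.map (g.restrictScalars R)) fun v => by
    obtain ⟨b, rfl⟩ := h.surjective v
    obtain ⟨s, hs, hb⟩ := hU b
    exact ⟨s, hs, s • b, hb, map_smul (g.restrictScalars R) s b⟩
  exact ⟨.of R _, .of R U, .of R _, _, _, hR.restrict U, Module.Finite.iff_fg.2 ⟨T, rfl⟩,
    nonempty_locMod_equiv p (U.comap (f.restrictScalars R)).subtype,
    nonempty_locMod_equiv p U.subtype,
    nonempty_locMod_equiv p (U.map (g.restrictScalars R)).subtype⟩

namespace IsResolving

variable [IsNoetherianRing R] (hP : IsResolving P) (p : PrimeSpectrum R)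
include hP

omit [IsNoetherianRing R] in
theorem addLoc_le_isFG : addLoc P p ≤ ModuleCat.isFG (LocRing p) := by
  rw [hP.addLoc_eq]
  rintro V ⟨M, i, r, hM, hri⟩
  have : Module.Finite R M := hP.finite M hM
  exact Module.Finite.of_surjective (M := LocMod p M) r fun v => ⟨i v, hri v⟩

theorem addLoc_mid_iff {A B D : ModuleCat.{u} (LocRing p)} [Module.Finite (LocRing p) B]
    {f : A →ₗ[LocRing p] B} {g : B →ₗ[LocRing p] D} (h : IsShortExact f g)
    (hD : addLoc P p D) : addLoc P p B ↔ addLoc P p A := by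
  obtain ⟨X, Y, Z, f', g', hs, hY, ⟨eA⟩, ⟨eB⟩, ⟨eD⟩⟩ := h.exists_locMod_equiv
  have : Module.Finite R X := Module.Finite.of_injective f' hs.injective
  have : Module.Finite R Z := Module.Finite.of_surjective g' hs.surjective
  have hiff {V : ModuleCat.{u} (LocRing p)} {W : ModuleCat.{u} R} [Module.Finite R W]
      (e : locModule W p ≃ₗ[LocRing p] V) : addLoc P p V ↔ locAt P p W :=
    (Iff.intro ((isAddClosed_add _).of_equiv e.symm) ((isAddClosed_add _).of_equiv e)).trans
      (hP.addLoc_locMod_iff (X := W) p)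
  rw [hiff eA, hiff eB]
  exact (hP.isResolving_locIn _).mid_iff hs ((hiff eD).1 hD)

theorem isResolving_addLoc : IsResolving (addLoc P p) where
  fg := hP.addLoc_le_isFG p
  iso := (isAddClosed_add _).iso
  self := by
    obtain ⟨e⟩ := nonempty_locMod_self_equiv p
    exact (isAddClosed_add _).of_equiv e (addLoc_of_mem p hP.self)
  prod_iff := (isAddClosed_add _).prod_iff
  mid_iff_left S hS h₃ := by
    have h := IsShortExact.of_shortExact hS
    have hfin : addLoc P p S.X₂ ∨ addLoc P p S.X₁ → Module.Finite (LocRing p) S.X₂ := by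
      rintro (h₂ | h₁)
      · exact hP.addLoc_le_isFG p _ h₂
      · have : Module.Finite (LocRing p) S.X₁ := hP.addLoc_le_isFG p _ h₁
        have : Module.Finite (LocRing p) S.X₃ := hP.addLoc_le_isFG p _ h₃
        exact Module.Finite.of_exact h.exact h.surjective
    refine ⟨fun h₂ => ?_, fun h₁ => ?_⟩
    · have := hfin (.inl h₂)
      exact (hP.addLoc_mid_iff p h h₃).1 h₂
    · have := hfin (.inr h₁)
      exact (hP.addLoc_mid_iff p h h₃).2 h₁

theorem hasResolution_addLoc_iff (n : ℕ) (X : Type u) [AddCommGroup X] [Module R X]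
    [Module.Finite R X] : HasResolution (addLoc P p) n (LocMod p X) ↔
      HasResolution (locAt P p) n (ModuleCat.of R X) := by
  have hloc := hP.isResolving_locIn p.asIdeal.primeCompl
  have hadd := hP.isResolving_addLoc p
  induction n generalizing X with
  | zero =>
    exact hadd.hasResolution_zero_iff.trans
      ((hP.addLoc_locMod_iff p).trans hloc.hasResolution_zero_iff.symm)
  | succ n ih =>
    obtain ⟨m, f, hf⟩ := Module.Finite.exists_fin' R X
    have hs := IsShortExact.of_surjective hf
    calc HasResolution (addLoc P p) (n + 1) (LocMod p X)
        ↔ HasResolution (addLoc P p) n (LocMod p (LinearMap.ker f)) :=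
          hadd.hasResolution_succ_iff (hs.locMap p) (addLoc_of_mem p (hP.free m)) n
      _ ↔ HasResolution (locAt P p) n (ModuleCat.of R (LinearMap.ker f)) :=
          ih (LinearMap.ker f)
      _ ↔ HasResolution (locAt P p) (n + 1) (ModuleCat.of R X) :=
          (hloc.hasResolution_succ_iff hs (hloc.free m) n).symm

theorem pdim_addLoc_le_iff (n : ℕ) (X : ModuleCat.{u} R) [Module.Finite R X] :
    pdim (addLoc P p) (locModule X p) ≤ n ↔ HasResolution (locAt P p) n X := by
  rw [(hP.isResolving_addLoc p).pdim_le_iff]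
  exact hP.hasResolution_addLoc_iff p n X

end IsResolving

end Localize

section ExtVanishing

open Abelian

variable {R : Type u} [CommRing R]
variable {X Y Z : Type u} [AddCommGroup X] [Module R X] [AddCommGroup Y] [Module R Y]
  [AddCommGroup Z] [Module R Z]

/-- `Extⁱ(X, C) = 0`. -/
abbrev ExtVanishes (C : ModuleCat.{u} R) (X : Type u) [AddCommGroup X] [Module R X] (i : ℕ) :
    Prop :=
  Subsingleton (Ext (ModuleCat.of R X) C i)

/-- `Extⁱ(X, C) = 0` for all `i > k`. -/
def ExtVanishesAbove (C : ModuleCat.{u} R) (X : Type u) [AddCommGroup X] [Module R X] (k : ℕ) :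
    Prop :=
  ∀ i, k < i → ExtVanishes C X i

variable {C : ModuleCat.{u} R}

theorem ExtVanishes.eq_zero {i : ℕ} (_ : ExtVanishes C X i) (e : Ext (ModuleCat.of R X) C i) :
    e = 0 :=
  Subsingleton.elim _ _

theorem ExtVanishesAbove.mono {k l : ℕ} (h : ExtVanishesAbove C X k) (hkl : k ≤ l) :
    ExtVanishesAbove C X l :=
  fun i hi => h i (hkl.trans_lt hi)

variable {f : X →ₗ[R] Y} {g : Y →ₗ[R] Z}

namespace IsShortExact

theorem extVanishes_mid (h : IsShortExact f g) {i : ℕ} (hX : ExtVanishes C X i)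
    (hZ : ExtVanishes C Z i) : ExtVanishes C Y i := by
  refine subsingleton_of_forall_eq 0 fun e => ?_
  obtain ⟨e', rfl⟩ := Ext.contravariant_sequence_exact₂ h.shortExact C e (hX.eq_zero _)
  rw [hZ.eq_zero e', Ext.comp_zero]

theorem extVanishes_left (h : IsShortExact f g) {i : ℕ} (hY : ExtVanishes C Y i)
    (hZ : ExtVanishes C Z (i + 1)) : ExtVanishes C X i := by
  refine subsingleton_of_forall_eq 0 fun e => ?_
  obtain ⟨e', rfl⟩ := Ext.contravariant_sequence_exact₁ h.shortExact C e (add_comm 1 i)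
    (hZ.eq_zero _)
  rw [hY.eq_zero e', Ext.comp_zero]

theorem exists_extClass_comp_eq (h : IsShortExact f g) {i : ℕ} (hY : ExtVanishes C Y (i + 1))
    (e : Ext (ModuleCat.of R Z) C (i + 1)) :
    ∃ e' : Ext (ModuleCat.of R X) C i, h.shortExact.extClass.comp e' (add_comm 1 i) = e :=
  Ext.contravariant_sequence_exact₃ h.shortExact C e (hY.eq_zero _) (add_comm 1 i)

theorem eq_zero_of_extClass_comp_eq_zero (h : IsShortExact f g) {i : ℕ} (hY : ExtVanishes C Y i)
    {e : Ext (ModuleCat.of R X) C i} (he : h.shortExact.extClass.comp e (add_comm 1 i) = 0) :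
    e = 0 := by
  obtain ⟨e', rfl⟩ := Ext.contravariant_sequence_exact₁ h.shortExact C e (add_comm 1 i) he
  rw [hY.eq_zero e', Ext.comp_zero]

theorem extVanishes_right (h : IsShortExact f g) {i : ℕ} (hX : ExtVanishes C X i)
    (hY : ExtVanishes C Y (i + 1)) : ExtVanishes C Z (i + 1) := by
  refine subsingleton_of_forall_eq 0 fun e => ?_
  obtain ⟨e', rfl⟩ := h.exists_extClass_comp_eq hY e
  rw [hX.eq_zero e', Ext.comp_zero]

theorem exists_comp_eq_of_extClass_comp_eq_zero (h : IsShortExact f g) {φ : X →ₗ[R] C}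
    (hφ : h.shortExact.extClass.comp (Ext.mk₀ (ModuleCat.ofHom φ)) (add_zero 1) = 0) :
    ∃ ψ : Y →ₗ[R] C, ψ ∘ₗ f = φ := by
  obtain ⟨e, he⟩ := Ext.contravariant_sequence_exact₁ h.shortExact C
    (Ext.mk₀ (ModuleCat.ofHom φ)) (add_zero 1) hφ
  obtain ⟨ψ, rfl⟩ := Ext.homEquiv₀.symm.surjective e
  change (Ext.mk₀ (ModuleCat.ofHom f)).comp (Ext.mk₀ ψ) (zero_add 0) = _ at he
  rw [Ext.mk₀_comp_mk₀] at he
  have hψ := (Ext.mk₀_bijective _ _).1 he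
  exact ⟨ψ.hom, LinearMap.ext fun x => congrArg (fun k => k.hom x) hψ⟩

theorem surjective_lcomp (h : IsShortExact f g) (hZ : ExtVanishes C Z 1) :
    Function.Surjective (LinearMap.lcomp R C f) := fun _ =>
  h.exists_comp_eq_of_extClass_comp_eq_zero (hZ.eq_zero _)

theorem exists_comp_eq_pi (h : IsShortExact f g) (hZ : ExtVanishes C Z 1) {ι : Type*}
    (φ : X →ₗ[R] (ι → C)) : ∃ ψ : Y →ₗ[R] (ι → C), ψ ∘ₗ f = φ := by
  choose ψ hψ using fun i => h.surjective_lcomp hZ (LinearMap.proj i ∘ₗ φ)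
  exact ⟨LinearMap.pi ψ, LinearMap.ext fun x => funext fun i => LinearMap.congr_fun (hψ i) x⟩

theorem extVanishes_one (h : IsShortExact f g) (hY : ExtVanishes C Y 1)
    (hext : Function.Surjective (LinearMap.lcomp R C f)) : ExtVanishes C Z 1 := by
  refine subsingleton_of_forall_eq 0 fun e => ?_
  obtain ⟨e', rfl⟩ := h.exists_extClass_comp_eq hY e
  obtain ⟨φ, rfl⟩ := Ext.homEquiv₀.symm.surjective e'
  obtain ⟨ψ, hψ⟩ := hext φ.hom
  have hφ : φ = ModuleCat.ofHom f ≫ ModuleCat.ofHom ψ := ModuleCat.hom_ext hψ.symm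
  change h.shortExact.extClass.comp (Ext.mk₀ φ) _ = 0
  rw [hφ, ← Ext.mk₀_comp_mk₀]
  exact h.shortExact.extClass_comp_assoc (Ext.mk₀ (ModuleCat.ofHom ψ)) (h := add_comm 1 0)

end IsShortExact

theorem extVanishes_of_projective [Module.Projective R X] {i : ℕ} (hi : 0 < i) :
    ExtVanishes C X i := by
  obtain ⟨i, rfl⟩ := Nat.exists_eq_succ_of_ne_zero hi.ne'
  have : Projective (ModuleCat.of R X) := (IsProjective.iff_projective X).1 inferInstance
  exact Ext.subsingleton_of_projective _ _ _

theorem extVanishesAbove_of_projective [Module.Projective R X] : ExtVanishesAbove C X 0 :=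
  fun _ hi => extVanishes_of_projective hi

theorem smul_ext_eq_zero {i : ℕ} {s : R} {a : X →ₗ[R] Y} {b : Y →ₗ[R] X}
    (hba : ∀ x, b (a x) = s • x) (hY : ExtVanishes C Y i) (e : Ext (ModuleCat.of R X) C i) :
    s • e = 0 := by
  have hcomp : ModuleCat.ofHom a ≫ ModuleCat.ofHom b = s • 𝟙 (ModuleCat.of R X) := by
    ext x
    exact hba x
  calc s • e = (Ext.mk₀ (s • 𝟙 (ModuleCat.of R X))).comp e (zero_add i) := by
        rw [Ext.mk₀_smul, Ext.smul_comp, Ext.mk₀_id_comp]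
    _ = (Ext.mk₀ (ModuleCat.ofHom a)).comp ((Ext.mk₀ (ModuleCat.ofHom b)).comp e (zero_add i))
          (zero_add i) := by rw [← hcomp, ← Ext.mk₀_comp_mk₀_assoc]
    _ = 0 := by rw [hY.eq_zero ((Ext.mk₀ (ModuleCat.ofHom b)).comp e _), Ext.comp_zero]

theorem ExtVanishes.of_retract {i : ℕ} {a : X →ₗ[R] Y} {b : Y →ₗ[R] X}
    (hba : ∀ x, b (a x) = x) (hY : ExtVanishes C Y i) : ExtVanishes C X i :=
  subsingleton_of_forall_eq 0 fun e => by
    simpa only [one_smul] using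
      smul_ext_eq_zero (s := 1) (by simpa only [one_smul] using hba) hY e

theorem ExtVanishes.of_equiv {i : ℕ} (e : X ≃ₗ[R] Y) (h : ExtVanishes C X i) :
    ExtVanishes C Y i :=
  h.of_retract (a := e.symm.toLinearMap) (b := e.toLinearMap) (by simp)

theorem ExtVanishes.pi {i : ℕ} (hX : ExtVanishes C X i) (n : ℕ) :
    ExtVanishes C (Fin n → X) i := by
  induction n with
  | zero => exact hX.of_retract (a := 0) (b := 0) fun x => Subsingleton.elim _ _
  | succ n ih =>
    exact ((IsShortExact.inl_snd R X (Fin n → X)).extVanishes_mid hX ih).of_equiv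
      (Fin.consLinearEquiv R fun _ => X)

theorem ExtVanishesAbove.right (h : IsShortExact f g) (hY : ExtVanishesAbove C Y 0)
    {k : ℕ} (hX : ExtVanishesAbove C X k) : ExtVanishesAbove C Z (k + 1) := by
  intro i hi
  obtain ⟨i, rfl⟩ := Nat.exists_eq_succ_of_ne_zero (show i ≠ 0 by lia)
  exact h.extVanishes_right (hX i (by lia)) (hY _ (by lia))

theorem ExtVanishesAbove.left (h : IsShortExact f g) (hY : ExtVanishesAbove C Y 0)
    {k : ℕ} (hZ : ExtVanishesAbove C Z (k + 1)) : ExtVanishesAbove C X k := fun i hi =>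
  h.extVanishes_left (hY i (by lia)) (hZ _ (by lia))

theorem ExtVanishesAbove.right_of_surjective_lcomp (h : IsShortExact f g)
    (hext : Function.Surjective (LinearMap.lcomp R C f)) (hX : ExtVanishesAbove C X 0)
    (hY : ExtVanishesAbove C Y 0) : ExtVanishesAbove C Z 0 := fun i hi => by
  obtain rfl | hi : i = 1 ∨ 1 < i := by lia
  · exact h.extVanishes_one (hY 1 one_pos) hext
  · exact (ExtVanishesAbove.right h hY hX) i hi

end ExtVanishing

section TotallyReflexive

open Abelian

variable {R : Type u} [CommRing R]
variable {X Y Z : Type u} [AddCommGroup X] [Module R X] [AddCommGroup Y] [Module R Y]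
  [AddCommGroup Z] [Module R Z]
variable {C : ModuleCat.{u} R} {f : X →ₗ[R] Y} {g : Y →ₗ[R] Z}

/-- The evaluation map to the bidual. -/
abbrev evMap (C : ModuleCat.{u} R) (X : Type u) [AddCommGroup X] [Module R X] :
    X →ₗ[R] (X →ₗ[R] C) →ₗ[R] C := LinearMap.applyₗ

/-- The map `X** → Y**` induced by `f : X → Y`. -/
abbrev bidualMap (C : ModuleCat.{u} R) (f : X →ₗ[R] Y) :
    ((X →ₗ[R] C) →ₗ[R] C) →ₗ[R] (Y →ₗ[R] C) →ₗ[R] C :=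
  LinearMap.lcomp R C (LinearMap.lcomp R C f)

theorem bidualMap_comp_evMap (f : X →ₗ[R] Y) : bidualMap C f ∘ₗ evMap C X = evMap C Y ∘ₗ f := rfl

theorem IsShortExact.dual (h : IsShortExact f g)
    (hext : Function.Surjective (LinearMap.lcomp R C f)) :
    IsShortExact (LinearMap.lcomp R C g) (LinearMap.lcomp R C f) :=
  ⟨LinearMap.lcomp_injective_of_surjective g h.surjective,
    LinearMap.exact_lcomp_of_exact_of_surjective _ h.exact h.surjective, hext⟩

theorem injective_evMap_of_injective (hf : Function.Injective f)
    (hY : Function.Injective (evMap C Y)) : Function.Injective (evMap C X) :=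
  Function.Injective.of_comp (f := bidualMap C f) (hY.comp hf)

theorem surjective_evMap_of_surjective (hf : Function.Surjective (bidualMap C f))
    (hX : Function.Surjective (evMap C X)) : Function.Surjective (evMap C Y) :=
  Function.Surjective.of_comp (g := f) (hf.comp hX)

theorem surjective_bidualMap_of_surjective (hf : Function.Surjective f)
    (hY : Function.Surjective (evMap C Y)) : Function.Surjective (bidualMap C f) :=
  Function.Surjective.of_comp (g := evMap C X) (hY.comp hf)

theorem injective_of_surjective_lcomp (hX : Function.Injective (evMap C X))
    (hf : Function.Surjective (LinearMap.lcomp R C f)) : Function.Injective f := by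
  have hbidual : Function.Injective (bidualMap C f) :=
    LinearMap.lcomp_injective_of_surjective _ hf
  exact Function.Injective.of_comp (f := evMap C Y) (hbidual.comp hX)

namespace IsShortExact

theorem bijective_evMap_left (h : IsShortExact f g)
    (hext : Function.Surjective (LinearMap.lcomp R C f)) (hY : Function.Bijective (evMap C Y))
    (hZ : Function.Injective (evMap C Z)) : Function.Bijective (evMap C X) :=
  LinearMap.bijective_of_bijective_of_injective_of_left_exact f g (bidualMap C f) (bidualMap C g)
    _ _ _ (bidualMap_comp_evMap f) (bidualMap_comp_evMap g) h.exact
    (LinearMap.exact_lcomp_of_exact_of_surjective C (h.dual hext).exact hext) hY hZ h.injective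
    (LinearMap.lcomp_injective_of_surjective (LinearMap.lcomp R C f) hext)

theorem bijective_evMap_mid (h : IsShortExact f g)
    (hext : Function.Surjective (LinearMap.lcomp R C f)) (hX : Function.Bijective (evMap C X))
    (hZ : Function.Bijective (evMap C Z)) : Function.Bijective (evMap C Y) := by
  have h' : IsShortExact (bidualMap C f) (bidualMap C g) :=
    (h.dual hext).dual (surjective_bidualMap_of_surjective h.surjective hZ.2)
  exact LinearMap.bijective_of_surjective_of_bijective_of_bijective_of_injective
    (0 : Unit →ₗ[R] X) f g (0 : Z →ₗ[R] Unit) 0 (bidualMap C f) (bidualMap C g) 0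
    (LinearMap.id : Unit →ₗ[R] Unit) _ _ _ (LinearMap.id : Unit →ₗ[R] Unit)
    (by simp) (bidualMap_comp_evMap f) (bidualMap_comp_evMap g) (by simp)
    ((LinearMap.exact_zero_iff_injective Unit f).2 h.injective) h.exact
    ((LinearMap.exact_zero_iff_surjective Unit g).2 h.surjective)
    ((LinearMap.exact_zero_iff_injective Unit _).2 h'.injective) h'.exact
    ((LinearMap.exact_zero_iff_surjective Unit _).2 h'.surjective)
    Function.surjective_id hX hZ Function.injective_id

theorem bijective_evMap_right (h : IsShortExact f g)
    (hext : Function.Surjective (LinearMap.lcomp R C f))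
    (hg : Function.Surjective (bidualMap C g)) (hX : Function.Surjective (evMap C X))
    (hY : Function.Bijective (evMap C Y)) : Function.Bijective (evMap C Z) :=
  LinearMap.bijective_of_surjective_of_bijective_of_right_exact f g (bidualMap C f)
    (bidualMap C g) _ _ _ (bidualMap_comp_evMap f) (bidualMap_comp_evMap g) h.exact
    ((h.dual hext).dual hg).exact hX hY h.surjective hg

end IsShortExact

namespace IsTotallyReflexive

theorem of_retract {a : X →ₗ[R] Y} {b : Y →ₗ[R] X} (hba : ∀ x, b (a x) = x)
    (h : IsTotallyReflexive C (ModuleCat.of R Y)) :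
    IsTotallyReflexive C (ModuleCat.of R X) := by
  have := h.fg
  have hdual (φ : X →ₗ[R] C) : LinearMap.lcomp R C a (LinearMap.lcomp R C b φ) = φ :=
    LinearMap.ext fun x => congrArg φ (hba x)
  have hbidual (Φ : (X →ₗ[R] C) →ₗ[R] C) : bidualMap C b (bidualMap C a Φ) = Φ :=
    LinearMap.ext fun φ => congrArg Φ (hdual φ)
  refine ⟨Module.Finite.of_surjective b fun x => ⟨a x, hba x⟩,
    fun i hi => ExtVanishes.of_retract hba (h.ext i hi),
    fun i hi => ExtVanishes.of_retract hdual (h.ext_dual i hi),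
    injective_evMap_of_injective (Function.LeftInverse.injective hba) h.reflexive.1,
    surjective_evMap_of_surjective (Function.RightInverse.surjective hbidual) h.reflexive.2⟩

theorem of_equiv (e : X ≃ₗ[R] Y) (h : IsTotallyReflexive C (ModuleCat.of R X)) :
    IsTotallyReflexive C (ModuleCat.of R Y) :=
  h.of_retract (a := e.symm.toLinearMap) (b := e.toLinearMap) (by simp)

theorem mid (h : IsShortExact f g) (hX : IsTotallyReflexive C (ModuleCat.of R X))
    (hZ : IsTotallyReflexive C (ModuleCat.of R Z)) :
    IsTotallyReflexive C (ModuleCat.of R Y) := by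
  have := hX.fg
  have := hZ.fg
  have hext := h.surjective_lcomp (hZ.ext 1 one_pos)
  exact ⟨Module.Finite.of_exact h.exact h.surjective,
    fun i hi => h.extVanishes_mid (hX.ext i hi) (hZ.ext i hi),
    fun i hi => (h.dual hext).extVanishes_mid (hZ.ext_dual i hi) (hX.ext_dual i hi),
    h.bijective_evMap_mid hext hX.reflexive hZ.reflexive⟩

theorem left [IsNoetherianRing R] (h : IsShortExact f g)
    (hY : IsTotallyReflexive C (ModuleCat.of R Y))
    (hZ : IsTotallyReflexive C (ModuleCat.of R Z)) :
    IsTotallyReflexive C (ModuleCat.of R X) := by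
  have := hY.fg
  have hext := h.surjective_lcomp (hZ.ext 1 one_pos)
  exact ⟨Module.Finite.of_injective f h.injective,
    fun i hi => h.extVanishes_left (hY.ext i hi) (hZ.ext (i + 1) i.succ_pos),
    ExtVanishesAbove.right_of_surjective_lcomp (h.dual hext)
      (surjective_bidualMap_of_surjective h.surjective hZ.reflexive.2) hZ.ext_dual hY.ext_dual,
    h.bijective_evMap_left hext hY.reflexive hZ.reflexive.1⟩

theorem right (h : IsShortExact f g) (hext : Function.Surjective (LinearMap.lcomp R C f))
    (hX : IsTotallyReflexive C (ModuleCat.of R X))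
    (hY : IsTotallyReflexive C (ModuleCat.of R Y)) :
    IsTotallyReflexive C (ModuleCat.of R Z) := by
  have := hY.fg
  have hd := h.dual hext
  exact ⟨Module.Finite.of_surjective g h.surjective,
    ExtVanishesAbove.right_of_surjective_lcomp h hext hX.ext hY.ext,
    fun i hi => hd.extVanishes_left (hY.ext_dual i hi) (hX.ext_dual (i + 1) i.succ_pos),
    h.bijective_evMap_right hext (hd.surjective_lcomp (hX.ext_dual 1 one_pos)) hX.reflexive.2
      hY.reflexive⟩

theorem prod_iff : IsTotallyReflexive C (ModuleCat.of R (X × Y)) ↔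
    IsTotallyReflexive C (ModuleCat.of R X) ∧ IsTotallyReflexive C (ModuleCat.of R Y) :=
  ⟨fun h => ⟨h.of_retract (a := LinearMap.inl R X Y) (b := LinearMap.fst R X Y) (by simp),
    h.of_retract (a := LinearMap.inr R X Y) (b := LinearMap.snd R X Y) (by simp)⟩,
    fun h => mid (IsShortExact.inl_snd R X Y) h.1 h.2⟩

end IsTotallyReflexive

/-- Iterating the cogeneration hypothesis pushes both reflexivity and the vanishing of
`Ext(X*, C)` to the next cokernel. -/
theorem le_GC_of_cogenerated (Q : ObjectProperty (ModuleCat.{u} R)) (hfg : Q ≤ ModuleCat.isFG R)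
    (hext : ∀ X, Q X → ExtVanishesAbove C X 0)
    (hcog : ∀ X, Q X → ∃ (A W : ModuleCat.{u} R) (f : X →ₗ[R] A) (g : A →ₗ[R] W),
      IsShortExact f g ∧ GC C A ∧ Q W) : Q ≤ GC C := by
  have injective_evMap (X : ModuleCat.{u} R) (hX : Q X) : Function.Injective (evMap C X) := by
    obtain ⟨A, W, f, g, h, hA, -⟩ := hcog X hX
    exact injective_evMap_of_injective h.injective hA.reflexive.1
  have bijective_evMap (X : ModuleCat.{u} R) (hX : Q X) : Function.Bijective (evMap C X) := by
    obtain ⟨A, W, f, g, h, hA, hW⟩ := hcog X hX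
    exact h.bijective_evMap_left (h.surjective_lcomp (hext W hW 1 one_pos)) hA.reflexive
      (injective_evMap W hW)
  have ext_dual (i : ℕ) (X : ModuleCat.{u} R) (hX : Q X) :
      ExtVanishes C (X →ₗ[R] C) (i + 1) := by
    induction i generalizing X with
    | zero =>
      obtain ⟨A, W, f, g, h, hA, hW⟩ := hcog X hX
      exact (h.dual (h.surjective_lcomp (hext W hW 1 one_pos))).extVanishes_one
        (hA.ext_dual 1 one_pos)
        (surjective_bidualMap_of_surjective h.surjective (bijective_evMap W hW).2)
    | succ i ih =>
      obtain ⟨A, W, f, g, h, hA, hW⟩ := hcog X hX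
      exact (h.dual (h.surjective_lcomp (hext W hW 1 one_pos))).extVanishes_right (ih W hW)
        (hA.ext_dual _ (Nat.succ_pos _))
  refine fun X hX => ⟨hfg X hX, hext X hX, fun i hi => ?_, bijective_evMap X hX⟩
  obtain ⟨i, rfl⟩ := Nat.exists_eq_succ_of_ne_zero hi.ne'
  exact ext_dual i X hX

theorem exists_pi_surjective_lcomp [Module.Finite R (X →ₗ[R] C)] :
    ∃ (n : ℕ) (f : X →ₗ[R] (Fin n → C)), Function.Surjective (LinearMap.lcomp R C f) := by
  obtain ⟨n, π, hπ⟩ := Module.Finite.exists_fin' R (X →ₗ[R] C)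
  refine ⟨n, LinearMap.pi fun i => π (Pi.single i 1), fun φ => ?_⟩
  obtain ⟨a, rfl⟩ := hπ φ
  refine ⟨∑ i, a i • LinearMap.proj i, LinearMap.ext fun x => ?_⟩
  conv_rhs => rw [pi_eq_sum_univ' a]
  simp

namespace IsSemidualizing

variable (hC : IsSemidualizing C)
include hC

theorem exists_smul (φ : C →ₗ[R] C) : ∃ r : R, ∀ c, φ c = r • c := by
  obtain ⟨r, rfl⟩ := hC.homothety.2 φ
  exact ⟨r, fun _ => rfl⟩

theorem eq_zero_of_smul {r : R} (h : ∀ c : C, r • c = 0) : r = 0 :=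
  hC.homothety.1 (by rw [map_zero]; exact LinearMap.ext h)

theorem nonempty_equiv_end : Nonempty (R ≃ₗ[R] (C →ₗ[R] C)) :=
  ⟨LinearEquiv.ofBijective _ hC.homothety⟩

theorem isTotallyReflexive : IsTotallyReflexive C C := by
  obtain ⟨e⟩ := hC.nonempty_equiv_end
  refine ⟨hC.fg, hC.ext, fun i hi => (extVanishes_of_projective hi).of_equiv e,
    fun a b hab => LinearMap.congr_fun hab LinearMap.id, fun Φ => ⟨Φ LinearMap.id, ?_⟩⟩
  ext φ
  obtain ⟨r, rfl⟩ := hC.homothety.2 φ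
  exact (map_smul Φ r LinearMap.id).symm

theorem isTotallyReflexive_self : IsTotallyReflexive C (ModuleCat.of R R) := by
  refine ⟨Module.Finite.self R, extVanishesAbove_of_projective, fun i hi =>
    ExtVanishes.of_equiv (LinearMap.ringLmapEquivSelf R R C).symm (hC.ext i hi), ?_, fun Φ => ?_⟩
  · refine (injective_iff_map_eq_zero _).2 fun r hr => hC.eq_zero_of_smul fun c => ?_
    exact LinearMap.congr_fun hr (LinearMap.toSpanSingleton R C c)
  · obtain ⟨r, hr⟩ := hC.exists_smul (Φ ∘ₗ (LinearMap.ringLmapEquivSelf R R C).symm.toLinearMap)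
    refine ⟨r, LinearMap.ext fun φ => ?_⟩
    have hφ : (LinearMap.ringLmapEquivSelf R R C).symm (φ 1) = φ := by ext; simp
    calc φ r = r • φ 1 := by rw [← map_smul, smul_eq_mul, mul_one]
      _ = Φ φ := by rw [← hr, LinearMap.comp_apply, LinearEquiv.coe_coe, hφ]

theorem isResolving_GC [IsNoetherianRing R] : IsResolving (GC C) where
  fg _ h := h.fg
  iso := ⟨fun {X Y} e h => IsTotallyReflexive.of_equiv (X := X) (Y := Y) e.toLinearEquiv h⟩
  self := hC.isTotallyReflexive_self
  prod_iff _ _ := IsTotallyReflexive.prod_iff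
  mid_iff_left _ hS h₃ :=
    ⟨fun h => IsTotallyReflexive.left (IsShortExact.of_shortExact hS) h h₃,
      fun h => IsTotallyReflexive.mid (IsShortExact.of_shortExact hS) h h₃⟩

end IsSemidualizing

theorem IsTotallyReflexive.exists_isShortExact_pi [IsNoetherianRing R] (hC : IsSemidualizing C)
    (hX : IsTotallyReflexive C (ModuleCat.of R X)) :
    ∃ (n : ℕ) (W : ModuleCat.{u} R) (f : X →ₗ[R] (Fin n → C)) (g : (Fin n → C) →ₗ[R] W),
      IsShortExact f g ∧ GC C W := by
  have : Module.Finite R X := hX.fg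
  have := hC.fg
  obtain ⟨n, f, hf⟩ := exists_pi_surjective_lcomp (X := X) (C := C)
  have h := IsShortExact.of_injective (injective_of_surjective_lcomp hX.reflexive.1 hf)
  exact ⟨n, ModuleCat.of R _, f, _, h,
    hX.right h hf (hC.isResolving_GC.pi n hC.isTotallyReflexive)⟩

end TotallyReflexive

section Thick

variable {R : Type u} [CommRing R]
variable {X Y Z K W : Type u} [AddCommGroup X] [Module R X] [AddCommGroup Y] [Module R Y]
  [AddCommGroup Z] [Module R Z] [AddCommGroup K] [Module R K] [AddCommGroup W] [Module R W]
variable {C : ModuleCat.{u} R} {M : ObjectProperty (ModuleCat.{u} R)}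

/-- For `X ⊆ Y ⊆ K`, the pushout `Y/X ⊔_Y K` is `K/X`. -/
theorem IsShortExact.comp_pushout_inr {a : X →ₗ[R] Y} {b : Y →ₗ[R] Z} {c : Y →ₗ[R] K}
    (h : IsShortExact a b) (hc : Function.Injective c) :
    IsShortExact (c ∘ₗ a) (Pushout.inr b c) where
  injective := hc.comp h.injective
  exact k := by
    refine ⟨fun hk => ?_, ?_⟩
    · obtain ⟨y, hy, rfl⟩ :=
        Pushout.inl_add_inr_eq_zero_iff.1 (by rwa [map_zero (Pushout.inl b c), zero_add])
      obtain ⟨x, hx⟩ := h.exists_preimage (neg_eq_zero.1 hy)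
      exact ⟨x, congrArg c hx⟩
    · rintro ⟨x, rfl⟩
      rw [LinearMap.comp_apply, Pushout.condition, h.comp_apply, map_zero]
  surjective w := by
    obtain ⟨z, k, rfl⟩ := w.exists_inl_add_inr
    obtain ⟨y, rfl⟩ := h.surjective z
    exact ⟨c y + k, by rw [map_add, Pushout.condition]⟩

/-- Every module in `M` embeds into a power of `C` with cokernel in `M`. -/
def CogeneratedByPowers (C : ModuleCat.{u} R) (M : ObjectProperty (ModuleCat.{u} R)) : Prop :=
  ∀ X : ModuleCat.{u} R, M X → ∃ (n : ℕ) (W : ModuleCat.{u} R) (f : X →ₗ[R] (Fin n → C))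
    (g : (Fin n → C) →ₗ[R] W), IsShortExact f g ∧ M W

/-- Pushing out `X → Y` along `X → Cⁿ` gives an extension of `Z` by `Cⁿ`, which splits. -/
theorem CogeneratedByPowers.right (hM : IsResolving M) (hcog : CogeneratedByPowers C M)
    {f : X →ₗ[R] Y} {g : Y →ₗ[R] Z} (h : IsShortExact f g) (hX : M (ModuleCat.of R X))
    (hY : M (ModuleCat.of R Y)) (hZ : ExtVanishes C Z 1) : M (ModuleCat.of R Z) := by
  obtain ⟨n, W, f', g', h', hW⟩ := hcog _ hX
  have hpush : M (ModuleCat.of R (Pushout f' f)) := hM.mid (h'.pushout_inr f) hY hW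
  obtain ⟨r, hr⟩ := (h.pushout_inl f').exists_comp_eq_pi hZ LinearMap.id
  obtain ⟨e⟩ := (h.pushout_inl f').nonempty_equiv_of_retraction r (LinearMap.congr_fun hr)
  exact ((hM.prod_iff (ModuleCat.of R (Fin n → C)) (ModuleCat.of R Z)).1 (hM.of_equiv e hpush)).2

theorem mem_thickGC_of_cogeneratedByPowers (hM : IsResolving M) (hle : M ≤ GC C) (hMC : M C)
    (hcog : CogeneratedByPowers C M) : M ∈ thickGC C :=
  ⟨⟨hM, hle, fun _ hS h₁ h₂ h₃ =>
    hcog.right hM (IsShortExact.of_shortExact hS) h₁ h₂ (h₃.ext 1 one_pos)⟩, hMC⟩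

theorem HasResolution.extVanishesAbove (hM : IsResolving M) (hle : M ≤ GC C) {k : ℕ}
    (hX : HasResolution M k (ModuleCat.of R X)) : ExtVanishesAbove C X k := by
  induction k generalizing X with
  | zero => exact (hle _ (hM.hasResolution_zero_iff.1 hX)).ext
  | succ k ih =>
    obtain ⟨n, f, hf⟩ := (hM.isResolving_hasResolution (k + 1)).finite _ hX |>.exists_fin'
    have h := IsShortExact.of_surjective hf
    exact ExtVanishesAbove.right h extVanishesAbove_of_projective
      (ih ((hM.hasResolution_succ_iff h (hM.free n) k).1 hX))

section Noetherian

variable [IsNoetherianRing R] (hC : IsSemidualizing C)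
include hC

theorem cogeneratedByPowers_of_mem_thickGC (hM : M ∈ thickGC C) : CogeneratedByPowers C M := by
  intro X hX
  obtain ⟨n, W, f, g, h, hW⟩ := (hM.1.le X hX).exists_isShortExact_pi (X := X) hC
  exact ⟨n, W, f, g, h, hM.1.right _ h.shortExact hX (hM.1.resolving.pi n hM.2) hW⟩

theorem HasResolution.of_succ (hM : M ∈ thickGC C) {k : ℕ}
    (hX : HasResolution M (k + 1) (ModuleCat.of R X)) (hext : ExtVanishes C X (k + 1)) :
    HasResolution M k (ModuleCat.of R X) := by
  have hr := hM.1.resolving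
  induction k generalizing X with
  | zero =>
    have := (hr.isResolving_hasResolution 1).finite _ hX
    obtain ⟨n, f, hf⟩ := Module.Finite.exists_fin' R X
    have h := IsShortExact.of_surjective hf
    have hK := hr.hasResolution_zero_iff.1 ((hr.hasResolution_succ_iff h (hr.free n) 0).1 hX)
    exact hr.hasResolution_zero_iff.2
      ((cogeneratedByPowers_of_mem_thickGC hC hM).right hr h hK (hr.free n) hext)
  | succ k ih =>
    have := (hr.isResolving_hasResolution (k + 2)).finite _ hX
    obtain ⟨n, f, hf⟩ := Module.Finite.exists_fin' R X
    have h := IsShortExact.of_surjective hf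
    rw [hr.hasResolution_succ_iff h (hr.free n)] at hX ⊢
    exact ih hX (h.extVanishes_left (extVanishes_of_projective k.succ_pos) hext)

theorem hasResolution_iff_extVanishesAbove (hM : M ∈ thickGC C) {n : ℕ}
    (hX : HasResolution M n (ModuleCat.of R X)) (k : ℕ) :
    HasResolution M k (ModuleCat.of R X) ↔ ExtVanishesAbove C X k := by
  refine ⟨HasResolution.extVanishesAbove hM.1.resolving hM.1.le, fun hext => ?_⟩
  obtain hnk | hkn := le_total n k
  · exact hM.1.resolving.hasResolution_mono hnk _ hX
  · exact Nat.decreasingInduction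
      (motive := fun m _ => k ≤ m → HasResolution M m (ModuleCat.of R X))
      (fun m _ ih hkm => (ih (by lia)).of_succ hC hM (hext _ (by lia))) (fun _ => hX) hkn le_rfl

theorem GC_mem_thickGC : GC C ∈ thickGC C :=
  ⟨⟨hC.isResolving_GC, le_rfl, fun _ _ _ _ h => h⟩, hC.isTotallyReflexive⟩

theorem mem_iff_GC_of_hasResolution (hM : M ∈ thickGC C) {n : ℕ}
    (hX : HasResolution M n (ModuleCat.of R X)) :
    M (ModuleCat.of R X) ↔ GC C (ModuleCat.of R X) :=
  ⟨hM.1.le _, fun h => hM.1.resolving.hasResolution_zero_iff.1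
    ((hasResolution_iff_extVanishesAbove hC hM hX 0).2 h.ext)⟩

end Noetherian

theorem isResolving_sInf {T : Set (ObjectProperty (ModuleCat.{u} R))} (hT : T.Nonempty)
    (h : ∀ Q ∈ T, IsResolving Q) : IsResolving (sInf T) where
  fg X hX := by
    obtain ⟨Q, hQ⟩ := hT
    exact (h Q hQ).fg X (sInf_objectProperty_iff.1 hX Q hQ)
  iso := ⟨fun {X Y} e hX => sInf_objectProperty_iff.2 fun Q hQ => by
    have := (h Q hQ).iso
    exact Q.prop_of_iso e (sInf_objectProperty_iff.1 hX Q hQ)⟩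
  self := sInf_objectProperty_iff.2 fun Q hQ => (h Q hQ).self
  prod_iff X Y := by
    simp only [sInf_objectProperty_iff, ← forall₂_and]
    exact forall₂_congr fun Q hQ => (h Q hQ).prod_iff X Y
  mid_iff_left S hS h₃ := by
    simp only [sInf_objectProperty_iff] at h₃ ⊢
    exact forall₂_congr fun Q hQ => (h Q hQ).mid_iff_left S hS (h₃ Q hQ)

theorem isLeast_minThick [IsNoetherianRing R] (hC : IsSemidualizing C) :
    IsLeast (thickGC C) (minThick C) := by
  have hne : (thickGC C).Nonempty := ⟨_, GC_mem_thickGC hC⟩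
  refine ⟨⟨⟨isResolving_sInf hne fun Q hQ => hQ.1.resolving, sInf_le (GC_mem_thickGC hC),
    fun S hS h₁ h₂ h₃ => sInf_objectProperty_iff.2 fun Q hQ => ?_⟩,
    sInf_objectProperty_iff.2 fun Q hQ => hQ.2⟩, fun Q hQ => sInf_le hQ⟩
  exact hQ.1.right S hS (sInf_objectProperty_iff.1 h₁ Q hQ) (sInf_objectProperty_iff.1 h₂ Q hQ) h₃

end Thick

section LocalizeThick

variable {R : Type u} [CommRing R]
variable {X Y : Type u} [AddCommGroup X] [Module R X] [AddCommGroup Y] [Module R Y]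
variable {C : ModuleCat.{u} R} {A M N : ObjectProperty (ModuleCat.{u} R)}

theorem nonempty_locMod_free_equiv (p : PrimeSpectrum R) (n : ℕ) :
    Nonempty (LocMod p (Fin n → R) ≃ₗ[LocRing p] (Fin n → LocRing p)) := by
  obtain ⟨e⟩ := nonempty_locMod_pi_equiv R p n
  obtain ⟨e'⟩ := nonempty_locMod_self_equiv p
  exact ⟨e.trans (LinearEquiv.piCongrRight fun _ => e')⟩

theorem extVanishesAbove_locMod_free (p : PrimeSpectrum R) (D : ModuleCat.{u} (LocRing p))
    (n : ℕ) : ExtVanishesAbove D (LocMod p (Fin n → R)) 0 := fun _ hi => by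
  obtain ⟨e⟩ := nonempty_locMod_free_equiv p n
  exact (extVanishes_of_projective hi).of_equiv e.symm

theorem addLoc_mono (h : M ≤ N) (p : PrimeSpectrum R) : addLoc M p ≤ addLoc N p := by
  intro V hV
  refine add_iff.1 hV _ (isAddClosed_add _) ?_
  rintro V ⟨X, hX, ⟨e⟩⟩
  exact (isAddClosed_add _).of_equiv e.toLinearEquiv (addLoc_of_mem p (h X hX))

theorem CogeneratedByPowers.of_cogenerates (hM : IsResolving M) (hcog : Cogenerates A M)
    (hA : CogeneratedByPowers C A) : CogeneratedByPowers C M := fun X hX => by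
  obtain ⟨B, Z, a, b, _, hab, hB, hZ⟩ := hcog.2 X hX
  obtain ⟨n, W, f, g, h, hW⟩ := hA B hB
  have hab := IsShortExact.of_shortExact hab
  exact ⟨n, ModuleCat.of R (Pushout b.hom f), _, _, hab.comp_pushout_inr h.injective,
    hM.mid (h.pushout_inl b.hom) hZ (hcog.1 _ hW)⟩

theorem IsSemidualizing.injective_lsmul_locModule (hC : IsSemidualizing C) (p : PrimeSpectrum R) :
    Function.Injective (LinearMap.lsmul (LocRing p) (locModule C p)) := by
  have := hC.fg
  refine (injective_iff_map_eq_zero _).2 fun a ha => ?_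
  obtain ⟨r, s, rfl⟩ := IsLocalization.exists_mk'_eq p.asIdeal.primeCompl a
  have hr : locMk p C ∘ₗ (r • LinearMap.id) = locMk p C ∘ₗ (0 : C →ₗ[R] C) := by
    ext c
    have hc : IsLocalization.mk' (LocRing p) r s • locMk p C c = 0 := LinearMap.congr_fun ha _
    calc locMk p C (r • c) = algebraMap R (LocRing p) r • locMk p C c := by
          rw [map_smul, algebraMap_smul]
      _ = 0 := by
          rw [← IsLocalization.mk'_spec' (LocRing p) r s, mul_smul, hc, smul_zero]
      _ = locMk p C 0 := (map_zero _).symm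
  obtain ⟨t, ht, htr⟩ := exists_smul_eq_smul_of_locMk_comp_eq hr
  have htr : t * r = 0 := hC.eq_zero_of_smul fun c => by
    simpa only [LinearMap.smul_apply, LinearMap.id_apply, smul_zero, LinearMap.zero_apply,
      smul_smul] using LinearMap.congr_fun htr c
  exact (IsLocalization.mk'_eq_zero_iff r s).2 ⟨⟨t, ht⟩, htr⟩

section Noetherian

variable [IsNoetherianRing R]

theorem CogeneratedByPowers.addLoc (hM : IsResolving M) (hcog : CogeneratedByPowers C M)
    (p : PrimeSpectrum R) :
    CogeneratedByPowers (locModule C p) (addLoc M p) := fun V hV => by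
  have hMp := hM.isResolving_addLoc p
  obtain ⟨L, i, r, hL, hri⟩ := hM.addLoc_eq p ▸ hV
  have hi := IsShortExact.of_injective (f := i) (Function.LeftInverse.injective hri)
  obtain ⟨e⟩ := hi.nonempty_equiv_of_retraction r hri
  have hcoker := ((hMp.prod_iff V (ModuleCat.of _ _)).1 (hMp.of_equiv e (addLoc_of_mem p hL))).2
  obtain ⟨n, W, f, g, h, hW⟩ := hcog L hL
  obtain ⟨e'⟩ := nonempty_locMod_pi_equiv C p n
  have h' : IsShortExact (e'.toLinearMap ∘ₗ locMap p f) (locMap p g ∘ₗ e'.symm.toLinearMap) :=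
    ⟨e'.injective.comp (h.locMap p).injective,
      (LinearEquiv.conj_exact_iff_exact _ _ e').2 (h.locMap p).exact,
      (h.locMap p).surjective.comp e'.symm.surjective⟩
  exact ⟨n, _, _, _, hi.comp_pushout_inr h'.injective,
    hMp.mid (h'.pushout_inl _) hcoker (addLoc_of_mem p hW)⟩

theorem exists_smul_locMap_eq [Module.Finite R X] {p : PrimeSpectrum R}
    (φ : LocMod p X →ₗ[LocRing p] LocMod p Y) :
    ∃ (f : X →ₗ[R] Y) (a : LocRing p), a • locMap p f = φ := by
  obtain ⟨f, s, hs, hf⟩ := exists_locMk_eq_smul φ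
  obtain ⟨a, ha⟩ := (IsLocalization.map_units (LocRing p)
    (⟨s, hs⟩ : p.asIdeal.primeCompl)).exists_left_inv
  refine ⟨f, a, locMod_hom_ext fun x => ?_⟩
  calc a • locMap p f (locMk p X x) = a • s • φ (locMk p X x) := by rw [locMap_mk, hf]
    _ = φ (locMk p X x) := by rw [← algebraMap_smul (LocRing p) s, smul_smul, ha, one_smul]

theorem surjective_lcomp_locMap [Module.Finite R X] (p : PrimeSpectrum R) {f : X →ₗ[R] Y}
    (hf : Function.Surjective (LinearMap.lcomp R C f)) :
    Function.Surjective (LinearMap.lcomp (LocRing p) (locModule C p) (locMap p f)) := fun φ => by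
  obtain ⟨k, a, rfl⟩ := exists_smul_locMap_eq (Y := C) φ
  obtain ⟨ψ, rfl⟩ := hf k
  refine ⟨a • locMap p ψ, locMod_hom_ext fun x => ?_⟩
  simp only [LinearMap.lcomp_apply', LinearMap.comp_apply, LinearMap.smul_apply, locMap_mk]

theorem ExtVanishesAbove.locMod (p : PrimeSpectrum R) [Module.Finite R X]
    (h : ExtVanishesAbove C X 0) : ExtVanishesAbove (locModule C p) (LocMod p X) 0 := by
  intro i hi
  obtain ⟨i, rfl⟩ := Nat.exists_eq_succ_of_ne_zero hi.ne'
  induction i generalizing X with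
  | zero =>
    obtain ⟨n, f, hf⟩ := Module.Finite.exists_fin' R X
    have hs := IsShortExact.of_surjective hf
    exact (hs.locMap p).extVanishes_one (extVanishesAbove_locMod_free p _ n 1 one_pos)
      (surjective_lcomp_locMap p (hs.surjective_lcomp (h 1 one_pos)))
  | succ i ih =>
    obtain ⟨n, f, hf⟩ := Module.Finite.exists_fin' R X
    have hs := IsShortExact.of_surjective hf
    have hker := ExtVanishesAbove.left hs extVanishesAbove_of_projective (h.mono (zero_le_one' ℕ))
    exact (hs.locMap p).extVanishes_right (ih hker i.succ_pos)
      (extVanishesAbove_locMod_free p _ n _ (Nat.succ_pos _))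

theorem IsSemidualizing.locModule (hC : IsSemidualizing C) (p : PrimeSpectrum R) :
    IsSemidualizing (locModule C p) := by
  have := hC.fg
  refine ⟨inferInstanceAs (Module.Finite (LocRing p) (LocMod p C)),
    ExtVanishesAbove.locMod (X := C) p hC.ext, hC.injective_lsmul_locModule p, fun φ => ?_⟩
  obtain ⟨f, a, rfl⟩ := exists_smul_locMap_eq (X := C) (Y := C) φ
  obtain ⟨r, hr⟩ := hC.exists_smul f
  refine ⟨a * algebraMap R (LocRing p) r, locMod_hom_ext (X := C) fun c => ?_⟩
  calc (a * algebraMap R (LocRing p) r) • locMk p C c = a • locMk p C (r • c) := by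
        rw [mul_smul, algebraMap_smul, map_smul]
    _ = a • locMap p f (locMk p C c) := by rw [locMap_mk, hr]

theorem IsThickIn.of_forall_addLoc (hA : IsResolving A) (hM : IsResolving M) (hle : A ≤ M)
    (h : ∀ p, IsThickIn (addLoc A p) (addLoc M p)) : IsThickIn A M := by
  refine ⟨hA, hle, fun S hS h₁ h₂ h₃ => ?_⟩
  have := hM.finite _ h₃
  refine hA.of_forall_locAt (X := S.X₃) fun p => (hA.addLoc_locMod_iff p).1 ?_
  exact (h p).right _ ((IsShortExact.of_shortExact hS).locMap p).shortExact (addLoc_of_mem p h₁)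
    (addLoc_of_mem p h₂) (addLoc_of_mem p h₃)

variable (hC : IsSemidualizing C)
include hC

theorem GC_locModule (p : PrimeSpectrum R) {X : ModuleCat.{u} R} (hX : GC C X) :
    GC (locModule C p) (locModule X p) := by
  have hG := (hC.locModule p).isResolving_GC
  refine le_GC_of_cogenerated (C := locModule C p)
    (fun V => ∃ X : ModuleCat.{u} R, GC C X ∧ V = locModule X p) ?_ ?_ ?_ _ ⟨X, hX, rfl⟩
  · rintro V ⟨X, hX, rfl⟩
    have := hX.fg
    exact inferInstanceAs (Module.Finite (LocRing p) (LocMod p X))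
  · rintro V ⟨X, hX, rfl⟩
    have := hX.fg
    exact ExtVanishesAbove.locMod (X := X) p hX.ext
  · rintro V ⟨X, hX, rfl⟩
    obtain ⟨n, W, f, g, h, hW⟩ := IsTotallyReflexive.exists_isShortExact_pi (X := X) hC hX
    obtain ⟨e⟩ := nonempty_locMod_pi_equiv C p n
    exact ⟨_, _, _, _, h.locMap p,
      hG.of_equiv e.symm (hG.pi n (hC.locModule p).isTotallyReflexive), W, hW, rfl⟩

theorem addLoc_mem_thickGC (hM : M ∈ thickGC C) (p : PrimeSpectrum R) :
    addLoc M p ∈ thickGC (locModule C p) := by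
  have hr := hM.1.resolving
  have hG := (hC.locModule p).isResolving_GC
  refine mem_thickGC_of_cogeneratedByPowers (hr.isResolving_addLoc p) (fun V hV => ?_)
    (addLoc_of_mem p hM.2) ((cogeneratedByPowers_of_mem_thickGC hC hM).addLoc hr p)
  refine add_iff.1 hV _ hG.isAddClosed ?_
  rintro V ⟨X, hX, ⟨e⟩⟩
  exact hG.of_equiv e.toLinearEquiv (GC_locModule hC p (hM.1.le X hX))

theorem thickGC_subset_SC : thickGC C ⊆ SC C := by
  intro M hM
  have hA := isLeast_minThick hC
  refine ⟨hM.1.resolving, ⟨hA.2 hM, fun X hX => ?_⟩, fun p => ?_⟩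
  · obtain ⟨n, W, f, g, h, hW⟩ := cogeneratedByPowers_of_mem_thickGC hC hM X hX
    exact ⟨_, _, _, _, h.complex.zero, h.shortExact, hA.1.1.resolving.pi n hA.1.2, hW⟩
  · have hAp := addLoc_mem_thickGC hC hA.1 p
    have hMp := addLoc_mem_thickGC hC hM p
    exact ⟨hAp.1.resolving, addLoc_mono (hA.2 hM) p,
      fun S hS h₁ h₂ h₃ => hAp.1.right S hS h₁ h₂ (hMp.1.le _ h₃)⟩

/-- An extension `E` of `X` by `C` lies in `M`, so it embeds into some `B` in `minThick C` with
cokernel in `M`. By thickness `B/C` is in `minThick C`, hence `C → B` splits. -/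
theorem extVanishes_one_of_mem_SC (hM : M ∈ SC C) {X : ModuleCat.{u} R} (hX : M X) :
    ExtVanishes C X 1 := by
  obtain ⟨hr, ⟨hAM, hcog⟩, hloc⟩ := hM
  have hA := (isLeast_minThick hC).1
  have hthick := IsThickIn.of_forall_addLoc hA.1.resolving hr hAM hloc
  have := hr.finite X hX
  obtain ⟨n, f, hf⟩ := Module.Finite.exists_fin' R X
  have hs := IsShortExact.of_surjective hf
  refine hs.extVanishes_one (extVanishes_of_projective one_pos) fun φ => ?_
  have hE := hs.pushout_inl φ
  obtain ⟨B, Z, a, b, _, hab, hB, hZ⟩ := hcog _ (hr.mid hE (hAM _ hA.2) hX)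
  have hab := IsShortExact.of_shortExact hab
  have hCB := hE.comp_pushout_inr hab.injective
  have hD := hthick.right _ hCB.shortExact hA.2 hB (hr.mid (hab.pushout_inl _) hX hZ)
  obtain ⟨ρ, hρ⟩ := hCB.surjective_lcomp ((hA.1.le _ hD).ext 1 one_pos) LinearMap.id
  refine ⟨ρ ∘ₗ a.hom ∘ₗ Pushout.inr φ _, LinearMap.ext fun x => ?_⟩
  calc ρ (a.hom (Pushout.inr φ _ x.1)) = ρ (a.hom (Pushout.inl φ _ (φ x))) :=
        congrArg (ρ ∘ₗ a.hom) (Pushout.condition x)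
    _ = φ x := LinearMap.congr_fun hρ (φ x)

theorem extVanishesAbove_of_mem_SC (hM : M ∈ SC C) {X : ModuleCat.{u} R} (hX : M X) :
    ExtVanishesAbove C X 0 := by
  intro i hi
  obtain ⟨i, rfl⟩ := Nat.exists_eq_succ_of_ne_zero hi.ne'
  induction i generalizing X with
  | zero => exact extVanishes_one_of_mem_SC hC hM hX
  | succ i ih =>
    have := hM.1.finite X hX
    obtain ⟨n, f, hf⟩ := Module.Finite.exists_fin' R X
    have hs := IsShortExact.of_surjective hf
    exact hs.extVanishes_right (ih (hM.1.left hs (hM.1.free n) hX) i.succ_pos)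
      (extVanishes_of_projective (Nat.succ_pos _))

theorem SC_subset_thickGC : SC C ⊆ thickGC C := by
  intro M hM
  have hA := (isLeast_minThick hC).1
  have hle : M ≤ GC C := by
    refine le_GC_of_cogenerated M hM.1.fg (fun X => extVanishesAbove_of_mem_SC hC hM) fun X hX => ?_
    obtain ⟨B, Z, a, b, _, hab, hB, hZ⟩ := hM.2.1.2 X hX
    exact ⟨B, Z, a.hom, b.hom, IsShortExact.of_shortExact hab, hA.1.le _ hB, hZ⟩
  exact mem_thickGC_of_cogeneratedByPowers hM.1 hle (hM.2.1.1 _ hA.2)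
    (CogeneratedByPowers.of_cogenerates hM.1 hM.2.1 (cogeneratedByPowers_of_mem_thickGC hC hA))

theorem SC_eq_thickGC : SC C = thickGC C :=
  (SC_subset_thickGC hC).antisymm (thickGC_subset_SC hC)

end Noetherian

end LocalizeThick

section RegularSequences

open Abelian RingTheory.Sequence
open scoped Pointwise

variable {R : Type u} [CommRing R]
variable {X Y Z K N : Type u} [AddCommGroup X] [Module R X] [AddCommGroup Y] [Module R Y]
  [AddCommGroup Z] [Module R Z] [AddCommGroup K] [Module R K] [AddCommGroup N] [Module R N]

section Covariant

variable {f : X →ₗ[R] Y} {g : Y →ₗ[R] Z}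

theorem IsShortExact.extVanishes_covariant_right (h : IsShortExact f g) {i : ℕ}
    (hY : ExtVanishes (ModuleCat.of R Y) N i) (hX : ExtVanishes (ModuleCat.of R X) N (i + 1)) :
    ExtVanishes (ModuleCat.of R Z) N i := by
  refine subsingleton_of_forall_eq 0 fun e => ?_
  obtain ⟨e', rfl⟩ := Ext.covariant_sequence_exact₃ _ h.shortExact e rfl (hX.eq_zero _)
  rw [hY.eq_zero e', Ext.zero_comp]

theorem IsShortExact.surjective_compRight (h : IsShortExact f g)
    (hX : ExtVanishes (ModuleCat.of R X) N 1) :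
    Function.Surjective (LinearMap.compRight R (M := N) g) := fun φ => by
  obtain ⟨e, he⟩ := Ext.covariant_sequence_exact₃ _ h.shortExact (Ext.mk₀ (ModuleCat.ofHom φ))
    (zero_add 1) (hX.eq_zero _)
  obtain ⟨ψ, rfl⟩ := Ext.homEquiv₀.symm.surjective e
  change (Ext.mk₀ ψ).comp (Ext.mk₀ (ModuleCat.ofHom g)) (zero_add 0) = _ at he
  rw [Ext.mk₀_comp_mk₀] at he
  have hψ := (Ext.mk₀_bijective _ _).1 he
  exact ⟨ψ.hom, LinearMap.ext fun x => congrArg (fun k => k.hom x) hψ⟩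

end Covariant

section Quotient

variable {r : R}

theorem IsShortExact.smul (hr : IsSMulRegular N r) :
    IsShortExact (LinearMap.lsmul R N r) (Submodule.mkQ (r • (⊤ : Submodule R N))) :=
  ⟨hr, LinearMap.exact_lsmul_mkQ_smul_top N r, Submodule.mkQ_surjective _⟩

theorem mkQ_smul_top_eq_zero_iff {n : N} :
    Submodule.mkQ (r • (⊤ : Submodule R N)) n = 0 ↔ ∃ n', r • n' = n :=
  LinearMap.exact_lsmul_mkQ_smul_top N r n

theorem ofList_smul_top_quotSMulTop (r : R) (rs : List R) :
    Ideal.ofList rs • (⊤ : Submodule R (QuotSMulTop r N)) =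
      (Ideal.ofList rs • ⊤ : Submodule R N).map (Submodule.mkQ (r • (⊤ : Submodule R N))) := by
  rw [Submodule.map_smul'', Submodule.map_top, Submodule.range_mkQ]

theorem mem_ofList_cons_smul_top_iff {rs : List R} {n : N} :
    n ∈ Ideal.ofList (r :: rs) • (⊤ : Submodule R N) ↔
      Submodule.mkQ (r • (⊤ : Submodule R N)) n ∈
        Ideal.ofList rs • (⊤ : Submodule R (QuotSMulTop r N)) := by
  rw [ofList_smul_top_quotSMulTop, ← Submodule.mem_comap, Submodule.comap_map_mkQ,
    Ideal.ofList_cons_smul]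

theorem ker_compRight_mkQ_smul_top (hr : IsSMulRegular N r) :
    LinearMap.ker (LinearMap.compRight R (M := X) (Submodule.mkQ (r • (⊤ : Submodule R N)))) =
      r • (⊤ : Submodule R (X →ₗ[R] N)) := by
  ext φ
  rw [LinearMap.mem_ker, Submodule.mem_smul_pointwise_iff_exists]
  constructor
  · intro hφ
    obtain ⟨ψ, hψ⟩ := (IsShortExact.smul hr).exists_lift φ fun x => LinearMap.congr_fun hφ x
    exact ⟨ψ, trivial, LinearMap.ext hψ⟩
  · rintro ⟨ψ, -, rfl⟩
    ext x
    exact mkQ_smul_top_eq_zero_iff.2 ⟨ψ x, rfl⟩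

theorem nonempty_quotSMulTop_hom_equiv (hr : IsSMulRegular N r)
    (hext : ExtVanishes (ModuleCat.of R N) X 1) :
    Nonempty (QuotSMulTop r (X →ₗ[R] N) ≃ₗ[R] (X →ₗ[R] QuotSMulTop r N)) :=
  ⟨(Submodule.quotEquivOfEq _ _ (ker_compRight_mkQ_smul_top hr).symm).trans
    (LinearMap.quotKerEquivOfSurjective _ ((IsShortExact.smul hr).surjective_compRight hext))⟩

end Quotient

theorem exists_lift_of_isWeaklyRegular (rs : List R) (hrs : IsWeaklyRegular N rs)
    (hext : ∀ i, ExtVanishes (ModuleCat.of R N) X (i + 1)) (π : N →ₗ[R] Y)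
    (hπ : Function.Surjective π)
    (hker : ∀ n, π n = 0 ↔ n ∈ Ideal.ofList rs • (⊤ : Submodule R N)) (φ : X →ₗ[R] Y) :
    ∃ ψ : X →ₗ[R] N, ∀ x, π (ψ x) = φ x := by
  induction rs generalizing N with
  | nil =>
    have hinj : Function.Injective π := (injective_iff_map_eq_zero _).2 fun n hn => by
      simpa using (hker n).1 hn
    let e := LinearEquiv.ofBijective π ⟨hinj, hπ⟩
    exact ⟨e.symm ∘ₗ φ, fun x => e.apply_symm_apply _⟩
  | cons r rs ih =>
    rw [isWeaklyRegular_cons_iff] at hrs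
    have hs := IsShortExact.smul hrs.1
    obtain ⟨π', hπ'⟩ := hs.exists_desc π fun n => by
      rw [hker, mem_ofList_cons_smul_top_iff, hs.comp_apply]
      exact Submodule.zero_mem _
    obtain ⟨ψ', hψ'⟩ := ih hrs.2
      (fun i => hs.extVanishes_covariant_right (hext i) (hext (i + 1))) π'
      (fun y => by obtain ⟨n, rfl⟩ := hπ y; exact ⟨_, hπ' n⟩)
      (fun n => by
        obtain ⟨n, rfl⟩ := hs.surjective n
        rw [hπ', hker, mem_ofList_cons_smul_top_iff])
    obtain ⟨ψ, rfl⟩ := hs.surjective_compRight (hext 0) ψ'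
    exact ⟨ψ, fun x => (hπ' _).symm.trans (hψ' x)⟩

theorem mem_ofList_smul_top_of_forall_apply_mem (rs : List R) (hrs : IsWeaklyRegular N rs)
    (hext : ∀ i, ExtVanishes (ModuleCat.of R N) X (i + 1)) (φ : X →ₗ[R] N)
    (hφ : ∀ x, φ x ∈ Ideal.ofList rs • (⊤ : Submodule R N)) :
    φ ∈ Ideal.ofList rs • (⊤ : Submodule R (X →ₗ[R] N)) := by
  induction rs generalizing N with
  | nil =>
    have : φ = 0 := LinearMap.ext fun x => by simpa using hφ x
    rw [this]
    exact Submodule.zero_mem _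
  | cons r rs ih =>
    rw [isWeaklyRegular_cons_iff] at hrs
    have hs := IsShortExact.smul hrs.1
    let q := LinearMap.compRight R (M := X) (Submodule.mkQ (r • (⊤ : Submodule R N)))
    have hqφ : q φ ∈ Ideal.ofList rs • (⊤ : Submodule R (X →ₗ[R] QuotSMulTop r N)) :=
      ih hrs.2 (fun i => hs.extVanishes_covariant_right (hext i) (hext (i + 1))) _
        (fun x => mem_ofList_cons_smul_top_iff.1 (hφ x))
    rw [← LinearMap.range_eq_top.2 (hs.surjective_compRight (hext 0)), ← Submodule.map_top,
      ← Submodule.map_smul''] at hqφ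
    obtain ⟨ψ, hψ, hψφ⟩ := hqφ
    have hsub : φ - ψ ∈ r • (⊤ : Submodule R (X →ₗ[R] N)) := by
      rw [← ker_compRight_mkQ_smul_top hrs.1, LinearMap.sub_mem_ker_iff, hψφ]
    rw [Ideal.ofList_cons_smul, ← sub_add_cancel φ ψ]
    exact Submodule.add_mem_sup hsub hψ

section Hom

variable [IsNoetherianRing R] [Module.Finite R X] [Module.Finite R N]

theorem isSMulRegular_of_hom (hX : Module.annihilator R X = ⊥) {r : R}
    (hr : IsSMulRegular (X →ₗ[R] N) r) : IsSMulRegular N r := by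
  let L := LinearMap.ker (LinearMap.lsmul R N r)
  have : Subsingleton (X →ₗ[R] L) := by
    refine subsingleton_of_forall_eq 0 fun φ => ?_
    have hφ : L.subtype ∘ₗ φ = 0 := hr (LinearMap.ext fun x =>
      (LinearMap.mem_ker.1 (φ x).2).trans (smul_zero r).symm)
    ext x
    exact LinearMap.congr_fun hφ x
  obtain ⟨a, ha, hreg⟩ := IsSMulRegular.subsingleton_linearMap_iff.1 this
  rw [hX, Ideal.mem_bot] at ha
  subst ha
  have hL : ∀ x : L, x = 0 := fun x => hreg (by simp)
  exact (injective_iff_map_eq_zero (LinearMap.lsmul R N r)).2 fun n hn =>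
    congrArg Subtype.val (hL ⟨n, hn⟩)

theorem isWeaklyRegular_of_hom (hX : Module.annihilator R X = ⊥) (rs : List R)
    (hext : ∀ i, ExtVanishes (ModuleCat.of R N) X (i + 1))
    (hrs : IsWeaklyRegular (X →ₗ[R] N) rs) : IsWeaklyRegular N rs := by
  induction rs generalizing N with
  | nil => exact IsWeaklyRegular.nil _ _
  | cons r rs ih =>
    rw [isWeaklyRegular_cons_iff] at hrs ⊢
    have hr := isSMulRegular_of_hom hX hrs.1
    have hs := IsShortExact.smul hr
    obtain ⟨e⟩ := nonempty_quotSMulTop_hom_equiv hr (hext 0)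
    exact ⟨hr, ih (fun i => hs.extVanishes_covariant_right (hext i) (hext (i + 1)))
      ((LinearEquiv.isWeaklyRegular_congr e rs).1 hrs.2)⟩

end Hom

namespace IsShortExact

variable {f : X →ₗ[R] Y} {g : Y →ₗ[R] Z}

theorem quotSMulTop (h : IsShortExact f g) {r : R} (hr : IsSMulRegular Z r) :
    IsShortExact (QuotSMulTop.map r f) (QuotSMulTop.map r g) where
  injective := by
    refine (injective_iff_map_eq_zero _).2 fun x hx => ?_
    obtain ⟨x, rfl⟩ := Submodule.mkQ_surjective _ x
    obtain ⟨y, hy⟩ :=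
      mkQ_smul_top_eq_zero_iff.1 (show Submodule.mkQ (r • (⊤ : Submodule R Y)) (f x) = 0 from hx)
    have hgy : g y = 0 := hr (by
      change r • g y = r • 0
      rw [← map_smul, hy, h.comp_apply, smul_zero])
    obtain ⟨x', rfl⟩ := h.exists_preimage hgy
    rw [← map_smul] at hy
    exact mkQ_smul_top_eq_zero_iff.2 ⟨x', h.injective hy⟩
  exact := QuotSMulTop.map_exact r h.exact h.surjective
  surjective := QuotSMulTop.map_surjective r h.surjective

theorem mem_ofList_smul_top (h : IsShortExact f g) (rs : List R) (hrs : IsWeaklyRegular Z rs)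
    {x : X} (hx : f x ∈ Ideal.ofList rs • (⊤ : Submodule R Y)) :
    x ∈ Ideal.ofList rs • (⊤ : Submodule R X) := by
  induction rs generalizing X Y Z with
  | nil =>
    have : f x = 0 := by simpa using hx
    rw [h.injective (this.trans (map_zero f).symm)]
    exact Submodule.zero_mem _
  | cons r rs ih =>
    rw [isWeaklyRegular_cons_iff] at hrs
    rw [mem_ofList_cons_smul_top_iff] at hx ⊢
    exact ih (h.quotSMulTop hrs.1) hrs.2 hx

theorem isWeaklyRegular_take_succ (h : IsShortExact f g) (rs : List R)
    (hY : IsWeaklyRegular Y rs) (k : ℕ) (hZ : IsWeaklyRegular Z (rs.take k)) :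
    IsWeaklyRegular X (rs.take (k + 1)) := by
  induction rs generalizing X Y Z k with
  | nil => exact IsWeaklyRegular.nil _ _
  | cons r rs ih =>
    rw [isWeaklyRegular_cons_iff] at hY
    rw [List.take_succ_cons, isWeaklyRegular_cons_iff]
    refine ⟨hY.1.of_injective f h.injective, ?_⟩
    rcases k with _ | k
    · exact IsWeaklyRegular.nil _ _
    · rw [List.take_succ_cons, isWeaklyRegular_cons_iff] at hZ
      exact ih (h.quotSMulTop hZ.1) hY.2 k hZ.2

end IsShortExact

theorem nontrivial_linearMap_of_maximalIdeal_smul_eq_zero [IsNoetherianRing R] [IsLocalRing R]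
    [Module.Finite R X] [Module.Finite R N] [Nontrivial X] {n : N} (hn : n ≠ 0)
    (hmn : ∀ a ∈ IsLocalRing.maximalIdeal R, a • n = 0) : Nontrivial (X →ₗ[R] N) := by
  rw [← not_subsingleton_iff_nontrivial, IsSMulRegular.subsingleton_linearMap_iff]
  rintro ⟨a, ha, hreg⟩
  have ham : a ∈ IsLocalRing.maximalIdeal R := by
    rw [IsLocalRing.mem_maximalIdeal, mem_nonunits_iff]
    intro hu
    obtain ⟨x, hx⟩ := exists_ne (0 : X)
    exact hx (hu.smul_eq_zero.1 (Module.mem_annihilator.1 ha x))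
  exact hn (hreg ((hmn a ham).trans (smul_zero a).symm))

section Semidualizing

variable {C : ModuleCat.{u} R} [IsNoetherianRing R] (hC : IsSemidualizing C) {rs : List R}
  (hrs : IsWeaklyRegular R rs)
include hC hrs

theorem IsSemidualizing.isWeaklyRegular : IsWeaklyRegular C rs := by
  have := hC.fg
  obtain ⟨e⟩ := hC.nonempty_equiv_end
  refine isWeaklyRegular_of_hom (X := C) ?_ rs (fun i => hC.ext _ i.succ_pos)
    ((LinearEquiv.isWeaklyRegular_congr e rs).1 hrs)
  exact eq_bot_iff.2 fun r hr => hC.eq_zero_of_smul (Module.mem_annihilator.1 hr)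

theorem IsSemidualizing.mem_ofList {z : R}
    (hz : ∀ c : C, z • c ∈ Ideal.ofList rs • (⊤ : Submodule R C)) : z ∈ Ideal.ofList rs := by
  let e : R ≃ₗ[R] (C →ₗ[R] C) := LinearEquiv.ofBijective _ hC.homothety
  have h : e z ∈ Ideal.ofList rs • (⊤ : Submodule R (C →ₗ[R] C)) :=
    mem_ofList_smul_top_of_forall_apply_mem (X := C) rs (hC.isWeaklyRegular hrs)
      (fun i => hC.ext _ i.succ_pos) _ hz
  rw [← LinearEquiv.range e, ← Submodule.map_top, ← Submodule.map_smul''] at h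
  obtain ⟨a, ha, hae⟩ := h
  rw [e.injective hae] at ha
  simpa using ha

theorem IsTotallyReflexive.exists_mkQ_apply_eq (hK : GC C (ModuleCat.of R K))
    (l : (K →ₗ[R] C) →ₗ[R] (C ⧸ Ideal.ofList rs • (⊤ : Submodule R C))) :
    ∃ x : K, ∀ φ : K →ₗ[R] C, (Ideal.ofList rs • (⊤ : Submodule R C)).mkQ (φ x) = l φ := by
  obtain ⟨Φ, hΦ⟩ := exists_lift_of_isWeaklyRegular (X := K →ₗ[R] C) rs (hC.isWeaklyRegular hrs)
    (fun i => hK.ext_dual _ i.succ_pos) _ (Submodule.mkQ_surjective _)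
    (fun _ => Submodule.Quotient.mk_eq_zero _) l
  obtain ⟨x, rfl⟩ := hK.reflexive.2 Φ
  exact ⟨x, hΦ⟩

variable {n : ℕ} {f : K →ₗ[R] (Fin n → R)} {g : (Fin n → R) →ₗ[R] Y} (h : IsShortExact f g)
  (hY : IsWeaklyRegular Y rs) (hK : GC C (ModuleCat.of R K))
include h hY hK

theorem eq_zero_of_comp_lcomp_eq_zero
    {l : (K →ₗ[R] C) →ₗ[R] (C ⧸ Ideal.ofList rs • (⊤ : Submodule R C))}
    (hl : l ∘ₗ LinearMap.lcomp R C f = 0) : l = 0 := by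
  obtain ⟨x, hx⟩ := IsTotallyReflexive.exists_mkQ_apply_eq hC hrs hK l
  have hfxi (i : Fin n) : f x i ∈ Ideal.ofList rs := hC.mem_ofList hrs fun c => by
    rw [← Submodule.Quotient.mk_eq_zero]
    let ψ : (Fin n → R) →ₗ[R] C := LinearMap.toSpanSingleton R C c ∘ₗ LinearMap.proj i
    exact (hx (LinearMap.lcomp R C f ψ)).trans (LinearMap.congr_fun hl ψ)
  have hfx : f x ∈ Ideal.ofList rs • (⊤ : Submodule R (Fin n → R)) := by
    rw [pi_eq_sum_univ' (f x)]
    exact Submodule.sum_mem _ fun i _ => Submodule.smul_mem_smul (hfxi i) trivial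
  ext φ
  have hφx : φ x ∈ (Ideal.ofList rs • ⊤ : Submodule R K).map φ :=
    ⟨x, h.mem_ofList_smul_top rs hY hfx, rfl⟩
  rw [Submodule.map_smul''] at hφx
  rw [← hx, LinearMap.zero_apply]
  exact (Submodule.Quotient.mk_eq_zero _).2 (Submodule.smul_mono le_rfl le_top hφx)

variable [IsLocalRing R] {z : R} (hz : z ∉ Ideal.ofList rs)
  (hmz : ∀ a ∈ IsLocalRing.maximalIdeal R, a * z ∈ Ideal.ofList rs)
include hz hmz

theorem surjective_lcomp_of_isWeaklyRegular : Function.Surjective (LinearMap.lcomp R C f) := by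
  have := hC.fg
  have : Module.Finite R K := hK.fg
  let I := Ideal.ofList rs
  obtain ⟨c, hc⟩ : ∃ c : C, (I • (⊤ : Submodule R C)).mkQ (z • c) ≠ 0 := by
    by_contra! hcon
    exact hz (hC.mem_ofList hrs fun c => (Submodule.Quotient.mk_eq_zero _).1 (hcon c))
  let W := (K →ₗ[R] C) ⧸ LinearMap.range (LinearMap.lcomp R C f)
  have hW (l : W →ₗ[R] C ⧸ I • (⊤ : Submodule R C)) : l = 0 := by
    refine Submodule.linearMap_qext _ ?_
    rw [eq_zero_of_comp_lcomp_eq_zero hC hrs h hY hK (l := l ∘ₗ Submodule.mkQ _),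
      LinearMap.zero_comp]
    ext φ
    rw [LinearMap.comp_assoc, LinearMap.range_mkQ_comp, LinearMap.comp_zero]
  rw [← LinearMap.range_eq_top, ← Submodule.Quotient.subsingleton_iff]
  by_contra hnt
  rw [not_subsingleton_iff_nontrivial] at hnt
  have := nontrivial_linearMap_of_maximalIdeal_smul_eq_zero (X := W) hc fun a ha => by
    rw [← map_smul, smul_smul]
    exact (Submodule.Quotient.mk_eq_zero _).2 (Submodule.smul_mem_smul (hmz a ha) trivial)
  obtain ⟨l, hl⟩ := exists_ne (0 : W →ₗ[R] C ⧸ I • (⊤ : Submodule R C))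
  exact hl (hW l)

end Semidualizing

section Dimension

variable [IsNoetherianRing R] [IsLocalRing R] {C : ModuleCat.{u} R} (hC : IsSemidualizing C)
  {M : ObjectProperty (ModuleCat.{u} R)} (hM : M ∈ thickGC C) {rs : List R}
  (hrs : IsWeaklyRegular R rs) {z : R} (hz : z ∉ Ideal.ofList rs)
  (hmz : ∀ a ∈ IsLocalRing.maximalIdeal R, a * z ∈ Ideal.ofList rs)
include hC hM hrs hz hmz

theorem HasResolution.of_succ_of_isWeaklyRegular_take {j k : ℕ} (hjk : rs.length ≤ k + j)
    (hreg : IsWeaklyRegular X (rs.take k)) (hX : HasResolution M (j + 1) (ModuleCat.of R X)) :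
    HasResolution M j (ModuleCat.of R X) := by
  have hr := hM.1.resolving
  induction j generalizing k X with
  | zero =>
    have := (hr.isResolving_hasResolution 1).finite _ hX
    obtain ⟨n, g, hg⟩ := Module.Finite.exists_fin' R X
    have h := IsShortExact.of_surjective hg
    have hK := hr.hasResolution_zero_iff.1 ((hr.hasResolution_succ_iff h (hr.free n) 0).1 hX)
    rw [List.take_of_length_le (by lia)] at hreg
    exact hX.of_succ hC hM (h.extVanishes_one (extVanishes_of_projective one_pos)
      (surjective_lcomp_of_isWeaklyRegular hC hrs h hreg (hM.1.le _ hK) hz hmz))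
  | succ j ih =>
    have := (hr.isResolving_hasResolution (j + 2)).finite _ hX
    obtain ⟨n, g, hg⟩ := Module.Finite.exists_fin' R X
    have h := IsShortExact.of_surjective hg
    have hfree : IsWeaklyRegular (Fin n → R) rs :=
      (LinearEquiv.isWeaklyRegular_congr (TensorProduct.rid R (Fin n → R)) rs).1
        hrs.isWeaklyRegular_lTensor
    rw [hr.hasResolution_succ_iff h (hr.free n)] at hX ⊢
    exact ih (k := k + 1) (by lia) (h.isWeaklyRegular_take_succ rs hfree k hreg) hX

theorem HasResolution.length_of_isWeaklyRegular {N : ℕ}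
    (hX : HasResolution M N (ModuleCat.of R X)) :
    HasResolution M rs.length (ModuleCat.of R X) := by
  obtain hN | hN := le_total N rs.length
  · exact hM.1.resolving.hasResolution_mono hN _ hX
  · exact Nat.decreasingInduction
      (motive := fun m _ => rs.length ≤ m → HasResolution M m (ModuleCat.of R X))
      (fun m _ ih hm => (ih (by lia)).of_succ_of_isWeaklyRegular_take hC hM hrs hz hmz (k := 0)
        (by lia) (IsWeaklyRegular.nil _ _))
      (fun _ => hX) hN le_rfl

end Dimension

end RegularSequences

section ExtMaps

open Abelian

variable {R : Type u} [CommRing R] {C : ModuleCat.{u} R}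
variable {X Y Z : Type u} [AddCommGroup X] [Module R X] [AddCommGroup Y] [Module R Y]
  [AddCommGroup Z] [Module R Z]

variable (C) in
/-- The map `Extⁱ(k, C)` induced by a linear map `k`. -/
noncomputable def extMap (k : X →ₗ[R] Y) (i : ℕ) :
    Ext (ModuleCat.of R Y) C i →ₗ[R] Ext (ModuleCat.of R X) C i :=
  Ext.bilinearCompOfLinear R _ _ _ 0 i i (zero_add i) (Ext.mk₀ (ModuleCat.ofHom k))

theorem extMap_apply (k : X →ₗ[R] Y) (i : ℕ) (e : Ext (ModuleCat.of R Y) C i) :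
    extMap C k i e = (Ext.mk₀ (ModuleCat.ofHom k)).comp e (zero_add i) := rfl

theorem extMap_extMap (k : X →ₗ[R] Y) (l : Y →ₗ[R] Z) (i : ℕ) (e : Ext (ModuleCat.of R Z) C i) :
    extMap C k i (extMap C l i e) = extMap C (l ∘ₗ k) i e := by
  simp only [extMap_apply, ModuleCat.ofHom_comp]
  rw [← Ext.mk₀_comp_mk₀_assoc]

theorem extMap_add (k l : X →ₗ[R] Y) (i : ℕ) (e : Ext (ModuleCat.of R Y) C i) :
    extMap C (k + l) i e = extMap C k i e + extMap C l i e := by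
  simp only [extMap_apply, ← Ext.add_comp, ← Ext.mk₀_add]
  rfl

theorem extMap_smul (r : R) (k : X →ₗ[R] Y) (i : ℕ) (e : Ext (ModuleCat.of R Y) C i) :
    extMap C (r • k) i e = r • extMap C k i e := by
  simp only [extMap_apply, ← Ext.smul_comp, ← Ext.mk₀_smul]
  rfl

theorem extMap_id (i : ℕ) (e : Ext (ModuleCat.of R X) C i) : extMap C LinearMap.id i e = e :=
  Ext.mk₀_id_comp e

theorem extMap_comp (k : X →ₗ[R] Y) {D : ModuleCat.{u} R} {i j n : ℕ}
    (e : Ext (ModuleCat.of R Y) D i) (τ : Ext D C j) (hn : i + j = n) :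
    extMap C k n (e.comp τ hn) = (extMap D k i e).comp τ hn :=
  (Ext.comp_assoc _ _ _ (zero_add i) hn (by lia)).symm

theorem ext_pi_eq_zero {N : ModuleCat.{u} R} {b i : ℕ} (e : Ext N (ModuleCat.of R (Fin b → C)) i)
    (he : ∀ j, e.comp (Ext.mk₀ (ModuleCat.ofHom
      (LinearMap.proj (R := R) (φ := fun _ : Fin b => C) j))) (add_zero i) = 0) : e = 0 := by
  have hid : 𝟙 (ModuleCat.of R (Fin b → C)) = ∑ j, ModuleCat.ofHom (LinearMap.proj j) ≫
      ModuleCat.ofHom (LinearMap.single R (fun _ : Fin b => C) j) := by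
    refine ModuleCat.hom_ext (LinearMap.ext fun x => funext fun k => ?_)
    rw [ModuleCat.hom_sum]
    simp [LinearMap.sum_apply, Finset.sum_apply, Pi.single_apply]
  rw [← Ext.comp_mk₀_id e, hid, Ext.mk₀_sum, Ext.comp_sum]
  refine Finset.sum_eq_zero fun j _ => ?_
  rw [← Ext.mk₀_comp_mk₀, ← Ext.comp_assoc_of_second_deg_zero, he, Ext.zero_comp]

theorem ExtVanishes.covariant_pi {i : ℕ} (h : ExtVanishes C X i) (b : ℕ) :
    ExtVanishes (ModuleCat.of R (Fin b → C)) X i :=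
  subsingleton_of_forall_eq 0 fun e => ext_pi_eq_zero e fun _ => h.eq_zero _

namespace IsShortExact

variable {f : X →ₗ[R] Y} {g : Y →ₗ[R] Z}

theorem extClass_comp_smul_id (h : IsShortExact f g) (r : R) :
    h.shortExact.extClass.comp (Ext.mk₀ (ModuleCat.ofHom (r • LinearMap.id))) (add_zero 1) =
      r • h.shortExact.extClass := by
  change h.shortExact.extClass.comp (Ext.mk₀ (r • 𝟙 h.complex.X₁)) (add_zero 1) = _
  rw [Ext.mk₀_smul, Ext.comp_smul, Ext.comp_mk₀_id]

theorem exists_map {X' Y' Z' : Type u} [AddCommGroup X'] [Module R X'] [AddCommGroup Y']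
    [Module R Y'] [AddCommGroup Z'] [Module R Z'] (h : IsShortExact f g) {f' : X' →ₗ[R] Y'}
    {g' : Y' →ₗ[R] Z'} (h' : IsShortExact f' g') (a : X →ₗ[R] X') (b : Y →ₗ[R] Y')
    (hab : b ∘ₗ f = f' ∘ₗ a) :
    ∃ c : Z →ₗ[R] Z', extMap (ModuleCat.of R X') c 1 h'.shortExact.extClass =
      h.shortExact.extClass.comp (Ext.mk₀ (ModuleCat.ofHom a)) (add_zero 1) := by
  obtain ⟨c, hc⟩ := h.exists_desc (g' ∘ₗ b) fun x => by
    rw [LinearMap.comp_apply, show b (f x) = f' (a x) from LinearMap.congr_fun hab x,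
      h'.comp_apply]
  let F : h.complex ⟶ h'.complex :=
    { τ₁ := ModuleCat.ofHom a
      τ₂ := ModuleCat.ofHom b
      τ₃ := ModuleCat.ofHom c
      comm₁₂ := ModuleCat.hom_ext hab.symm
      comm₂₃ := by ext y; exact (hc y).symm }
  exact ⟨c, (ShortComplex.ShortExact.extClass_naturality h.shortExact h'.shortExact F).symm⟩

theorem exists_extMap_extClass_eq {X' Y' Z' : Type u} [AddCommGroup X'] [Module R X']
    [AddCommGroup Y'] [Module R Y'] [AddCommGroup Z'] [Module R Z'] (h : IsShortExact f g)
    {f' : X' →ₗ[R] Y'} {g' : Y' →ₗ[R] Z'} (h' : IsShortExact f' g') {a : X →ₗ[R] X'}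
    {b : Y →ₗ[R] Y'} (hab : b ∘ₗ f = f' ∘ₗ a) {η : X' →ₗ[R] X} (hη : η ∘ₗ a = LinearMap.id) :
    ∃ (c : Z →ₗ[R] Z') (e : Ext (ModuleCat.of R Z') (ModuleCat.of R X) 1),
      extMap (ModuleCat.of R X) c 1 e = h.shortExact.extClass := by
  obtain ⟨c, hc⟩ := h.exists_map h' a b hab
  refine ⟨c, h'.shortExact.extClass.comp (Ext.mk₀ (ModuleCat.ofHom η)) (add_zero 1), ?_⟩
  rw [extMap_comp]
  erw [hc]
  rw [Ext.comp_assoc_of_third_deg_zero, Ext.mk₀_comp_mk₀, ← ModuleCat.ofHom_comp, hη]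
  exact Ext.comp_mk₀_id _

theorem exists_smul_lift (h : IsShortExact f g) {r : R} (k : Y →ₗ[R] X)
    (hk : ∀ x, k (f x) = r • x) : ∃ l : Z →ₗ[R] Y, ∀ z, g (l z) = r • z := by
  obtain ⟨l, hl⟩ := h.exists_desc (r • LinearMap.id - f ∘ₗ k) fun x => by simp [hk]
  refine ⟨l, fun z => ?_⟩
  obtain ⟨y, rfl⟩ := h.surjective z
  simp [hl, h.comp_apply]

end IsShortExact

theorem IsSemidualizing.exists_apply_eq_sum (hC : IsSemidualizing C) {b : ℕ}
    (φ : (Fin b → C) →ₗ[R] C) : ∃ a : Fin b → R, ∀ x, φ x = ∑ j, a j • x j := by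
  choose a ha using fun j => hC.exists_smul (φ ∘ₗ LinearMap.single R (fun _ : Fin b => C) j)
  refine ⟨a, fun x => ?_⟩
  conv_lhs => rw [← Finset.univ_sum_single x, map_sum]
  exact Finset.sum_congr rfl fun j _ => ha j (x j)

end ExtMaps

section TruncatedDual

open Abelian

variable {R : Type u} [CommRing R] {C : ModuleCat.{u} R} {I : Ideal R}

/-- `T` is the cokernel of the last map of `C → C^b₁ → ⋯ → C^bₙ₊₁`, the dual with respect to `C` of
the beginning of a free resolution of `R ⧸ I`, and `τ ∈ Extⁿ⁺¹(T, C)` is the Yoneda class of the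
resulting exact sequence. The surjectivity in `step` says that `C^b → Hom(T, C)` is a step of the
free resolution. -/
inductive IsTruncatedDual (C : ModuleCat.{u} R) (I : Ideal R) :
    (n : ℕ) → (T : ModuleCat.{u} R) → Ext T C (n + 1) → Prop
  | base {b : ℕ} (r : Fin b → R) (hr : Ideal.span (Set.range r) = I) {T : ModuleCat.{u} R}
      {g : (Fin b → C) →ₗ[R] T}
      (h : IsShortExact (LinearMap.pi fun j => r j • LinearMap.id : C →ₗ[R] (Fin b → C)) g) :
      IsTruncatedDual C I 0 T h.shortExact.extClass
  | step {n : ℕ} {T : ModuleCat.{u} R} {τ : Ext T C (n + 1)} (hT : IsTruncatedDual C I n T τ)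
      {b : ℕ} {T' : ModuleCat.{u} R} {f : T →ₗ[R] (Fin b → C)} {g : (Fin b → C) →ₗ[R] T'}
      (h : IsShortExact f g) (hext : Function.Surjective (LinearMap.lcomp R C f)) :
      IsTruncatedDual C I (n + 1) T' (h.shortExact.extClass.comp τ (add_comm 1 (n + 1)))

namespace IsTruncatedDual

variable {n : ℕ} {T : ModuleCat.{u} R} {τ : Ext T C (n + 1)} {M : ObjectProperty (ModuleCat.{u} R)}

theorem hasResolution (hM : IsResolving M) (hMC : M C) (hT : IsTruncatedDual C I n T τ) :
    HasResolution M (n + 1) T := by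
  induction hT with
  | base _ _ h =>
    exact (hM.hasResolution_succ_iff h (hM.pi _ hMC) 0).2 (hM.hasResolution_zero_iff.2 hMC)
  | step _ h _ ih => exact (hM.hasResolution_succ_iff h (hM.pi _ hMC) _).2 ih

theorem exists_pi_surjective (hT : IsTruncatedDual C I n T τ) :
    ∃ (b : ℕ) (g : (Fin b → C) →ₗ[R] T), Function.Surjective g := by
  cases hT with
  | base _ _ h => exact ⟨_, _, h.surjective⟩
  | step _ h _ => exact ⟨_, _, h.surjective⟩

theorem exists_smul_eq_comp_pi (hT : IsTruncatedDual C I n T τ) {r : R} (hr : r ∈ I) :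
    ∃ (b : ℕ) (u : T →ₗ[R] (Fin b → C)) (v : (Fin b → C) →ₗ[R] T), ∀ x, v (u x) = r • x := by
  induction hT with
  | base s hs h =>
    rw [← hs, Ideal.mem_span_range_iff_exists_fun] at hr
    obtain ⟨a, rfl⟩ := hr
    obtain ⟨l, hl⟩ := h.exists_smul_lift (r := ∑ i, a i * s i)
      (∑ j, a j • LinearMap.proj j) fun x => by
        simp [LinearMap.sum_apply, Finset.sum_smul, smul_smul]
    exact ⟨_, l, _, hl⟩
  | step _ h hext ih =>
    obtain ⟨b, u, v, huv⟩ := ih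
    choose w hw using fun j => hext (LinearMap.proj j ∘ₗ u)
    have hwu : LinearMap.pi w ∘ₗ _ = u :=
      LinearMap.ext fun x => funext fun j => LinearMap.congr_fun (hw j) x
    obtain ⟨l, hl⟩ := h.exists_smul_lift (r := r) (v ∘ₗ LinearMap.pi w) fun x =>
      (congrArg v (LinearMap.congr_fun hwu x)).trans (huv x)
    exact ⟨_, l, _, hl⟩

theorem le_smulFactorsIdeal (hM : IsResolving M) (hMC : M C) (hT : IsTruncatedDual C I n T τ) :
    I ≤ smulFactorsIdeal hM T := by
  intro r hr
  obtain ⟨b, u, v, huv⟩ := hT.exists_smul_eq_comp_pi hr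
  exact ⟨ModuleCat.of R (Fin b → C), u, v, hM.pi _ hMC, huv⟩

theorem smul_eq_zero (hC : IsSemidualizing C) (hT : IsTruncatedDual C I n T τ) {r : R}
    (hr : r ∈ I) : r • τ = 0 := by
  obtain ⟨b, u, v, huv⟩ := hT.exists_smul_eq_comp_pi hr
  exact smul_ext_eq_zero (X := T) huv (ExtVanishes.pi (X := C) (hC.ext _ n.succ_pos) b) τ

theorem exists_mem_of_hasResolution_locIn [IsNoetherianRing R] (hC : IsSemidualizing C)
    (hM : M ∈ thickGC C) {S : Submonoid R} (hT : IsTruncatedDual C I n T τ)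
    (h : HasResolution (locIn M S) n T) : ∃ s ∈ S, s ∈ I := by
  have hMS := hM.1.resolving.isResolving_locIn S
  have hCS : locIn M S C := hM.1.resolving.le_locIn S _ hM.2
  induction hT with
  | @base b r hrI T g hs =>
    obtain ⟨-, s, hsS, Y, u, v, hY, huv⟩ := hMS.hasResolution_zero_iff.1 h
    refine ⟨s, hsS, ?_⟩
    have hsτ : s • hs.shortExact.extClass = 0 :=
      smul_ext_eq_zero (X := T) huv ((hM.1.le _ hY).ext 1 one_pos) hs.shortExact.extClass
    obtain ⟨ψ, hψ⟩ := hs.exists_comp_eq_of_extClass_comp_eq_zero (C := C)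
      (φ := s • LinearMap.id) ((hs.extClass_comp_smul_id s).trans hsτ)
    obtain ⟨a, ha⟩ := hC.exists_apply_eq_sum ψ
    have hsum : s = ∑ j, a j * r j := sub_eq_zero.1 <| hC.eq_zero_of_smul fun c => by
      have hψc : ψ (fun j => r j • c) = s • c := LinearMap.congr_fun hψ c
      rw [sub_smul, ← hψc, ha]
      simp [Finset.sum_smul, smul_smul]
    rw [hsum, ← hrI]
    exact Ideal.sum_mem _ fun j _ => Ideal.mul_mem_left _ _ (Ideal.subset_span ⟨j, rfl⟩)
  | step _ hs _ ih => exact ih ((hMS.hasResolution_succ_iff hs (hMS.pi _ hCS) _).1 h)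

theorem exists_eq_smul (hC : IsSemidualizing C) (hT : IsTruncatedDual C I n T τ)
    (e : Ext T C (n + 1)) : ∃ a : R, e = a • τ := by
  induction hT with
  | base _ _ h =>
    obtain ⟨e', rfl⟩ :=
      h.exists_extClass_comp_eq (ExtVanishes.pi (X := C) (hC.ext _ one_pos) _) e
    obtain ⟨φ, rfl⟩ := Ext.homEquiv₀.symm.surjective e'
    obtain ⟨a, ha⟩ := hC.exists_smul φ.hom
    obtain rfl : φ = ModuleCat.ofHom (a • LinearMap.id) :=
      ModuleCat.hom_ext (LinearMap.ext ha)
    exact ⟨a, h.extClass_comp_smul_id a⟩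
  | @step n T τ _ b T' f g h _ ih =>
    obtain ⟨e', rfl⟩ :=
      h.exists_extClass_comp_eq (ExtVanishes.pi (X := C) (hC.ext _ (Nat.succ_pos _)) _) e
    obtain ⟨a, rfl⟩ := ih e'
    exact ⟨a, Ext.comp_smul _ _ _ _⟩

theorem extVanishes (hC : IsSemidualizing C) (hT : IsTruncatedDual C I n T τ) {j : ℕ}
    (hj : 0 < j) (hjn : j < n + 1) : ExtVanishes C T j := by
  induction hT generalizing j with
  | base => lia
  | @step n T _ _ b T' f g h hext ih =>
    have hb (i : ℕ) : ExtVanishes C (Fin b → C) (i + 1) :=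
      ExtVanishes.pi (X := C) (hC.ext _ i.succ_pos) _
    obtain _ | _ | j := j
    · lia
    · exact h.extVanishes_one (hb 0) hext
    · exact h.extVanishes_right (ih j.succ_pos (by lia)) (hb _)

theorem exists_comp_eq (hT : IsTruncatedDual C I n T τ) {X : ModuleCat.{u} R} (k : ℕ) {m : ℕ}
    (hm : k + (n + 1) = m) (hX : ∀ j, k < j → j < m → ExtVanishes C X j) (e : Ext X C m)
    (he : ∀ r ∈ I, r • e = 0) : ∃ g : Ext X T k, g.comp τ hm = e := by
  induction hT generalizing k m with
  | @base b r hr T g h =>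
    refine Ext.covariant_sequence_exact₁ _ h.shortExact e (ext_pi_eq_zero _ fun j => ?_) hm
    rw [Ext.comp_assoc_of_second_deg_zero, Ext.mk₀_comp_mk₀]
    change e.comp (Ext.mk₀ (r j • 𝟙 C)) (add_zero m) = 0
    rw [Ext.mk₀_smul, Ext.comp_smul, Ext.comp_mk₀_id]
    exact he _ (hr ▸ Ideal.subset_span ⟨j, rfl⟩)
  | @step n T τ _ b T' f g h _ ih =>
    obtain ⟨g', rfl⟩ := ih (k + 1) (by lia) (fun j h1 h2 => hX j (by lia) h2) e he
    have hpi := ExtVanishes.covariant_pi (X := X) (hX (k + 1) (by lia) (by lia)) b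
    obtain ⟨l, rfl⟩ := Ext.covariant_sequence_exact₁ _ h.shortExact g' (hpi.eq_zero _) rfl
    exact ⟨l, (Ext.comp_assoc _ _ _ _ _ (by lia)).symm⟩

end IsTruncatedDual

end TruncatedDual

section TruncatedDualExistence

open Abelian

variable {R : Type u} [CommRing R] {C : ModuleCat.{u} R} {I : Ideal R}

theorem eq_zero_of_extVanishes_quotient {T : ModuleCat.{u} R} (h : ExtVanishes T (R ⧸ I) 0) {x : T}
    (hx : ∀ r ∈ I, r • x = 0) : x = 0 := by
  let φ : (R ⧸ I) →ₗ[R] T := Submodule.liftQ I (LinearMap.toSpanSingleton R T x) hx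
  have hφ : Ext.mk₀ (ModuleCat.ofHom φ) = Ext.mk₀ 0 := Subsingleton.elim _ _
  have hφ0 := congrArg ModuleCat.Hom.hom ((Ext.mk₀_bijective _ _).1 hφ)
  calc x = φ (Submodule.Quotient.mk 1) := (one_smul R x).symm
    _ = 0 := LinearMap.congr_fun hφ0 _

theorem IsSemidualizing.smul_top_lt_top (hC : IsSemidualizing C) (hI : I ≠ ⊤) :
    I • (⊤ : Submodule R C) < ⊤ := by
  refine lt_top_iff_ne_top.2 fun htop => hI ?_
  obtain ⟨r, hr, hrC⟩ :=
    Submodule.exists_sub_one_mem_and_smul_eq_zero_of_fg_of_le_smul I (⊤ : Submodule R C)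
      hC.fg.fg_top htop.ge
  obtain rfl := hC.eq_zero_of_smul fun c => hrC c trivial
  rw [Ideal.eq_top_iff_one]
  simpa using hr

theorem IsSemidualizing.extVanishes_quotient [IsNoetherianRing R] (hC : IsSemidualizing C)
    (hI : I ≠ ⊤) {rs : List R} (hmem : ∀ r ∈ rs, r ∈ I)
    (hrs : RingTheory.Sequence.IsWeaklyRegular R rs) {j : ℕ} (hj : j < rs.length) :
    ExtVanishes C (R ⧸ I) j := by
  have := hC.fg
  have hlt := hC.smul_top_lt_top hI
  have hle : Ideal.ofList rs • (⊤ : Submodule R C) ≤ I • ⊤ :=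
    Submodule.smul_mono_left (Ideal.span_le.2 hmem)
  have hsupp : Module.support R (R ⧸ I) ⊆ PrimeSpectrum.zeroLocus I := by
    rw [Module.support_eq_zeroLocus, Ideal.annihilator_quotient]
  exact ModuleCat.subsingleton_ext_of_exists_isRegular I (ModuleCat.of R (R ⧸ I)) hsupp C hlt rs
    hmem ⟨hC.isWeaklyRegular hrs, (hle.trans_lt hlt).ne'⟩ j hj

theorem exists_isTruncatedDual_zero [IsNoetherianRing R] (hI : ExtVanishes C (R ⧸ I) 0) :
    ∃ (b : ℕ) (f : C →ₗ[R] (Fin b → C))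
      (h : IsShortExact f (LinearMap.range f).mkQ),
      IsTruncatedDual C I 0 (ModuleCat.of R _) h.shortExact.extClass := by
  obtain ⟨b, r, hr⟩ := Submodule.fg_iff_exists_fin_generating_family.1 (IsNoetherian.noetherian I)
  let f : C →ₗ[R] (Fin b → C) := LinearMap.pi fun j => r j • LinearMap.id
  have hf : Function.Injective f := (injective_iff_map_eq_zero f).2 fun c hc => by
    have hle : I ≤ LinearMap.ker (LinearMap.toSpanSingleton R C c) := by
      rw [← hr, Submodule.span_le]
      rintro _ ⟨j, rfl⟩
      exact congrFun hc j
    exact eq_zero_of_extVanishes_quotient hI hle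
  exact ⟨b, f, IsShortExact.of_injective hf, .base r hr (IsShortExact.of_injective hf)⟩

theorem IsTruncatedDual.injective_of_surjective_lcomp {n : ℕ} {T : ModuleCat.{u} R}
    {τ : Ext T C (n + 1)} (hT : IsTruncatedDual C I n T τ) (hI : ExtVanishes T (R ⧸ I) 0) {b : ℕ}
    {f : T →ₗ[R] (Fin b → C)} (hf : Function.Surjective (LinearMap.lcomp R C f)) :
    Function.Injective f := by
  refine (injective_iff_map_eq_zero f).2 fun x hx => ?_
  have hdual (φ : T →ₗ[R] C) : φ x = 0 := by
    obtain ⟨ψ, rfl⟩ := hf φ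
    exact (congrArg ψ hx).trans (map_zero ψ)
  refine eq_zero_of_extVanishes_quotient hI fun a ha => ?_
  obtain ⟨b', u, v, huv⟩ := hT.exists_smul_eq_comp_pi ha
  have hux : u x = 0 := funext fun j => hdual (LinearMap.proj j ∘ₗ u)
  rw [← huv, hux, map_zero]

theorem exists_isTruncatedDual [IsNoetherianRing R] (hC : IsSemidualizing C) {N : ℕ}
    (hext : ∀ j < N, ExtVanishes C (R ⧸ I) j) {n : ℕ} (hn : n < N) :
    ∃ (T : ModuleCat.{u} R) (τ : Ext T C (n + 1)), IsTruncatedDual C I n T τ ∧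
      Module.Finite R T ∧ ∀ j, j + n + 1 < N → ExtVanishes T (R ⧸ I) j := by
  have := hC.fg
  induction n with
  | zero =>
    obtain ⟨b, f, h, hT⟩ := exists_isTruncatedDual_zero (hext 0 hn)
    exact ⟨_, _, hT, inferInstance, fun j hj => h.extVanishes_covariant_right
      (ExtVanishes.covariant_pi (hext j (by lia)) b) (hext (j + 1) (by lia))⟩
  | succ n ih =>
    obtain ⟨T, τ, hT, hfin, hText⟩ := ih (by lia)
    obtain ⟨b, f, hf⟩ := exists_pi_surjective_lcomp (X := T) (C := C)
    have h := IsShortExact.of_injective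
      (hT.injective_of_surjective_lcomp (hText 0 (by lia)) hf)
    exact ⟨ModuleCat.of R _, _, .step hT h hf, inferInstance, fun j hj =>
      h.extVanishes_covariant_right (ExtVanishes.covariant_pi (hext j (by lia)) b)
        (hText (j + 1) (by lia))⟩

end TruncatedDualExistence

section Approximation

open Abelian

variable {R : Type u} [CommRing R] {C : ModuleCat.{u} R} {M : ObjectProperty (ModuleCat.{u} R)}

/-- The modules isomorphic to a finite power of `C`. -/
def powers (C : ModuleCat.{u} R) : ObjectProperty (ModuleCat.{u} R) :=
  fun X => ∃ b : ℕ, Nonempty (X ≃ₗ[R] (Fin b → C))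

theorem HasResolution.exists_isShortExact_pi {n : ℕ} {Z : ModuleCat.{u} R}
    (hZ : HasResolution (powers C) (n + 1) Z) :
    ∃ (b : ℕ) (K : ModuleCat.{u} R) (f : K →ₗ[R] (Fin b → C)) (g : (Fin b → C) →ₗ[R] Z),
      IsShortExact f g ∧ HasResolution (powers C) n K := by
  obtain ⟨K, N, i, π, w, hS, ⟨b, ⟨e⟩⟩, hK⟩ := hZ
  have h := IsShortExact.of_shortExact hS
  exact ⟨b, K, e.toLinearMap ∘ₗ i.hom, π.hom ∘ₗ e.symm.toLinearMap, h.equiv_mid e, hK⟩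

theorem HasResolution.exists_isShortExact_pi_pi {Z : ModuleCat.{u} R}
    (hZ : HasResolution (powers C) 1 Z) :
    ∃ (b c : ℕ) (A : (Fin b → C) →ₗ[R] (Fin c → C)) (g : (Fin c → C) →ₗ[R] Z),
      IsShortExact A g := by
  obtain ⟨c, K, f, g, h, ⟨N, ⟨b, ⟨e⟩⟩, ⟨e'⟩⟩⟩ := hZ.exists_isShortExact_pi
  exact ⟨b, c, _, g, h.equiv_left (e'.symm.toLinearEquiv.trans e)⟩

theorem exists_isShortExact_hasResolution_powers [IsNoetherianRing R] (hC : IsSemidualizing C)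
    (hM : M ∈ thickGC C) {n : ℕ} {X : ModuleCat.{u} R} (hX : HasResolution M n X) :
    ∃ (Z W : ModuleCat.{u} R) (f : X →ₗ[R] Z) (g : Z →ₗ[R] W),
      IsShortExact f g ∧ HasResolution (powers C) n Z ∧ M W := by
  have hr := hM.1.resolving
  have hcog := cogeneratedByPowers_of_mem_thickGC hC hM
  have hpi (b : ℕ) : powers C (ModuleCat.of R (Fin b → C)) := ⟨b, ⟨.refl R _⟩⟩
  induction n generalizing X with
  | zero =>
    obtain ⟨b, W, f, g, h, hW⟩ := hcog X (hr.hasResolution_zero_iff.1 hX)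
    exact ⟨_, W, f, g, h, ⟨_, hpi b, ⟨Iso.refl _⟩⟩, hW⟩
  | succ n ih =>
    obtain ⟨m, π, hπ, -⟩ := (hr.isResolving_hasResolution (n + 1)).le_syzygyIn X hX
    have hX' := IsShortExact.of_surjective hπ
    obtain ⟨Z, W, f, g, h, hZ, hW⟩ :=
      ih ((hr.hasResolution_succ_iff (X := X) hX' (hr.free m) n).1 hX)
    obtain ⟨b, W', f', g', h', hW'⟩ := hcog (ModuleCat.of R _)
      (hr.mid (h.pushout_inr (LinearMap.ker π).subtype) (hr.free m) hW)
    have hZ' := (hX'.pushout_inl f).comp_pushout_inr h'.injective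
    exact ⟨ModuleCat.of R _, W', _, _, h'.pushout_inl _,
      ⟨Z, _, _, _, _, hZ'.shortExact, hpi b, hZ⟩, hW'⟩

theorem exists_sum_mul_mem_maximalIdeal [IsLocalRing R] {ι : Type*} [Fintype ι]
    {L : Submodule R (ι → R)} (hL : L ≠ ⊤) :
    ∃ (k : ι) (t : ι → R), t k = 1 ∧
      ∀ l ∈ L, ∑ j, l j * t j ∈ IsLocalRing.maximalIdeal R := by
  classical
  obtain ⟨L', hL', hle⟩ := (eq_top_or_exists_le_coatom L).resolve_left hL
  obtain ⟨m, hm, ⟨e⟩⟩ := isSimpleModule_iff_quot_maximal.1 (isSimpleModule_iff_isCoatom.2 hL')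
  obtain rfl := IsLocalRing.eq_maximalIdeal hm
  choose t ht using fun j =>
    Submodule.Quotient.mk_surjective (IsLocalRing.maximalIdeal R) (e (L'.mkQ (Pi.single j 1)))
  have hφ (l : ι → R) : e (L'.mkQ l) = Submodule.Quotient.mk (∑ j, l j * t j) := by
    conv_lhs => rw [pi_eq_sum_univ' l]
    simp_rw [map_sum, map_smul, ← ht]
    exact (map_sum (Submodule.mkQ (IsLocalRing.maximalIdeal R)) _ _).symm
  have hmem (l : ι → R) : l ∈ L' ↔ ∑ j, l j * t j ∈ IsLocalRing.maximalIdeal R := by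
    rw [← Submodule.Quotient.mk_eq_zero (IsLocalRing.maximalIdeal R), ← hφ,
      LinearEquiv.map_eq_zero_iff, Submodule.mkQ_apply, Submodule.Quotient.mk_eq_zero]
  obtain ⟨k, hk⟩ : ∃ k, IsUnit (t k) := by
    by_contra! ht'
    exact hL'.1 (eq_top_iff.2 fun l _ =>
      (hmem l).2 (Ideal.sum_mem _ fun j _ => Ideal.mul_mem_left _ _ (ht' j)))
  obtain ⟨v, hv⟩ := hk.exists_right_inv
  refine ⟨k, fun j => t j * v, hv, fun l hl => ?_⟩
  simp only [← mul_assoc, ← Finset.sum_mul]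
  exact Ideal.mul_mem_right _ _ ((hmem l).1 (hle hl))

theorem IsSemidualizing.exists_smul_mem_maximalIdeal [IsLocalRing R] (hC : IsSemidualizing C)
    {b c : ℕ} (A : (Fin b → C) →ₗ[R] (Fin c → C))
    (hA : ¬ Function.Surjective (LinearMap.lcomp R C A)) :
    ∃ (k : Fin b) (t : Fin b → R) (β : Fin c → R), t k = 1 ∧
      (∀ i, β i ∈ IsLocalRing.maximalIdeal R) ∧
      ∀ x i, A (fun j => t j • x) i = β i • x := by
  let Φ : (Fin b → R) →ₗ[R] ((Fin b → C) →ₗ[R] C) :=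
    Fintype.linearCombination R fun j => LinearMap.proj j
  have hΦ (a : Fin b → R) (x : Fin b → C) : Φ a x = ∑ j, a j • x j := by
    simp [Φ, Fintype.linearCombination_apply]
  obtain ⟨k, t, htk, ht⟩ := exists_sum_mul_mem_maximalIdeal
    (L := (LinearMap.range (LinearMap.lcomp R C A)).comap Φ) fun htop => hA fun φ => by
      obtain ⟨a, ha⟩ := hC.exists_apply_eq_sum φ
      have hφ : φ = Φ a := LinearMap.ext fun x => (ha x).trans (hΦ a x).symm
      have ha' : a ∈ (LinearMap.range (LinearMap.lcomp R C A)).comap Φ := htop ▸ trivial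
      exact hφ ▸ ha'
  choose a ha using fun i => hC.exists_apply_eq_sum (LinearMap.proj i ∘ₗ A)
  refine ⟨k, t, fun i => ∑ j, a i j * t j, htk, fun i => ht _ ⟨LinearMap.proj i, ?_⟩,
    fun x i => ?_⟩
  · exact LinearMap.ext fun x => (ha i x).trans (hΦ _ x).symm
  · exact (ha i _).trans (by simp [Finset.sum_smul, smul_smul])

section LocalRing

variable [IsNoetherianRing R] [IsLocalRing R] (hC : IsSemidualizing C) (hM : M ∈ thickGC C)
include hC hM

theorem exists_extMap_extClass_eq {b : ℕ} {r : Fin b → R}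
    (hr : Ideal.span (Set.range r) = IsLocalRing.maximalIdeal R) {T Z : ModuleCat.{u} R}
    {g : (Fin b → C) →ₗ[R] T}
    (h : IsShortExact (LinearMap.pi fun j => r j • LinearMap.id : C →ₗ[R] (Fin b → C)) g)
    (hZ : HasResolution (powers C) 1 Z) (hZM : ¬ M Z) :
    ∃ (k : T →ₗ[R] Z) (e : Ext Z C 1), extMap C k 1 e = h.shortExact.extClass := by
  have hres := hM.1.resolving
  obtain ⟨_, c, A, g', h'⟩ := hZ.exists_isShortExact_pi_pi
  have hA : ¬ Function.Surjective (LinearMap.lcomp R C A) := fun hA => by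
    have hZ1 : HasResolution M 1 Z := (hres.hasResolution_succ_iff h' (hres.pi _ hM.2) 0).2
      (hres.hasResolution_zero_iff.2 (hres.pi _ hM.2))
    exact hZM <| hres.hasResolution_zero_iff.1 <| HasResolution.of_succ (X := Z) hC hM hZ1 <|
      h'.extVanishes_one (ExtVanishes.pi (X := C) (hC.ext _ one_pos) _) hA
  obtain ⟨i, t, β, hti, hβ, hAt⟩ := hC.exists_smul_mem_maximalIdeal A hA
  choose w hw using fun i => Ideal.mem_span_range_iff_exists_fun.1 (hr ▸ hβ i)
  let θ : C →ₗ[R] _ := LinearMap.pi fun j => t j • LinearMap.id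
  exact h.exists_extMap_extClass_eq h' (a := θ)
    (b := LinearMap.pi fun i => ∑ j, w i j • LinearMap.proj j)
    (LinearMap.ext fun x => funext fun l => by
      change _ = A (fun j => t j • x) l
      simp only [hAt, ← hw, LinearMap.pi_apply, LinearMap.comp_apply, LinearMap.sum_apply,
        LinearMap.smul_apply, LinearMap.proj_apply, LinearMap.id_apply, smul_smul,
        Finset.sum_smul])
    (η := LinearMap.proj i) (LinearMap.ext fun x => by simp [θ, hti])

theorem IsTruncatedDual.exists_extMap_eq {n : ℕ} {T Z : ModuleCat.{u} R} {τ : Ext T C (n + 1)}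
    (hT : IsTruncatedDual C (IsLocalRing.maximalIdeal R) n T τ)
    (hZ : HasResolution (powers C) (n + 1) Z) (hZM : ¬ HasResolution M n Z) :
    ∃ (g : T →ₗ[R] Z) (e : Ext Z C (n + 1)), extMap C g (n + 1) e = τ := by
  have hr := hM.1.resolving
  induction hT generalizing Z with
  | base r hrI h =>
    exact exists_extMap_extClass_eq hC hM hrI h hZ (hr.hasResolution_zero_iff.not.1 hZM)
  | @step n T τ hT b T' f g h hext ih =>
    obtain ⟨c, K, f', g', h', hK⟩ := hZ.exists_isShortExact_pi
    obtain ⟨k, e, rfl⟩ := ih hK fun hKM =>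
      hZM ((hr.hasResolution_succ_iff h' (hr.pi _ hM.2) _).2 hKM)
    choose w hw using fun i => hext (LinearMap.proj i ∘ₗ f' ∘ₗ k)
    obtain ⟨l, hl⟩ := h.exists_map h' k (LinearMap.pi w)
      (LinearMap.ext fun x => funext fun i => LinearMap.congr_fun (hw i) x)
    refine ⟨l, h'.shortExact.extClass.comp e (add_comm 1 (n + 1)), ?_⟩
    rw [extMap_comp]
    erw [hl]
    exact Ext.comp_assoc_of_second_deg_zero _ _ _ _

end LocalRing

end Approximation

section MaximalSequences

open RingTheory.Sequence

variable {R : Type u} [CommRing R] [IsNoetherianRing R]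

theorem exists_isWeaklyRegular_forall_not_isSMulRegular {p : Ideal R} (hp : p ≠ ⊤) :
    ∃ rs : List R, (∀ r ∈ rs, r ∈ p) ∧ IsWeaklyRegular R rs ∧
      ∀ r ∈ p, ¬ IsSMulRegular (R ⧸ Ideal.ofList rs) r := by
  obtain ⟨_, ⟨rs, hmem, hrs, rfl⟩, hmax⟩ := set_has_maximal_iff_noetherian.2
    (inferInstance : IsNoetherian R R)
    {J : Ideal R | ∃ rs : List R, (∀ r ∈ rs, r ∈ p) ∧ IsWeaklyRegular R rs ∧ Ideal.ofList rs = J}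
    ⟨_, [], by simp, IsWeaklyRegular.nil R R, rfl⟩
  refine ⟨rs, hmem, hrs, fun r hr hreg => ?_⟩
  have hrs' : IsWeaklyRegular R (rs ++ [r]) := by
    rw [isWeaklyRegular_append_iff, isWeaklyRegular_singleton_iff]
    exact ⟨hrs, by rwa [smul_eq_mul, Ideal.mul_top]⟩
  have hr_mem : r ∈ Ideal.ofList rs := by
    by_contra hr_notMem
    refine hmax _ ⟨rs ++ [r], by simpa [or_imp, forall_and] using ⟨hmem, hr⟩, hrs', rfl⟩ ?_
    rw [Ideal.ofList_append, Ideal.ofList_singleton]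
    exact left_lt_sup.2 fun h => hr_notMem (h (Ideal.mem_span_singleton_self r))
  have hone : Ideal.Quotient.mk (Ideal.ofList rs) 1 = 0 := hreg <| by
    change Ideal.Quotient.mk (Ideal.ofList rs) (r * 1) = r • 0
    rwa [smul_zero, mul_one, Ideal.Quotient.eq_zero_iff_mem]
  exact hp ((Ideal.eq_top_iff_one p).2
    (Ideal.span_le.2 hmem (Ideal.Quotient.eq_zero_iff_mem.1 hone)))

theorem exists_isAssociatedPrime_ge {N : Type*} [AddCommGroup N] [Module R N] [Module.Finite R N]
    {p : Ideal R} (hp : ∀ r ∈ p, ¬ IsSMulRegular N r) : ∃ q, IsAssociatedPrime q N ∧ p ≤ q := by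
  refine (p.subset_union_prime_finite (associatedPrimes.finite R N) (f := id) 0 0
    fun _ h _ _ => h.isPrime).1 ?_
  simp only [id, biUnion_associatedPrimes_eq_zero_divisors]
  intro r hr
  have h := hp r hr
  rw [isSMulRegular_iff_right_eq_zero_of_smul] at h
  push Not at h
  exact h.imp fun x hx => hx.symm

/-- The prime `q` is associated to `R ⧸ (rs)` for a weakly regular sequence `rs` in `p` that cannot
be prolonged; it is the annihilator of the class of `z`. -/
theorem exists_isWeaklyRegular_isPrime_ge {p : Ideal R} (hp : p ≠ ⊤) :
    ∃ (rs : List R) (q : Ideal R) (z : R), (∀ r ∈ rs, r ∈ p) ∧ IsWeaklyRegular R rs ∧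
      q.IsPrime ∧ p ≤ q ∧ z ∉ Ideal.ofList rs ∧ ∀ a, a ∈ q ↔ a * z ∈ Ideal.ofList rs := by
  obtain ⟨rs, hmem, hrs, hreg⟩ := exists_isWeaklyRegular_forall_not_isSMulRegular hp
  obtain ⟨q, hq, hpq⟩ := exists_isAssociatedPrime_ge hreg
  obtain ⟨hprime, x, hx⟩ := isAssociatedPrime_iff.1 hq
  obtain ⟨z, rfl⟩ := Ideal.Quotient.mk_surjective x
  have hqz (a : R) : a ∈ q ↔ a * z ∈ Ideal.ofList rs := by
    rw [hx, Submodule.mem_colon_singleton, Submodule.mem_bot, ← Ideal.Quotient.eq_zero_iff_mem]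
    rfl
  refine ⟨rs, q, z, hmem, hrs, hprime, hpq, fun hz => hprime.ne_top ?_, hqz⟩
  rwa [Ideal.eq_top_iff_one, hqz, one_mul]

theorem exists_ne_zero_forall_mem_maximalIdeal_smul_eq_zero [IsLocalRing R] {E : Type*}
    [AddCommGroup E] [Module R E] [Nontrivial E]
    (h : ∀ s ∈ IsLocalRing.maximalIdeal R, ∃ k : ℕ, ∀ e : E, s ^ k • e = 0) :
    ∃ e : E, e ≠ 0 ∧ ∀ s ∈ IsLocalRing.maximalIdeal R, s • e = 0 := by
  obtain ⟨q, hq⟩ := associatedPrimes.nonempty R E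
  obtain ⟨hprime, e, he⟩ := isAssociatedPrime_iff.1 hq
  have hmem (a : R) : a ∈ q ↔ a • e = 0 := by
    rw [he, Submodule.mem_colon_singleton, Submodule.mem_bot]
  refine ⟨e, fun h0 => hprime.ne_top ?_, fun s hs => ?_⟩
  · rw [Ideal.eq_top_iff_one, hmem, h0, smul_zero]
  · obtain ⟨k, hk⟩ := h s hs
    exact (hmem s).1 (hprime.mem_of_pow_mem k ((hmem _).2 (hk e)))

end MaximalSequences

section ContravariantExt

open Abelian

variable {R : Type u} [CommRing R] {C : ModuleCat.{u} R}
variable {X Y Z : Type u} [AddCommGroup X] [Module R X] [AddCommGroup Y] [Module R Y]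
  [AddCommGroup Z] [Module R Z]

theorem IsShortExact.exists_extMap_eq {f : X →ₗ[R] Y} {g : Y →ₗ[R] Z} (h : IsShortExact f g) {i : ℕ}
    (hZ : ExtVanishes C Z (i + 1)) (e : Ext (ModuleCat.of R X) C i) : ∃ e', extMap C f i e' = e :=
  Ext.contravariant_sequence_exact₁ h.shortExact C e (add_comm 1 i) (hZ.eq_zero _)

theorem extMap_fst_extMap_inl {i : ℕ} (hY : ExtVanishes C Y i)
    (e : Ext (ModuleCat.of R (X × Y)) C i) :
    extMap C (LinearMap.fst R X Y) i (extMap C (LinearMap.inl R X Y) i e) = e := by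
  have h : (LinearMap.id : X × Y →ₗ[R] X × Y) = LinearMap.inl R X Y ∘ₗ LinearMap.fst R X Y +
      LinearMap.inr R X Y ∘ₗ LinearMap.snd R X Y := by
    ext <;> simp
  conv_rhs => rw [← extMap_id i e, h, extMap_add, ← extMap_extMap, ← extMap_extMap,
    hY.eq_zero (extMap C (LinearMap.inr R X Y) i e), map_zero, add_zero]

variable {V A B : Type u} [AddCommGroup V] [Module R V] [AddCommGroup A] [Module R A]
  [AddCommGroup B] [Module R B] {ι : V →ₗ[R] A × B} {g : A →ₗ[R] Z} {c : B →ₗ[R] Z}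

theorem IsShortExact.exists_extMap_fst_eq (h : IsShortExact ι (g.coprod c)) {i : ℕ}
    (hB : ExtVanishes C B i) (hZ : ExtVanishes C Z (i + 1)) (e : Ext (ModuleCat.of R V) C i) :
    ∃ e', extMap C (LinearMap.fst R A B ∘ₗ ι) i e' = e := by
  obtain ⟨e, rfl⟩ := h.exists_extMap_eq hZ e
  exact ⟨_, by rw [← extMap_extMap, extMap_fst_extMap_inl hB]⟩

theorem IsShortExact.extMap_fst_extMap (h : IsShortExact ι (g.coprod c)) {i : ℕ}
    (hB : ExtVanishes C B i) (e : Ext (ModuleCat.of R Z) C i) :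
    extMap C (LinearMap.fst R A B ∘ₗ ι) i (extMap C g i e) = 0 := by
  have hgc : g ∘ₗ LinearMap.fst R A B ∘ₗ ι = (-1 : R) • c ∘ₗ LinearMap.snd R A B ∘ₗ ι :=
    LinearMap.ext fun v => by simpa using eq_neg_of_add_eq_zero_left (h.comp_apply v)
  rw [extMap_extMap, hgc, extMap_smul, ← extMap_extMap, hB.eq_zero (extMap C c i e), map_zero,
    smul_zero]

end ContravariantExt

section PuncturedSpectrum

variable {R : Type u} [CommRing R] [IsLocalRing R]
variable {C : ModuleCat.{u} R} {M P Q : ObjectProperty (ModuleCat.{u} R)} {X : ModuleCat.{u} R}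

/-- The modules that belong to `P` on the punctured spectrum of a local ring. -/
def locPunctured (P : ObjectProperty (ModuleCat.{u} R)) : ObjectProperty (ModuleCat.{u} R) :=
  sInf {Q | ∃ s ∈ IsLocalRing.maximalIdeal R, Q = locIn P (Submonoid.powers s)}

theorem locPunctured_iff :
    locPunctured P X ↔ ∀ s ∈ IsLocalRing.maximalIdeal R, locIn P (Submonoid.powers s) X := by
  rw [locPunctured, sInf_objectProperty_iff]
  exact ⟨fun h s hs => h _ ⟨s, hs, rfl⟩, by rintro h _ ⟨s, hs, rfl⟩; exact h s hs⟩

theorem IsResolving.le_locPunctured (hP : IsResolving P) : P ≤ locPunctured P := fun X hX =>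
  locPunctured_iff.2 fun _ _ => hP.le_locIn _ X hX

theorem IsTruncatedDual.mem_locPunctured {n : ℕ} {τ : Abelian.Ext X C (n + 1)} (hM : IsResolving M)
    (hMC : M C) (hX : IsTruncatedDual C (IsLocalRing.maximalIdeal R) n X τ) : locPunctured M X :=
  locPunctured_iff.2 fun s hs => ⟨(hM.isResolving_hasResolution _).finite _
    (hX.hasResolution hM hMC), s, Submonoid.mem_powers s, hX.le_smulFactorsIdeal hM hMC hs⟩

theorem locPunctured_iff_le_radical (hP : IsResolving P) [Module.Finite R X] :
    locPunctured P X ↔ IsLocalRing.maximalIdeal R ≤ (smulFactorsIdeal hP X).radical :=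
  locPunctured_iff.trans (forall₂_congr fun _ _ => (mem_radical_smulFactorsIdeal_iff hP).symm)

variable [IsNoetherianRing R]

theorem IsResolving.isResolving_locPunctured (hP : IsResolving P) :
    IsResolving (locPunctured P) :=
  isResolving_sInf ⟨_, 0, Ideal.zero_mem _, rfl⟩ <| by
    rintro _ ⟨s, -, rfl⟩
    exact hP.isResolving_locIn _

/-- The grade of the maximal ideal is at least the dimension of any module of finite dimension. -/
theorem extVanishes_quotient_maximalIdeal (hC : IsSemidualizing C) (hM : M ∈ thickGC C) {N n : ℕ}
    (hX : HasResolution M N X) (hn : ¬ HasResolution M n X) {j : ℕ} (hj : j < n + 1) :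
    ExtVanishes C (R ⧸ IsLocalRing.maximalIdeal R) j := by
  have hne := Ideal.IsPrime.ne_top (I := IsLocalRing.maximalIdeal R) inferInstance
  obtain ⟨rs, q, z, hmem, hrs, -, hle, hz, hqz⟩ := exists_isWeaklyRegular_isPrime_ge hne
  have hlen := HasResolution.length_of_isWeaklyRegular (X := X) hC hM hrs hz
    (fun a ha => (hqz a).1 (hle ha)) hX
  have hlt : n < rs.length := not_le.1 fun h => hn (hM.1.resolving.hasResolution_mono h _ hlen)
  exact hC.extVanishes_quotient hne hmem hrs (by lia)

end PuncturedSpectrum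

section TruncatedDualGenerators

open Abelian

variable {R : Type u} [CommRing R] [IsNoetherianRing R] [IsLocalRing R]
variable {C : ModuleCat.{u} R} {M P Q : ObjectProperty (ModuleCat.{u} R)}
variable {i : ℕ} {T : ModuleCat.{u} R} {τ : Ext T C (i + 1)}
variable {V W B : Type u} [AddCommGroup V] [Module R V] [AddCommGroup W] [Module R W]
  [AddCommGroup B] [Module R B]

omit [IsNoetherianRing R] in
theorem IsTruncatedDual.extVanishes_of_coprod (hC : IsSemidualizing C)
    (hT : IsTruncatedDual C (IsLocalRing.maximalIdeal R) i T τ) {ι : W →ₗ[R] V × B} {g : V →ₗ[R] T}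
    {c : B →ₗ[R] T} (h : IsShortExact ι (g.coprod c)) (hg : extMap C g (i + 1) τ ≠ 0)
    (hB : ExtVanishesAbove C B 0) {j : ℕ} (hj0 : 0 < j) (hji : j ≤ i) (hV : ExtVanishes C V j) :
    ExtVanishes C W j := by
  obtain ⟨j, rfl⟩ := Nat.exists_eq_succ_of_ne_zero hj0.ne'
  have hprod : ExtVanishes C (V × B) (j + 1) :=
    (IsShortExact.inl_snd R V B).extVanishes_mid hV (hB _ hj0)
  obtain hlt | rfl := hji.lt_or_eq
  · exact h.extVanishes_left hprod (hT.extVanishes hC j.succ.succ_pos (by lia))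
  · refine subsingleton_of_forall_eq 0 fun x => h.eq_zero_of_extClass_comp_eq_zero hprod ?_
    obtain ⟨a, ha⟩ := hT.exists_eq_smul hC (h.shortExact.extClass.comp x (add_comm 1 (j + 1)))
    have hcoprod : extMap C (g.coprod c) (j + 1 + 1) (a • τ) = 0 := by
      rw [← ha]
      exact h.shortExact.comp_extClass_assoc x (add_comm 1 (j + 1))
    have hsmul : a • extMap C g (j + 1 + 1) τ = 0 := by
      rw [← map_smul, ← LinearMap.coprod_inl g c, ← extMap_extMap, hcoprod, map_zero]
    rw [ha]
    refine hT.smul_eq_zero hC ?_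
    rw [IsLocalRing.mem_maximalIdeal, mem_nonunits_iff]
    exact fun hu => hg (hu.smul_eq_zero.1 hsmul)

theorem IsTruncatedDual.exists_extMap_ne_zero (hM : M ≤ GC C)
    (hT : IsTruncatedDual C (IsLocalRing.maximalIdeal R) i T τ)
    (hV : locPunctured M (ModuleCat.of R V)) (hext : ∀ j, 0 < j → j ≤ i → ExtVanishes C V j)
    (hne : ¬ ExtVanishes C V (i + 1)) : ∃ g : V →ₗ[R] T, extMap C g (i + 1) τ ≠ 0 := by
  have : Nontrivial (Ext (ModuleCat.of R V) C (i + 1)) := not_subsingleton_iff_nontrivial.1 hne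
  obtain ⟨e, he0, he⟩ := exists_ne_zero_forall_mem_maximalIdeal_smul_eq_zero (R := R)
    (E := Ext (ModuleCat.of R V) C (i + 1)) fun s hs => by
      obtain ⟨-, _, ⟨k, rfl⟩, Y, u, v, hY, huv⟩ := locPunctured_iff.1 hV s hs
      exact ⟨k, smul_ext_eq_zero huv ((hM _ hY).ext _ i.succ_pos)⟩
  obtain ⟨g', hg'⟩ := hT.exists_comp_eq 0 (zero_add (i + 1))
    (fun j hj hji => hext j hj (by lia)) e he
  obtain ⟨g, rfl⟩ := Ext.homEquiv₀.symm.surjective g'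
  have hg : extMap C g.hom (i + 1) τ = e := hg'
  exact ⟨g.hom, hg ▸ he0⟩

/-- If `g : V → T` pulls `τ` back to a nonzero class, the kernel of `V × C ^ b → T` has a proper
quotient of `Ext (V, C)` as its own `Ext` module, which makes Noetherian induction possible. -/
theorem IsTruncatedDual.mem_of_forall_extVanishes (hC : IsSemidualizing C) (hM : M ∈ thickGC C)
    (hQ : IsResolving Q) (hP : IsResolving P) (hQM : Q ≤ locPunctured M) (hQC : Q C)
    (hT : IsTruncatedDual C (IsLocalRing.maximalIdeal R) i T τ) (hQT : Q T) (hPT : P T)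
    (hmem : ∀ V : ModuleCat.{u} R, Q V → (∀ j, 0 < j → j ≤ i + 1 → ExtVanishes C V j) → P V)
    {X : ModuleCat.{u} R} (hX : Q X) (hext : ∀ j, 0 < j → j ≤ i → ExtVanishes C X j) : P X := by
  have := hC.fg
  have := hQ.finite X hX
  obtain ⟨b, c, hc⟩ := hT.exists_pi_surjective
  have hCb : ExtVanishesAbove C (Fin b → C) 0 := fun k hk => ExtVanishes.pi (X := C) (hC.ext k hk) b
  suffices ∀ (K : Submodule R (Ext X C (i + 1))) (V : ModuleCat.{u} R)
      (π : Ext X C (i + 1) →ₗ[R] Ext V C (i + 1)), Q V →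
      (∀ j, 0 < j → j ≤ i → ExtVanishes C V j) → Function.Surjective π → LinearMap.ker π = K → P V
    from this _ X LinearMap.id hX hext Function.surjective_id rfl
  intro K
  induction K using WellFoundedGT.induction with
  | ind K ih =>
  rintro V π hV hVext hπ rfl
  by_cases hne : ExtVanishes C V (i + 1)
  · refine hmem V hV fun j hj0 hj => ?_
    obtain hlt | rfl := hj.lt_or_eq
    exacts [hVext j hj0 (by lia), hne]
  obtain ⟨g, hg⟩ := hT.exists_extMap_ne_zero hM.1.le (hQM V hV) hVext hne
  have h := IsShortExact.of_surjective (g := g.coprod c) fun t =>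
    (hc t).elim fun y hy => ⟨(0, y), by simpa using hy⟩
  have hsurj : Function.Surjective (extMap C (LinearMap.fst R V (Fin b → C) ∘ₗ
      (LinearMap.ker (g.coprod c)).subtype) (i + 1)) := fun x =>
    h.exists_extMap_fst_eq (hCb _ i.succ_pos) (HasResolution.extVanishesAbove (X := T)
      hM.1.resolving hM.1.le (hT.hasResolution hM.1.resolving hM.2) _ (Nat.lt_succ_self _)) x
  have hker := ih (LinearMap.ker (extMap C (LinearMap.fst R V (Fin b → C) ∘ₗ
      (LinearMap.ker (g.coprod c)).subtype) (i + 1) ∘ₗ π)) ?_ (ModuleCat.of R _) _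
    (hQ.left h (hQ.prod (X := V) hV (hQ.pi b hQC)) hQT)
    (fun j hj0 hji => hT.extVanishes_of_coprod hC h hg hCb hj0 hji (hVext j hj0 hji))
    (by rw [LinearMap.coe_comp]; exact hsurj.comp hπ) rfl
  · exact ((hP.prod_iff V (ModuleCat.of R (Fin b → C))).1 (hP.mid h hker hPT)).1
  · refine lt_of_le_of_ne (LinearMap.ker_le_ker_comp _ _) fun heq => hg ?_
    obtain ⟨x, hx⟩ := hπ (extMap C g (i + 1) τ)
    have hxker : x ∈ LinearMap.ker π := by
      rw [heq, LinearMap.mem_ker, LinearMap.comp_apply, hx]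
      exact h.extMap_fst_extMap (hCb _ i.succ_pos) τ
    exact hx.symm.trans hxker

theorem le_of_isTruncatedDual_mem (hC : IsSemidualizing C) (hM : M ∈ thickGC C)
    (hQ : IsResolving Q) (hP : IsResolving P) (hQM : Q ≤ locPunctured M) (hQC : Q C) {n : ℕ}
    (hmem : ∀ V : ModuleCat.{u} R, Q V → (∀ j, 0 < j → j ≤ n → ExtVanishes C V j) → P V)
    (hT : ∀ i < n, ∃ (T : ModuleCat.{u} R) (τ : Ext T C (i + 1)),
      IsTruncatedDual C (IsLocalRing.maximalIdeal R) i T τ ∧ Q T ∧ P T) : Q ≤ P := by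
  suffices ∀ V : ModuleCat.{u} R, Q V → (∀ j, 0 < j → j ≤ 0 → ExtVanishes C V j) → P V from
    fun V hV => this V hV fun j hj0 hj => absurd hj0 (by lia)
  refine Nat.decreasingInduction (motive := fun i _ => ∀ V : ModuleCat.{u} R, Q V →
    (∀ j, 0 < j → j ≤ i → ExtVanishes C V j) → P V) (fun i hi ih V hV hext => ?_) hmem n.zero_le
  obtain ⟨T, τ, hTi, hQT, hPT⟩ := hT i hi
  exact hTi.mem_of_forall_extVanishes hC hM hQ hP hQM hQC hQT hPT ih hV hext

end TruncatedDualGenerators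

section PuncturedClassification

open Abelian

variable {R : Type u} [CommRing R] [IsNoetherianRing R] [IsLocalRing R]
variable {C : ModuleCat.{u} R} {M P : ObjectProperty (ModuleCat.{u} R)} {n : ℕ}

omit [IsNoetherianRing R] [IsLocalRing R] in
theorem IsResolving.inf {Q : ObjectProperty (ModuleCat.{u} R)} (hP : IsResolving P)
    (hQ : IsResolving Q) : IsResolving (P ⊓ Q) := by
  rw [← sInf_pair]
  refine isResolving_sInf (Set.insert_nonempty P {Q}) ?_
  rintro _ (rfl | rfl)
  exacts [hP, hQ]

theorem IsTruncatedDual.mem (hC : IsSemidualizing C) (hM : M ∈ thickGC C) (hP : IsResolving P)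
    (hle : M ≤ P) (hlow : ∀ X : ModuleCat.{u} R, locPunctured M X → HasResolution M n X → P X)
    {T : ModuleCat.{u} R} {τ : Ext T C (n + 1)}
    (hT : IsTruncatedDual C (IsLocalRing.maximalIdeal R) n T τ) {Z : ModuleCat.{u} R} (hZ : P Z)
    (hZQ : (HasResolution M (n + 1) ⊓ locPunctured M) Z) (hZn : ¬ HasResolution M n Z) : P T := by
  have hr := hM.1.resolving
  have hQ := (hr.isResolving_hasResolution (n + 1)).inf hr.isResolving_locPunctured
  have hMQ : M ≤ HasResolution M (n + 1) ⊓ locPunctured M :=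
    le_inf (hr.le_hasResolution _) hr.le_locPunctured
  obtain ⟨Z', W, f, g, hZ', hres, hW⟩ := exists_isShortExact_hasResolution_powers hC hM hZQ.1
  have hZ'Q := hQ.mid hZ' hZQ (hMQ _ hW)
  obtain ⟨k, e, hke⟩ := hT.exists_extMap_eq hC hM hres fun hZ'n =>
    hZn ((hr.isResolving_hasResolution n).left hZ' hZ'n (hr.le_hasResolution n _ hW))
  obtain ⟨b, _, _, c, h₀, -⟩ := hres.exists_isShortExact_pi
  have h := IsShortExact.of_surjective (g := k.coprod c) fun z =>
    (h₀.surjective z).elim fun y hy => ⟨(0, y), by simpa using hy⟩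
  have hV := hQ.left h (hQ.prod (X := T) ⟨hT.hasResolution hr hM.2, hT.mem_locPunctured hr hM.2⟩
    (hQ.pi b (hMQ _ hM.2))) hZ'Q
  have hCb : ExtVanishes C (Fin b → C) (n + 1) :=
    ExtVanishes.pi (X := C) (hC.ext _ n.succ_pos) b
  have hext : ExtVanishes C (LinearMap.ker (k.coprod c)) (n + 1) := by
    refine subsingleton_of_forall_eq 0 fun x => ?_
    obtain ⟨y, rfl⟩ := h.exists_extMap_fst_eq hCb (HasResolution.extVanishesAbove (X := Z') hr
      hM.1.le hZ'Q.1 _ (Nat.lt_succ_self _)) x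
    obtain ⟨a, rfl⟩ := hT.exists_eq_smul hC y
    rw [map_smul, ← hke]
    erw [h.extMap_fst_extMap hCb e]
    rw [smul_zero]
  have hVP := hlow _ hV.2 (HasResolution.of_succ hC hM hV.1 hext)
  exact ((hP.prod_iff T (ModuleCat.of R (Fin b → C))).1
    (hP.mid h hVP (hP.mid hZ' hZ (hle _ hW)))).1

theorem hasResolution_inf_locPunctured_le_of_forall (hC : IsSemidualizing C) (hM : M ∈ thickGC C)
    (hP : IsResolving P) (hle : M ≤ P)
    (hlow : ∀ X : ModuleCat.{u} R, locPunctured M X → HasResolution M n X → P X)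
    {Z : ModuleCat.{u} R} (hZ : P Z) (hZQ : (HasResolution M (n + 1) ⊓ locPunctured M) Z)
    (hZn : ¬ HasResolution M n Z) : HasResolution M (n + 1) ⊓ locPunctured M ≤ P := by
  have hr := hM.1.resolving
  refine le_of_isTruncatedDual_mem hC hM ((hr.isResolving_hasResolution (n + 1)).inf
    hr.isResolving_locPunctured) hP inf_le_right
    ⟨hr.le_hasResolution _ _ hM.2, hr.le_locPunctured _ hM.2⟩ (n := n + 1) (fun V hV hext => ?_)
    fun i hi => ?_
  · refine hle _ (hr.hasResolution_zero_iff.1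
      ((hasResolution_iff_extVanishesAbove hC hM hV.1 0).2 fun j hj => ?_))
    obtain hjn | hjn := le_or_gt j (n + 1)
    exacts [hext j hj hjn, HasResolution.extVanishesAbove hr hM.1.le hV.1 j hjn]
  · obtain ⟨T, τ, hT, -⟩ := exists_isTruncatedDual (I := IsLocalRing.maximalIdeal R) hC
      (fun j hj => extVanishes_quotient_maximalIdeal hC hM hZQ.1 hZn hj) hi
    have hTres := hT.hasResolution hr hM.2
    have hTloc := hT.mem_locPunctured hr hM.2
    refine ⟨T, τ, hT, ⟨hr.hasResolution_mono hi _ hTres, hTloc⟩, ?_⟩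
    obtain hlt | rfl := (Nat.le_of_lt_succ hi).lt_or_eq
    exacts [hlow T hTloc (hr.hasResolution_mono hlt _ hTres), hT.mem hC hM hP hle hlow hZ hZQ hZn]

theorem hasResolution_inf_locPunctured_le (hC : IsSemidualizing C) (hM : M ∈ thickGC C)
    (hP : IsResolving P) (hle : M ≤ P) {Z : ModuleCat.{u} R} (hZ : P Z)
    (hZQ : (HasResolution M (n + 1) ⊓ locPunctured M) Z) (hZn : ¬ HasResolution M n Z) :
    HasResolution M (n + 1) ⊓ locPunctured M ≤ P := by
  have hr := hM.1.resolving
  induction n generalizing Z with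
  | zero =>
    exact hasResolution_inf_locPunctured_le_of_forall hC hM hP hle
      (fun X _ hX => hle X (hr.hasResolution_zero_iff.1 hX)) hZ hZQ hZn
  | succ n ih =>
    refine hasResolution_inf_locPunctured_le_of_forall hC hM hP hle
      (fun X hXloc hX => ?_) hZ hZQ hZn
    have := hP.finite _ hZ
    obtain ⟨m, π, hπ⟩ := Module.Finite.exists_fin' R Z
    have h := IsShortExact.of_surjective hπ
    have hfree := hr.free m
    exact ih (Z := ModuleCat.of R (LinearMap.ker π)) (hP.left h (hP.free m) hZ)
      ⟨(hr.hasResolution_succ_iff h hfree _).1 hZQ.1,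
        hr.isResolving_locPunctured.left h (hr.le_locPunctured _ hfree) hZQ.2⟩
      (fun hn => hZn ((hr.hasResolution_succ_iff h hfree _).2 hn)) _ ⟨hX, hXloc⟩

end PuncturedClassification

section Twist

open Abelian

variable {R : Type u} [CommRing R] {P : ObjectProperty (ModuleCat.{u} R)}
variable {X Y V W : Type u} [AddCommGroup X] [Module R X] [AddCommGroup Y] [Module R Y]
  [AddCommGroup V] [Module R V] [AddCommGroup W] [Module R W]

theorem IsResolving.fiberProduct (hP : IsResolving P) {π : Y →ₗ[R] X} (hπ : Function.Surjective π)
    (k : V →ₗ[R] X) (hY : P (ModuleCat.of R Y)) (hX : P (ModuleCat.of R X))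
    (hV : P (ModuleCat.of R V)) : P (ModuleCat.of R (FiberProduct π k)) :=
  have h := IsShortExact.of_surjective hπ
  hP.mid (h.fiberProduct_snd k) (hP.left h hY hX) hV

theorem IsResolving.of_fiberProduct_comp (hP : IsResolving P) {π : Y →ₗ[R] X}
    (hπ : Function.Surjective π) {a : V →ₗ[R] W} {b : W →ₗ[R] X} (hW : P (ModuleCat.of R W))
    (h : P (ModuleCat.of R (FiberProduct π (b ∘ₗ a)))) : P (ModuleCat.of R V) := by
  have hs : IsShortExact
      ((FiberProduct.lift (g := π) (k := b) (FiberProduct.fst π (b ∘ₗ a))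
        (a ∘ₗ FiberProduct.snd π _) FiberProduct.condition).prod (FiberProduct.snd π _))
      ((FiberProduct.snd π b).coprod (-a)) := by
    refine ⟨fun x y hxy => ?_, fun ⟨e, v⟩ => ?_, fun w => ?_⟩
    · exact FiberProduct.ext
        (congrArg (fun z : FiberProduct π b × V => FiberProduct.fst π b z.1) hxy)
        (congrArg (fun z : FiberProduct π b × V => z.2) hxy)
    · have hexact : (FiberProduct.snd π b).coprod (-a) (e, v) = 0 ↔ FiberProduct.snd π b e = a v :=
        add_neg_eq_zero
      refine hexact.trans ⟨fun hev => ?_, ?_⟩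
      · obtain ⟨w, hw, rfl⟩ := FiberProduct.exists_of_eq (g := π) (k := b ∘ₗ a)
          (e.condition.trans (congrArg b hev))
        exact ⟨w, Prod.ext (FiberProduct.ext hw hev.symm) rfl⟩
      · rintro ⟨w, hw⟩
        obtain ⟨rfl, rfl⟩ := Prod.ext_iff.1 hw
        rfl
    · obtain ⟨y, hy⟩ := hπ (b w)
      obtain ⟨e, -, rfl⟩ := FiberProduct.exists_of_eq hy
      exact ⟨(e, 0), by rw [LinearMap.coprod_apply, map_zero, add_zero]⟩
  exact ((hP.prod_iff (ModuleCat.of R (FiberProduct π b)) (ModuleCat.of R V)).1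
    (hP.mid hs h hW)).2

theorem SMulFactors.fiberProduct_smul {π : Y →ₗ[R] X} {s : R} (hY : P (ModuleCat.of R Y)) :
    SMulFactors P (FiberProduct π (s • LinearMap.id)) s :=
  ⟨ModuleCat.of R Y, FiberProduct.fst π _,
    FiberProduct.lift (s • LinearMap.id) π fun y => by simp, hY, fun w =>
      FiberProduct.ext rfl w.condition⟩

theorem IsShortExact.extMap_extClass_fiberProduct {Z : Type u} [AddCommGroup Z] [Module R Z]
    (C : ModuleCat.{u} R) {f : V →ₗ[R] Y} {g : Y →ₗ[R] Z} (h : IsShortExact f g)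
    (k : W →ₗ[R] Z) {i : ℕ} (e : Ext (ModuleCat.of R V) C i) :
    extMap C k (i + 1) (h.shortExact.extClass.comp e (add_comm 1 i)) =
      (h.fiberProduct_snd k).shortExact.extClass.comp e (add_comm 1 i) := by
  let F : (h.fiberProduct_snd k).complex ⟶ h.complex :=
    { τ₁ := 𝟙 _
      τ₂ := ModuleCat.ofHom (FiberProduct.fst g k)
      τ₃ := ModuleCat.ofHom k
      comm₁₂ := rfl
      comm₂₃ := ModuleCat.hom_ext (LinearMap.ext FiberProduct.condition) }
  have hF : (h.fiberProduct_snd k).shortExact.extClass =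
      extMap (ModuleCat.of R V) k 1 h.shortExact.extClass :=
    (Ext.comp_mk₀_id _).symm.trans (ShortComplex.ShortExact.extClass_naturality
      (h.fiberProduct_snd k).shortExact h.shortExact F)
  rw [hF]
  exact extMap_comp k h.shortExact.extClass e (add_comm 1 i)

theorem ExtVanishes.exists_smul_eq_of_fiberProduct {C : ModuleCat.{u} R} {π : Y →ₗ[R] X}
    (hπ : Function.Surjective π) {s : R} {i : ℕ}
    (hF : ExtVanishes C (FiberProduct π (s • LinearMap.id)) (i + 1))
    (e : Ext (ModuleCat.of R X) C (i + 1)) : ∃ e', s • e' = e := by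
  have h := IsShortExact.of_surjective hπ
  obtain ⟨x, rfl⟩ := (h.fiberProduct_snd (s • LinearMap.id)).exists_extClass_comp_eq hF e
  exact ⟨_, by rw [← h.extMap_extClass_fiberProduct, extMap_smul, extMap_id]⟩

/-- By Nakayama's lemma, `s` does not act surjectively on `Ext (X, C)`. -/
theorem not_hasResolution_fiberProduct [IsNoetherianRing R] [IsLocalRing R] {C : ModuleCat.{u} R}
    {M : ObjectProperty (ModuleCat.{u} R)} (hC : IsSemidualizing C) (hM : M ∈ thickGC C)
    {π : Y →ₗ[R] X} (hπ : Function.Surjective π) {s : R} (hs : s ∈ IsLocalRing.maximalIdeal R)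
    {n : ℕ} (hX : HasResolution M (n + 1) (ModuleCat.of R X))
    (hXn : ¬ HasResolution M n (ModuleCat.of R X)) :
    ¬ HasResolution M n (ModuleCat.of R (FiberProduct π (s • LinearMap.id))) := by
  intro hF
  have := hC.fg
  have : Module.Finite R X := (hM.1.resolving.isResolving_hasResolution _).finite _ hX
  refine hXn (HasResolution.of_succ hC hM hX ?_)
  have hext := HasResolution.extVanishesAbove (X := ModuleCat.of R (FiberProduct π _))
    hM.1.resolving hM.1.le hF (n + 1) n.lt_succ_self
  refine (Submodule.subsingleton_iff R).1 (subsingleton_of_bot_eq_top (Eq.symm ?_))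
  refine Submodule.eq_bot_of_le_smul_of_le_jacobson_bot (IsLocalRing.maximalIdeal R) _
    Module.Finite.fg_top (fun e _ => ?_) (IsLocalRing.maximalIdeal_le_jacobson _)
  obtain ⟨e', rfl⟩ := ExtVanishes.exists_smul_eq_of_fiberProduct hπ hext e
  exact Submodule.smul_mem_smul hs trivial

/-- The pullback of a free cover of `X` along multiplication by `s` belongs to the same resolving
subcategories, and multiplication by `s` on it factors through a free module. -/
theorem radical_smulFactorsIdeal_lt_fiberProduct [IsNoetherianRing R] (hP : IsResolving P)
    {π : Y →ₗ[R] X} (hπ : Function.Surjective π) (hY : P (ModuleCat.of R Y)) [Module.Finite R X]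
    {s : R} (hs : s ∉ (smulFactorsIdeal hP (ModuleCat.of R X)).radical) :
    (smulFactorsIdeal hP (ModuleCat.of R X)).radical <
      (smulFactorsIdeal hP (ModuleCat.of R (FiberProduct π (s • LinearMap.id)))).radical := by
  have hX {Q : ObjectProperty (ModuleCat.{u} R)} (hQ : IsResolving Q) (hPQ : P ≤ Q)
      (h : Q (ModuleCat.of R X)) : Q (ModuleCat.of R (FiberProduct π (s • LinearMap.id))) :=
    hQ.fiberProduct hπ _ (hPQ _ hY) h h
  have := hP.finite _ hY
  refine lt_of_le_of_ne (fun t ht => ?_) fun heq => hs (heq ▸ Ideal.le_radical ?_)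
  · rw [mem_radical_smulFactorsIdeal_iff hP] at ht ⊢
    exact hX (hP.isResolving_locIn _) (hP.le_locIn _) ht
  · exact SMulFactors.fiberProduct_smul hY

end Twist

section LocalClassification

variable {R : Type u} [CommRing R] [IsNoetherianRing R] [IsLocalRing R]
variable {C : ModuleCat.{u} R} {M P : ObjectProperty (ModuleCat.{u} R)} {n : ℕ}

theorem exists_mem_locPunctured (hC : IsSemidualizing C) (hM : M ∈ thickGC C) (hP : IsResolving P)
    {Z : ModuleCat.{u} R} (hZ : P Z) (hZM : HasResolution M (n + 1) Z)
    (hZn : ¬ HasResolution M n Z) :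
    ∃ Z', P Z' ∧ (HasResolution M (n + 1) ⊓ locPunctured M) Z' ∧ ¬ HasResolution M n Z' := by
  have hr := hM.1.resolving
  have hrn := hr.isResolving_hasResolution (n + 1)
  induction hI : (smulFactorsIdeal hr Z).radical using WellFoundedGT.induction generalizing Z with
  | ind I ih =>
  subst hI
  have := hP.finite _ hZ
  by_cases hZloc : locPunctured M Z
  · exact ⟨Z, hZ, ⟨hZM, hZloc⟩, hZn⟩
  obtain ⟨s, hs, hsZ⟩ := SetLike.not_le_iff_exists.1 (mt (locPunctured_iff_le_radical hr).2 hZloc)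
  obtain ⟨m, π, hπ⟩ := Module.Finite.exists_fin' R Z
  exact ih _ (radical_smulFactorsIdeal_lt_fiberProduct hr hπ (hr.free m) hsZ)
    (hP.fiberProduct hπ _ (hP.free m) hZ hZ) (hrn.fiberProduct hπ _ (hrn.free m) hZM hZM)
    (not_hasResolution_fiberProduct hC hM hπ hs hZM hZn) rfl

/-- Noetherian induction on the locus where `X` is not locally in `M`, which shrinks when a free
cover of `X` is pulled back along a suitable scalar; the pullback determines `X` up to modules in
`P` because that scalar factors through `P`. -/
theorem mem_of_locPunctured_mem (hC : IsSemidualizing C) (hM : M ∈ thickGC C) (hP : IsResolving P)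
    (hle : M ≤ P) {Z X : ModuleCat.{u} R} (hZ : P Z) (hZM : HasResolution M (n + 1) Z)
    (hZn : ¬ HasResolution M n Z) (hX : HasResolution M (n + 1) X) (hXP : locPunctured P X) :
    P X := by
  have hr := hM.1.resolving
  have hrn := hr.isResolving_hasResolution (n + 1)
  obtain ⟨Z', hZ', hZ'Q, hZ'n⟩ := exists_mem_locPunctured hC hM hP hZ hZM hZn
  induction hI : (smulFactorsIdeal hr X).radical using WellFoundedGT.induction generalizing X with
  | ind I ih =>
  subst hI
  have := hrn.finite _ hX
  by_cases hXloc : locPunctured M X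
  · exact hasResolution_inf_locPunctured_le hC hM hP hle hZ' hZ'Q hZ'n _ ⟨hX, hXloc⟩
  obtain ⟨s, hs, hsX⟩ := SetLike.not_le_iff_exists.1 (mt (locPunctured_iff_le_radical hr).2 hXloc)
  obtain ⟨k, Y, a, b, hY, hab⟩ := (locPunctured_iff_le_radical hP).1 hXP hs
  obtain ⟨m, π, hπ⟩ := Module.Finite.exists_fin' R X
  have hlt := radical_smulFactorsIdeal_lt_fiberProduct (s := s ^ k) hr hπ (hr.free m) fun h =>
    hsX (Ideal.mem_radical_of_pow_mem h)
  have hloc := hP.isResolving_locPunctured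
  have hba : (s ^ k) • LinearMap.id = b ∘ₗ a := LinearMap.ext fun x => (hab x).symm
  have hF := ih _ hlt (hrn.fiberProduct hπ _ (hrn.free m) hX hX)
    (hloc.fiberProduct hπ _ (hloc.free m) hXP hXP) rfl
  rw [hba] at hF
  exact hP.of_fiberProduct_comp hπ hY hF

end LocalClassification

section LocalDimension

variable {R : Type u} [CommRing R] {M P : ObjectProperty (ModuleCat.{u} R)}

theorem SMulFactors.locMod (p : PrimeSpectrum R) {X : Type u} [AddCommGroup X] [Module R X] {s : R}
    (h : SMulFactors P X s) :
    SMulFactors (addLoc P p) (LocMod p X) (algebraMap R (LocRing p) s) := by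
  obtain ⟨W, a, b, hW, hab⟩ := h
  refine ⟨locModule W p, locMap p a, locMap p b, addLoc_of_mem p hW, fun x => ?_⟩
  have hcomp : locMap p b ∘ₗ locMap p a = algebraMap R (LocRing p) s • LinearMap.id :=
    locMod_hom_ext fun x => by
      simp only [LinearMap.comp_apply, locMap_mk, hab, LinearMap.smul_apply, LinearMap.id_apply,
        map_smul, algebraMap_smul]
  exact LinearMap.congr_fun hcomp x

theorem pdim_le_Phi {X : ModuleCat.{u} R} (hX : P X) (p : PrimeSpectrum R) :
    pdim (addLoc M p) (locModule X p) ≤ Phi M P p :=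
  le_iSup₂ (f := fun (Y : ModuleCat.{u} R) (_ : P Y) => pdim (addLoc M p) (locModule Y p)) X hX

theorem Phi_mono {Q : ObjectProperty (ModuleCat.{u} R)} (h : P ≤ Q) : Phi M P ≤ Phi M Q :=
  fun p => iSup₂_le fun X hX => pdim_le_Phi (h X hX) p

theorem le_res : P ≤ res P := le_sInf fun _ hQ => hQ.2

theorem res_le {Q : ObjectProperty (ModuleCat.{u} R)} (hQ : IsResolving Q) (h : P ≤ Q) :
    res P ≤ Q := sInf_le ⟨hQ, h⟩

theorem isResolving_res {Q : ObjectProperty (ModuleCat.{u} R)} (hQ : IsResolving Q) (h : P ≤ Q) :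
    IsResolving (res P) := isResolving_sInf ⟨Q, hQ, h⟩ fun _ hQ => hQ.1

variable [IsNoetherianRing R]

theorem locPunctured_addLoc_of_mem_minimalPrimes (hP : IsResolving P) {X : ModuleCat.{u} R}
    [Module.Finite R X] {p : PrimeSpectrum R}
    (hp : p.asIdeal ∈ (smulFactorsIdeal hP X).minimalPrimes) :
    locPunctured (addLoc P p) (locModule X p) := by
  have hPp := hP.isResolving_addLoc p
  have : Module.Finite (LocRing p) (locModule X p) :=
    inferInstanceAs (Module.Finite (LocRing p) (LocMod p X))
  have hle : (smulFactorsIdeal hP X).map (algebraMap R (LocRing p)) ≤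
      smulFactorsIdeal hPp (LocMod p X) :=
    Ideal.map_le_iff_le_comap.2 fun s hs => SMulFactors.locMod p hs
  rw [locPunctured_iff_le_radical hPp, ← IsLocalization.AtPrime.map_eq_maximalIdeal p.asIdeal,
    ← IsLocalization.AtPrime.radical_map_of_mem_minimalPrimes (LocRing p) p.asIdeal _ hp]
  exact Ideal.radical_mono hle

namespace IsResolving

variable (hM : IsResolving M)
include hM

theorem pdim_addLoc_mono {X : ModuleCat.{u} R} [Module.Finite R X] {p q : PrimeSpectrum R}
    (h : p ≤ q) : pdim (addLoc M p) (locModule X p) ≤ pdim (addLoc M q) (locModule X q) :=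
  le_iInf₂ fun n hn => (hM.pdim_addLoc_le_iff p n X).2
    ((hM.hasResolution_addLoc_iff q n X).1 hn |>.mono (locAt_antitone M h))

theorem pdim_addLoc_le {X : ModuleCat.{u} R} {n : ℕ} (hX : HasResolution M n X)
    (p : PrimeSpectrum R) : pdim (addLoc M p) (locModule X p) ≤ n := by
  have := (hM.isResolving_hasResolution n).finite _ hX
  exact (hM.pdim_addLoc_le_iff p n X).2 (hX.mono (hM.le_locIn _))

omit [IsNoetherianRing R] in
theorem locIn_top : locIn M ⊤ = ModuleCat.isFG R :=
  le_antisymm (fun _ h => h.1) fun X h => ⟨h, 0, trivial, Ideal.zero_mem (smulFactorsIdeal hM X)⟩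

theorem Lam_iff {f : PrimeSpectrum R → ℕ∞} (hf : ∀ p, f p ≠ ⊤) {X : ModuleCat.{u} R} :
    Lam M f X ↔
      ModuleCat.isFG R X ∧ ∀ p, HasResolution (locAt M p) (f p).toNat X :=
  and_congr_right fun (_ : Module.Finite R X) => forall_congr' fun p => by
    rw [← hM.pdim_addLoc_le_iff, ENat.natCast_toNat (hf p)]

theorem isResolving_Lam {f : PrimeSpectrum R → ℕ∞} (hf : ∀ p, f p ≠ ⊤) : IsResolving (Lam M f) := by
  have heq : Lam M f = sInf (insert (ModuleCat.isFG R)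
      (Set.range fun p => HasResolution (locAt M p) (f p).toNat)) := by
    ext X
    simp only [hM.Lam_iff hf, sInf_objectProperty_iff, Set.forall_mem_insert, Set.forall_mem_range]
  rw [heq]
  refine isResolving_sInf (Set.insert_nonempty _ _) ?_
  rintro _ (rfl | ⟨p, rfl⟩)
  · exact hM.locIn_top ▸ hM.isResolving_locIn ⊤
  · exact (hM.isResolving_locIn _).isResolving_hasResolution _

theorem Lam_mem_resolvingOver {f : PrimeSpectrum R → ℕ∞} (hf : ∀ p, f p ≠ ⊤) :
    Lam M f ∈ resolvingOver M := by
  refine ⟨hM.isResolving_Lam hf, fun X hX => ⟨hM.fg X hX, fun p => ?_⟩, fun X hX => ?_⟩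
  · exact (hM.pdim_addLoc_le (hM.hasResolution_zero_iff.2 hX) p).trans (by simp)
  · have : Module.Finite R X := hX.1
    exact (hM.finDim_iff X).2 <| hM.exists_hasResolution_of_forall_locAt fun p =>
      ⟨_, ((hM.Lam_iff hf).1 hX).2 p⟩

end IsResolving

end LocalDimension

section Grade

variable {R : Type u} [CommRing R]

theorem natCast_length_le_grade {I : Ideal R} (hI : I ≠ ⊤) {rs : List R} (hmem : ∀ r ∈ rs, r ∈ I)
    (hrs : RingTheory.Sequence.IsWeaklyRegular R rs) : (rs.length : ℕ∞) ≤ grade I := by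
  have hle : Ideal.ofList rs ≤ I := Ideal.span_le.2 hmem
  have hreg : RingTheory.Sequence.IsRegular R rs := ⟨hrs, fun h => hI <| eq_top_iff.2 <| by
    rwa [h, smul_eq_mul, Ideal.mul_top]⟩
  exact le_iSup₂_of_le (f := fun (rs : List R) _ => (rs.length : ℕ∞)) rs ⟨hmem, hreg⟩ le_rfl

theorem exists_isWeaklyRegular_of_lt_grade {I : Ideal R} {n : ℕ} (hn : (n : ℕ∞) < grade I) :
    ∃ rs : List R, (∀ r ∈ rs, r ∈ I) ∧ RingTheory.Sequence.IsWeaklyRegular R rs ∧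
      n < rs.length := by
  obtain ⟨rs, hrs⟩ := lt_iSup_iff.1 hn
  obtain ⟨⟨hmem, hreg⟩, hlen⟩ := lt_iSup_iff.1 hrs
  exact ⟨rs, hmem, hreg.toIsWeaklyRegular, by exact_mod_cast hlen⟩

variable {q : PrimeSpectrum R} {I : Ideal R} {z : R}

theorem algebraMap_notMem_map (h : ∀ a, a * z ∈ I → a ∈ q.asIdeal) :
    algebraMap R (LocRing q) z ∉ I.map (algebraMap R (LocRing q)) := by
  rw [IsLocalization.algebraMap_mem_map_algebraMap_iff q.asIdeal.primeCompl]
  exact fun ⟨a, ha, haz⟩ => ha (h a haz)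

theorem mul_algebraMap_mem_map (h : ∀ a ∈ q.asIdeal, a * z ∈ I) {a : LocRing q}
    (ha : a ∈ IsLocalRing.maximalIdeal (LocRing q)) :
    a * algebraMap R (LocRing q) z ∈ I.map (algebraMap R (LocRing q)) := by
  rw [← IsLocalization.AtPrime.map_eq_maximalIdeal q.asIdeal] at ha
  have hle : q.asIdeal.map (algebraMap R (LocRing q)) ≤
      (I.map (algebraMap R (LocRing q))).colon {algebraMap R (LocRing q) z} :=
    Ideal.map_le_iff_le_comap.2 fun b hb => Submodule.mem_colon_singleton.2 <| by
      rw [smul_eq_mul, ← map_mul]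
      exact Ideal.mem_map_of_mem _ (h b hb)
  exact Submodule.mem_colon_singleton.1 (hle ha)

variable [IsNoetherianRing R] {C : ModuleCat.{u} R} {M P : ObjectProperty (ModuleCat.{u} R)}
variable (hC : IsSemidualizing C) (hM : M ∈ thickGC C)
include hC hM

theorem pdim_addLoc_le_length {rs : List R} (hrs : RingTheory.Sequence.IsWeaklyRegular R rs)
    (hz : ∀ a, a ∈ q.asIdeal ↔ a * z ∈ Ideal.ofList rs) {X : ModuleCat.{u} R} (hX : finDim M X) :
    pdim (addLoc M q) (locModule X q) ≤ rs.length := by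
  have hr := hM.1.resolving
  have hrq := hr.isResolving_addLoc q
  obtain ⟨N, hN⟩ := (hr.finDim_iff X).1 hX
  have hNq := (hrq.pdim_le_iff N _).1 (hr.pdim_addLoc_le hN q)
  rw [hrq.pdim_le_iff, ← List.length_map (as := rs) (algebraMap R (LocRing q))]
  refine HasResolution.length_of_isWeaklyRegular (X := locModule X q)
    (z := algebraMap R (LocRing q) z) (hC.locModule q) (addLoc_mem_thickGC hC hM q)
    (RingTheory.Sequence.IsWeaklyRegular.of_isLocalization (LocRing q) q.asIdeal.primeCompl hrs)
    ?_ (fun a ha => ?_) hNq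
  all_goals rw [← Ideal.map_ofList]
  · exact algebraMap_notMem_map fun a => (hz a).2
  · exact mul_algebraMap_mem_map (fun b => (hz b).1) ha

/-- A weakly regular sequence that is maximal in `p` bounds the dimensions at an associated prime
of the quotient containing `p`, and the dimensions at `p` are no larger. -/
theorem exists_natCast_le_grade_forall_pdim_le (p : PrimeSpectrum R) :
    ∃ n : ℕ, (n : ℕ∞) ≤ grade p.asIdeal ∧
      ∀ X, finDim M X → pdim (addLoc M p) (locModule X p) ≤ n := by
  obtain ⟨rs, q, z, hmem, hrs, hq, hpq, -, hqz⟩ :=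
    exists_isWeaklyRegular_isPrime_ge p.isPrime.ne_top
  refine ⟨rs.length, natCast_length_le_grade p.isPrime.ne_top hmem hrs, fun X hX => ?_⟩
  have : Module.Finite R X := hX.1
  exact (hM.1.resolving.pdim_addLoc_mono (q := ⟨q, hq⟩) hpq).trans
    (pdim_addLoc_le_length hC hM hrs hqz hX)

theorem Phi_mem_gradeConsistent (hP : P ∈ resolvingOver M) : Phi M P ∈ gradeConsistent R := by
  have hbound (p : PrimeSpectrum R) : ∃ n : ℕ, (n : ℕ∞) ≤ grade p.asIdeal ∧ Phi M P p ≤ n :=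
    (exists_natCast_le_grade_forall_pdim_le hC hM p).imp fun n ⟨hn, hle⟩ =>
      ⟨hn, iSup₂_le fun X hX => hle X (hP.2.2 X hX)⟩
  refine ⟨fun p => ?_, fun p q hpq => iSup₂_le fun X hX => ?_, fun p => ?_⟩
  · obtain ⟨n, -, hn⟩ := hbound p
    exact (hn.trans_lt (ENat.natCast_lt_top n)).ne
  · have := hP.1.finite X hX
    exact (hM.1.resolving.pdim_addLoc_mono hpq).trans (pdim_le_Phi hX q)
  · obtain ⟨n, hn, hle⟩ := hbound p
    exact hle.trans hn

end Grade

section Classification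

variable {R : Type u} [CommRing R] [IsNoetherianRing R] {C : ModuleCat.{u} R}
variable {M N P : ObjectProperty (ModuleCat.{u} R)} {f : PrimeSpectrum R → ℕ∞}

theorem IsTruncatedDual.mem_Lam (hM : IsResolving M) (hMC : M C) {p : PrimeSpectrum R} {n : ℕ}
    {T : ModuleCat.{u} R} [Module.Finite R T] {τ : Abelian.Ext T C (n + 1)}
    (hT : IsTruncatedDual C p.asIdeal n T τ) (hf : Monotone f) (hn : ((n + 1 : ℕ) : ℕ∞) ≤ f p) :
    Lam M f T := by
  refine ⟨‹_›, fun q => ?_⟩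
  by_cases hpq : p ≤ q
  · exact (hM.pdim_addLoc_le (hT.hasResolution hM hMC) q).trans (hn.trans (hf hpq))
  · have hq : locAt M q T := (locAt_iff hM q).2 fun h =>
      hpq ((hT.le_smulFactorsIdeal hM hMC).trans h)
    have h0 := (hM.isResolving_locIn _).hasResolution_zero_iff.2 hq
    exact ((hM.pdim_addLoc_le_iff q 0 T).2 h0).trans (by simp)

variable (hC : IsSemidualizing C)
include hC

theorem exists_isTruncatedDual_of_lt_grade {I : Ideal R} (hI : I ≠ ⊤) {n : ℕ}
    (hn : (n : ℕ∞) < grade I) :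
    ∃ (T : ModuleCat.{u} R) (τ : Abelian.Ext T C (n + 1)),
      IsTruncatedDual C I n T τ ∧ Module.Finite R T := by
  obtain ⟨rs, hmem, hrs, hlen⟩ := exists_isWeaklyRegular_of_lt_grade hn
  obtain ⟨T, τ, hT, hfin, -⟩ := exists_isTruncatedDual (I := I) hC
    (fun j hj => hC.extVanishes_quotient hI hmem hrs hj) hlen
  exact ⟨T, τ, hT, hfin⟩

variable (hM : M ∈ thickGC C)
include hM

theorem IsTruncatedDual.lt_pdim_addLoc {p : PrimeSpectrum R} {n : ℕ} {T : ModuleCat.{u} R}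
    [Module.Finite R T] {τ : Abelian.Ext T C (n + 1)} (hT : IsTruncatedDual C p.asIdeal n T τ) :
    n < pdim (addLoc M p) (locModule T p) := by
  rw [← not_le, hM.1.resolving.pdim_addLoc_le_iff]
  intro h
  obtain ⟨s, hs, hsp⟩ := hT.exists_mem_of_hasResolution_locIn hC hM h
  exact hs hsp

theorem Phi_Lam (hf : f ∈ gradeConsistent R) : Phi M (Lam M f) = f := by
  refine funext fun p => le_antisymm (iSup₂_le fun X hX => hX.2 p) ?_
  refine ENat.forall_natCast_le_iff_le.1 fun n hn => ?_
  obtain _ | n := n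
  · exact zero_le
  have hgrade : (n : ℕ∞) < grade p.asIdeal :=
    lt_of_lt_of_le (by exact_mod_cast n.lt_succ_self) (hn.trans (hf.2.2 p))
  obtain ⟨T, τ, hT, hfin⟩ := exists_isTruncatedDual_of_lt_grade hC p.isPrime.ne_top hgrade
  calc ((n + 1 : ℕ) : ℕ∞) ≤ pdim (addLoc M p) (locModule T p) :=
        Order.add_one_le_of_lt (hT.lt_pdim_addLoc hC hM)
    _ ≤ Phi M (Lam M f) p := pdim_le_Phi (hT.mem_Lam hM.1.resolving hM.2 hf.2.1 hn) p

theorem addLoc_of_locPunctured (hP : P ∈ resolvingOver M) {p : PrimeSpectrum R}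
    {X : ModuleCat.{u} R} (hX : pdim (addLoc M p) (locModule X p) ≤ Phi M P p)
    (hXP : locPunctured (addLoc P p) (locModule X p)) : addLoc P p (locModule X p) := by
  have hrp := hM.1.resolving.isResolving_addLoc p
  have hle := addLoc_mono hP.2.1 p
  obtain ⟨n, hn⟩ := ENat.ne_top_iff_exists.1 ((Phi_mem_gradeConsistent hC hM hP).1 p)
  rw [← hn, hrp.pdim_le_iff] at hX
  obtain _ | n := n
  · exact hle _ (hrp.hasResolution_zero_iff.1 hX)
  obtain ⟨Y, hY, hYn⟩ : ∃ Y, P Y ∧ ¬ HasResolution (addLoc M p) n (locModule Y p) := by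
    by_contra! hcon
    have hle : Phi M P p ≤ n := iSup₂_le fun Y hY => (hrp.pdim_le_iff n _).2 (hcon Y hY)
    rw [← hn] at hle
    exact n.lt_irrefl (by exact_mod_cast hle)
  have hYM : HasResolution (addLoc M p) (n + 1) (locModule Y p) := by
    rw [← hrp.pdim_le_iff, hn]
    exact pdim_le_Phi hY p
  exact mem_of_locPunctured_mem (hC.locModule p) (addLoc_mem_thickGC hC hM p)
    (hP.1.isResolving_addLoc p) hle (addLoc_of_mem p hY) hYM hYn hX hXP

theorem Lam_Phi (hP : P ∈ resolvingOver M) : Lam M (Phi M P) = P := by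
  have hPr := hP.1
  refine le_antisymm (fun X hX => ?_) fun X hX => ⟨hPr.fg X hX, pdim_le_Phi hX⟩
  have hfin : Module.Finite R X := hX.1
  by_contra hXP
  have hne : smulFactorsIdeal hPr X ≠ ⊤ := fun h =>
    hXP ((smulFactors_one_iff hPr).1 ((Ideal.eq_top_iff_one _).1 h))
  obtain ⟨p, hp⟩ := Ideal.nonempty_minimalPrimes hne
  let p' : PrimeSpectrum R := ⟨p, hp.1.1⟩
  have hXp : addLoc P p' (locModule X p') := addLoc_of_locPunctured hC hM hP (hX.2 p')
    (locPunctured_addLoc_of_mem_minimalPrimes hPr hp)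
  exact (locAt_iff hPr p').1 ((hPr.addLoc_locMod_iff p').1 hXp) hp.1.2

theorem Lam_inf_GC (hf : ∀ p, f p ≠ ⊤) : Lam M f ⊓ GC C = M := by
  have hL := hM.1.resolving.Lam_mem_resolvingOver hf
  refine le_antisymm (fun X hX => ?_) (le_inf hL.2.1 hM.1.le)
  obtain ⟨n, hn⟩ := (hM.1.resolving.finDim_iff X).1 (hL.2.2 X hX.1)
  exact (mem_iff_GC_of_hasResolution (X := X) hC hM hn).2 hX.2

omit hM in
theorem Lam_bijOn :
    Set.BijOn (fun q : ObjectProperty (ModuleCat.{u} R) × (PrimeSpectrum R → ℕ∞) => Lam q.1 q.2)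
      (thickGC C ×ˢ gradeConsistent R) (⋃ M ∈ thickGC C, resolvingOver M) := by
  refine ⟨?_, ?_, ?_⟩
  · rintro ⟨M, f⟩ ⟨hM, hf⟩
    exact Set.mem_biUnion hM (hM.1.resolving.Lam_mem_resolvingOver hf.1)
  · rintro ⟨M, f⟩ ⟨hM, hf⟩ ⟨N, g⟩ ⟨hN, hg⟩ (h : Lam M f = Lam N g)
    obtain rfl : M = N := calc
      M = Lam M f ⊓ GC C := (Lam_inf_GC hC hM hf.1).symm
      _ = N := by rw [h, Lam_inf_GC hC hN hg.1]
    have hfg : f = g := calc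
      f = Phi M (Lam M f) := (Phi_Lam hC hM hf).symm
      _ = g := by rw [h, Phi_Lam hC hM hg]
    rw [hfg]
  · intro P hP
    obtain ⟨M, hM, hP⟩ := Set.mem_iUnion₂.1 hP
    exact ⟨(M, Phi M P), ⟨hM, Phi_mem_gradeConsistent hC hM hP⟩, Lam_Phi hC hM hP⟩

variable (hN : N ∈ thickGC C) (hMN : M ≤ N)
include hN hMN

theorem pdim_eq_of_le {X : ModuleCat.{u} R} {n : ℕ} (hX : HasResolution M n X) :
    pdim M X = pdim N X :=
  iInf_congr fun k => iInf_congr_Prop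
    ((hasResolution_iff_extVanishesAbove (X := X) hC hM hX k).trans
      (hasResolution_iff_extVanishesAbove (X := X) hC hN (hX.mono hMN) k).symm) fun _ => rfl

theorem pdim_addLoc_eq_of_le {X : ModuleCat.{u} R} (hX : finDim M X) (p : PrimeSpectrum R) :
    pdim (addLoc M p) (locModule X p) = pdim (addLoc N p) (locModule X p) := by
  have hr := hM.1.resolving
  obtain ⟨n, hn⟩ := (hr.finDim_iff X).1 hX
  exact pdim_eq_of_le (hC.locModule p) (addLoc_mem_thickGC hC hM p) (addLoc_mem_thickGC hC hN p)
    (addLoc_mono hMN p) (((hr.isResolving_addLoc p).pdim_le_iff n _).1 (hr.pdim_addLoc_le hn p))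

theorem rho_Lam (hf : ∀ p, f p ≠ ⊤) : rho M N (Lam N f) = Lam M f := by
  have hpdim {X : ModuleCat.{u} R} (hX : finDim M X) : Lam N f X ↔ Lam M f X := by
    simp only [Lam, pdim_addLoc_eq_of_le hC hM hN hMN hX]
  refine le_antisymm (fun X hX => (hpdim hX.2).1 hX.1) fun X hX => ?_
  have hfin := (hM.1.resolving.Lam_mem_resolvingOver hf).2.2 X hX
  exact ⟨(hpdim hfin).2 hX, hfin⟩

theorem Lam_le_of_le (hf : ∀ p, f p ≠ ⊤) : Lam M f ≤ Lam N f := by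
  rw [← rho_Lam hC hM hN hMN hf]
  exact inf_le_left

theorem Phi_eq_of_le (hP : P ≤ finDim M) : Phi M P = Phi N P :=
  funext fun p => biSup_congr fun _ hX => pdim_addLoc_eq_of_le hC hM hN hMN (hP _ hX) p

theorem eta_Lam (hf : f ∈ gradeConsistent R) : eta M N (Lam M f) = Lam N f := by
  have hL := hM.1.resolving.Lam_mem_resolvingOver hf.1
  have hLN := hN.1.resolving.Lam_mem_resolvingOver hf.1
  have hsup : Lam M f ⊔ N ≤ Lam N f := sup_le (Lam_le_of_le hC hM hN hMN hf.1) hLN.2.1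
  have hle : eta M N (Lam M f) ≤ Lam N f := res_le hLN.1 hsup
  have hge : Lam M f ⊔ N ≤ eta M N (Lam M f) := le_res
  have hmem : eta M N (Lam M f) ∈ resolvingOver N :=
    ⟨isResolving_res hLN.1 hsup, le_sup_right.trans hge, hle.trans hLN.2.2⟩
  have hPhi : Phi N (eta M N (Lam M f)) = f := le_antisymm
    (calc Phi N (eta M N (Lam M f)) ≤ Phi N (Lam N f) := Phi_mono hle
      _ = f := Phi_Lam hC hN hf)
    (calc f = Phi M (Lam M f) := (Phi_Lam hC hM hf).symm
      _ = Phi N (Lam M f) := Phi_eq_of_le hC hM hN hMN hL.2.2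
      _ ≤ Phi N (eta M N (Lam M f)) := Phi_mono (le_sup_left.trans hge))
  rw [← Lam_Phi hC hN hmem, hPhi]

theorem eta_eq_Lam_Phi (hP : P ∈ resolvingOver M) : eta M N P = Lam N (Phi M P) := by
  rw [← eta_Lam hC hM hN hMN (Phi_mem_gradeConsistent hC hM hP), Lam_Phi hC hM hP]

theorem rho_eq_Lam_Phi (hP : P ∈ resolvingOver N) : rho M N P = Lam M (Phi N P) := by
  rw [← rho_Lam hC hM hN hMN (Phi_mem_gradeConsistent hC hN hP).1, Lam_Phi hC hN hP]

theorem eta_mem_resolvingOver (hP : P ∈ resolvingOver M) : eta M N P ∈ resolvingOver N := by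
  rw [eta_eq_Lam_Phi hC hM hN hMN hP]
  exact hN.1.resolving.Lam_mem_resolvingOver (Phi_mem_gradeConsistent hC hM hP).1

theorem rho_mem_resolvingOver (hP : P ∈ resolvingOver N) : rho M N P ∈ resolvingOver M := by
  rw [rho_eq_Lam_Phi hC hM hN hMN hP]
  exact hM.1.resolving.Lam_mem_resolvingOver (Phi_mem_gradeConsistent hC hN hP).1

theorem Phi_eta (hP : P ∈ resolvingOver M) : Phi N (eta M N P) = Phi M P := by
  rw [eta_eq_Lam_Phi hC hM hN hMN hP, Phi_Lam hC hN (Phi_mem_gradeConsistent hC hM hP)]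

theorem Phi_rho (hP : P ∈ resolvingOver N) : Phi M (rho M N P) = Phi N P := by
  rw [rho_eq_Lam_Phi hC hM hN hMN hP, Phi_Lam hC hM (Phi_mem_gradeConsistent hC hN hP)]

theorem rho_eta_invOn :
    Set.InvOn (rho M N) (eta M N) (resolvingOver M) (resolvingOver N) := by
  refine ⟨fun P hP => ?_, fun P hP => ?_⟩
  · rw [rho_eq_Lam_Phi hC hM hN hMN (eta_mem_resolvingOver hC hM hN hMN hP),
      Phi_eta hC hM hN hMN hP, Lam_Phi hC hM hP]
  · rw [eta_eq_Lam_Phi hC hM hN hMN (rho_mem_resolvingOver hC hM hN hMN hP),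
      Phi_rho hC hM hN hMN hP, Lam_Phi hC hN hP]

end Classification

end ResolvingSubcat

theorem theoremB {R : Type u} [CommRing R] [IsNoetherianRing R] (C : ModuleCat.{u} R)
    (hC : IsSemidualizing C) :
    -- the smallest thick subcategory `A` of `G_C` containing `C` exists
    IsLeast (thickGC C) (minThick C) ∧
    -- every thick subcategory of `G_C` containing `C` belongs to `S(C)`
    thickGC C ⊆ SC C ∧
    -- `Λ_M` and `Φ_M` are mutually inverse bijections
    (∀ M ∈ SC C,
      Set.MapsTo (Lam M) (gradeConsistent R) (resolvingOver M) ∧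
      Set.MapsTo (Phi M) (resolvingOver M) (gradeConsistent R) ∧
      Set.InvOn (Phi M) (Lam M) (gradeConsistent R) (resolvingOver M)) ∧
    -- `Λ` is a bijection from `S(C) × Γ` onto the union of the `R(M)`
    Set.BijOn (fun q : ObjectProperty (ModuleCat.{u} R) × (PrimeSpectrum R → ℕ∞) => Lam q.1 q.2)
      (SC C ×ˢ gradeConsistent R) (⋃ M ∈ SC C, resolvingOver M) ∧
    -- for `M ⊆ N` the maps `η_M^N` and `ρ_M^N` are mutually inverse and commute with the `Φ`'s
    (∀ M ∈ SC C, ∀ N ∈ SC C, M ≤ N →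
      Set.MapsTo (eta M N) (resolvingOver M) (resolvingOver N) ∧
      Set.MapsTo (rho M N) (resolvingOver N) (resolvingOver M) ∧
      Set.InvOn (rho M N) (eta M N) (resolvingOver M) (resolvingOver N) ∧
      (∀ X ∈ resolvingOver M, Phi N (eta M N X) = Phi M X) ∧
      (∀ X ∈ resolvingOver N, Phi M (rho M N X) = Phi N X)) ∧
    -- the lower triangle of the diagram
    (∀ M ∈ SC C, ∀ X ∈ resolvingOver (minThick C),
      eta (minThick C) M X ∈ resolvingOver M ∧
      Phi M (eta (minThick C) M X) = Phi (minThick C) X) := by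
  rw [SC_eq_thickGC hC]
  have hA := isLeast_minThick hC
  exact ⟨hA, subset_rfl,
    fun M hM => ⟨fun _ hf => hM.1.resolving.Lam_mem_resolvingOver hf.1,
      fun _ hP => Phi_mem_gradeConsistent hC hM hP,
      fun _ hf => Phi_Lam hC hM hf, fun _ hP => Lam_Phi hC hM hP⟩,
    Lam_bijOn hC,
    fun M hM N hN hMN => ⟨fun _ hP => eta_mem_resolvingOver hC hM hN hMN hP,
      fun _ hP => rho_mem_resolvingOver hC hM hN hMN hP, rho_eta_invOn hC hM hN hMN,
      fun _ hP => Phi_eta hC hM hN hMN hP, fun _ hP => Phi_rho hC hM hN hMN hP⟩,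
    fun M hM P hP => ⟨eta_mem_resolvingOver hC hA.1 hM (hA.2 hM) hP,
      Phi_eta hC hA.1 hM (hA.2 hM) hP⟩⟩
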